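/- **Setting.** For $n\ge 1$ consider the $n\times n$ square lattice with $N=n^2$ vertices and open boundary conditions, a fixed physical dimension $d\ge1$ and a bond dimension $D=D(N)\ge 1$ bounded by a polynomial in $N$. PEPS data is a family $P=(P^{[v]})_v$ of linear maps $P^{[v]}:(\mathbb C^{D})^{\otimes 4}\to\mathbb C^d$, that is, $D^4dN$ complex numbers. The associated unnormalized PEPS $|\psi\rangle\in(\mathbb C^d)^{\otimes N}$ is obtained by applying all $P^{[v]}$ to the product of the unnormalized maximally entangled pairs $\sum_{a=0}^{D-1}|a\rangle|a\rangle$ on the edges, with the legs at the boundary in the state $|0\rangle$. *Problem 1:* given $P$, compute $\langle\psi|\psi\rangle$. *Problem 2:* given $P$ and an observable $\hat A$ (a Hermitian operator acting on $k$ sites, $k$ a constant), compute $\langle\psi|\hat A|\psi\rangle$. Let $\sigma>0$ be a polynomial-time computable real number (for instance a rational number). Let $\mathcal P_1$ and $\mathcal P_2$ be the distributions of PEPS data for which the real and imaginary parts of all the entries are independent and, respectively, uniform on $[-\sigma,\sigma]$ or normal with mean $0$ and standard deviation $\sigma$. A number of precision $b$ is one whose real and imaginary parts are integer multiples of $2^{-b}$;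 it is an *$s$-bit number* if in addition $b=s$ and these parts are at most $2^{s}$ in absolute value. Machines work on such binary data, with running times measured in bit operations up to polynomial factors. **Theorem 2 (worst-to-average reduction).** Fix one of the two problems, $i\in\{1,2\}$, and $d$, $D(\cdot)$, $\sigma$ (and $k$) as above. For all polynomials $s$ and $q$ there are polynomials $p_0,b_0$ such that the following holds for all polynomials $p\ge p_0$ and $b\ge b_0$. Suppose that there is a deterministic polynomial-time machine $\mathcal O$ such that for every $n\ge1$ (and, in Problem 2, for every observable $\hat A$ on $k$ sites with $s(N)$-bit matrix entries), when PEPS data is drawn from $\mathcal P_i$ and rounded down to precision $b(N)$, with probability at least $1-\frac1{12N}$ the output of $\mathcal O$ on the rounded instance differs from the solution of that instance by at most $2^{-p(N)}$. Then for every polynomial $e$ there is a randomized polynomial-time machine $\mathcal O'$ (using fair coin tosses) such that for every $n\ge1$ and every instance of the same problem on the $n\times n$ lattice whose PEPS data (and observable, on $k$ sites) consists of $s(N)$-bit numbers, the output of $\mathcal O'$ differs from the solution by at most $2^{-q(N)}$ with probability at least $1-2^{-e(N)}$. -/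

import Mathlib

open MeasureTheory ProbabilityTheory
open scoped Matrix

namespace PEPS

/-! ## Machines

Programs act on finite trees whose leaves are binary integers.  Each operation is charged at least
the bit size of its argument, and an elementary operation also the bit size of its result, so
polynomial time is the same as for Turing machines. -/

/-- The data handled by programs. -/
inductive Val : Type
  | int (z : ℤ) : Val
  | pair (a b : Val) : Val

namespace Val

/-- Bit size of a value. -/
def size : Val → ℕ
  | int z => Nat.size z.natAbs + 1
  | pair a b => a.size + b.size + 1

/-- The integer at a leaf (`0` for a pair). -/
def toInt : Val → ℤ
  | int z => z
  | pair _ _ => 0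

/-- First component (`0` for a leaf). -/
def fst : Val → Val
  | int _ => int 0
  | pair a _ => a

/-- Second component (`0` for a leaf). -/
def snd : Val → Val
  | int _ => int 0
  | pair _ b => b

/-- `1` for a pair, `0` for a leaf. -/
def isPair : Val → Val
  | int _ => int 0
  | pair _ _ => int 1

/-- A pair of integers read as numerator and denominator of a rational number. -/
def toRat (v : Val) : ℚ := (v.fst.toInt : ℚ) / (v.snd.toInt : ℚ)

/-- Lists as right-nested pairs that end in the leaf `0`. -/
def ofList : List Val → Val
  | [] => int 0
  | a :: l => pair a (ofList l)

end Val

/-- Elementary operations. -/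
inductive Prim : Type
  | id
  | const (z : ℤ)
  | fst
  | snd
  | isPair
  | add
  | sub
  | mul
  | div

/-- Arithmetic operations act on the two components of their argument. -/
def Prim.eval : Prim → Val → Val
  | .id, x => x
  | .const z, _ => .int z
  | .fst, x => x.fst
  | .snd, x => x.snd
  | .isPair, x => x.isPair
  | .add, x => .int (x.fst.toInt + x.snd.toInt)
  | .sub, x => .int (x.fst.toInt - x.snd.toInt)
  | .mul, x => .int (x.fst.toInt * x.snd.toInt)
  | .div, x => .int (x.fst.toInt / x.snd.toInt)

/-- Programs: elementary operations, pairing of two results, composition (`comp f g` runs `g`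
first), branching, and while loops.  A test succeeds if it returns a positive integer. -/
inductive Prog : Type
  | prim (o : Prim)
  | pair (f g : Prog)
  | comp (f g : Prog)
  | cond (c f g : Prog)
  | loop (c f : Prog)

/-- `P.Runs x y t`: started on `x`, the program `P` halts with output `y` after cost `t`. -/
inductive Prog.Runs : Prog → Val → Val → ℕ → Prop
  | prim (o : Prim) (x : Val) :
      Runs (.prim o) x (o.eval x) (1 + x.size + (o.eval x).size)
  | pair {f g : Prog} {x y z : Val} {t u : ℕ} (hf : Runs f x y t) (hg : Runs g x z u) :
      Runs (.pair f g) x (.pair y z) (1 + x.size + t + u)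
  | comp {f g : Prog} {x y z : Val} {t u : ℕ} (hg : Runs g x y t) (hf : Runs f y z u) :
      Runs (.comp f g) x z (1 + x.size + t + u)
  | cond_pos {c f g : Prog} {x w y : Val} {t u : ℕ} (hc : Runs c x w t) (hw : 0 < w.toInt)
      (hf : Runs f x y u) : Runs (.cond c f g) x y (1 + x.size + t + u)
  | cond_neg {c f g : Prog} {x w y : Val} {t u : ℕ} (hc : Runs c x w t) (hw : ¬ 0 < w.toInt)
      (hg : Runs g x y u) : Runs (.cond c f g) x y (1 + x.size + t + u)
  | loop_stop {c f : Prog} {x w : Val} {t : ℕ} (hc : Runs c x w t) (hw : ¬ 0 < w.toInt) :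
      Runs (.loop c f) x x (1 + x.size + t)
  | loop_step {c f : Prog} {x w y z : Val} {t u r : ℕ} (hc : Runs c x w t) (hw : 0 < w.toInt)
      (hf : Runs f x y u) (hl : Runs (.loop c f) y z r) :
      Runs (.loop c f) x z (1 + x.size + t + u + r)

/-- `σ` is a polynomial-time computable real number: `m` binary digits of `σ` can be found in time
polynomial in `m`. -/
def PolyTimeReal (σ : ℝ) : Prop :=
  ∃ (P : Prog) (T : Polynomial ℕ), ∀ m : ℕ, ∃ (z : ℤ) (t : ℕ),
    P.Runs (.int (2 ^ m)) (.int z) t ∧ t ≤ T.eval m ∧ |(z : ℝ) - σ * 2 ^ m| ≤ 1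

/-! ## PEPS on the `n × n` square lattice -/

/-- Indices of the entries of PEPS data on the `n × n` lattice with bond dimension `D` and physical
dimension `d`: row and column of the vertex, then the virtual indices on its left, right, upper and
lower leg, then the physical index. -/
abbrev Idx (n D d : ℕ) : Type :=
  Fin n × Fin n × Fin D × Fin D × Fin D × Fin D × Fin d

/-- Configurations of the physical spins: the computational basis of `(ℂ^d)^{⊗ n²}`. -/
abbrev Config (n d : ℕ) : Type := Fin n × Fin n → Fin d

/-- The PEPS with data `P`, as a vector of the physical Hilbert space: the result of applying
all the maps `P^{[v]} : (ℂ^D)^{⊗4} → ℂ^d` to the unnormalized maximally entangled pairs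
`∑ₐ |a⟩|a⟩` on the edges.  The open boundary legs are in the state `|0⟩`.  Here `h i j` is the
virtual index on the horizontal edge between the columns `j - 1` and `j` of row `i`, and `v i j`
the one on the vertical edge between the rows `i - 1` and `i` of column `j`. -/
noncomputable def state {n D d : ℕ} (P : Idx n D d → ℂ) : Config n d → ℂ := fun x =>
  ∑ h : Fin n → Fin (n + 1) → Fin D, ∑ v : Fin (n + 1) → Fin n → Fin D,
    if (∀ i, (h i 0 : ℕ) = 0 ∧ (h i (Fin.last n) : ℕ) = 0) ∧
        (∀ j, (v 0 j : ℕ) = 0 ∧ (v (Fin.last n) j : ℕ) = 0) then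
      ∏ i : Fin n, ∏ j : Fin n,
        P (i, j, h i j.castSucc, h i j.succ, v i.castSucc j, v i.succ j, x (i, j))
    else 0

/-! ## Finite precision -/

/-- The complex number with real and imaginary part `z.1 / 2 ^ b` and `z.2 / 2 ^ b`. -/
noncomputable def toComplex (b : ℕ) (z : ℤ × ℤ) : ℂ :=
  ((z.1 : ℂ) + (z.2 : ℂ) * Complex.I) / 2 ^ b

/-- Rounding of a complex number, given by real and imaginary part, to the grid of mesh `2^{-b}`. -/
noncomputable def round (b : ℕ) (w : ℝ × ℝ) : ℤ × ℤ :=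
  (⌊2 ^ b * w.1⌋, ⌊2 ^ b * w.2⌋)

/-- `z / 2 ^ s` has at most `s` binary digits before the point (in each component). -/
def Bounded (s : ℕ) (z : ℤ × ℤ) : Prop := |z.1| ≤ 2 ^ (2 * s) ∧ |z.2| ≤ 2 ^ (2 * s)

/-- Local observables: Hermitian operators on `k` of the `n²` sites, given by a matrix whose
entries have `s` binary digits before and after the point. -/
structure LocalObservable (k n d s : ℕ) : Type where
  site : Fin k ↪ Fin n × Fin n
  entry : (Fin k → Fin d) → (Fin k → Fin d) → ℤ × ℤ
  bounded : ∀ a c, Bounded s (entry a c)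
  hermitian : (Matrix.of fun a c => toComplex s (entry a c)).IsHermitian

/-- The operator on the physical Hilbert space: it acts as the identity on the other sites. -/
noncomputable def LocalObservable.toMatrix {k n d s : ℕ} (A : LocalObservable k n d s) :
    Matrix (Config n d) (Config n d) ℂ := open Classical in
  Matrix.of fun x y =>
    if ∀ v, v ∉ Set.range A.site → x v = y v then
      toComplex s (A.entry (fun a => x (A.site a)) (fun a => y (A.site a)))
    else 0

/-- The two problems: to compute `⟨ψ|ψ⟩`, and to compute `⟨ψ|A|ψ⟩` for a given observable `A`
on `k` sites. -/
inductive Task : Type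
  | contraction : Task
  | expectation (k : ℕ) : Task

/-- The part of the input beyond the PEPS data. -/
def Task.Obs : Task → (n d s : ℕ) → Type
  | .contraction, _, _, _ => Unit
  | .expectation k, n, d, s => LocalObservable k n d s

/-- The quantity to be computed. -/
noncomputable def Task.value {n D d s : ℕ} (P : Idx n D d → ℂ) : (τ : Task) → τ.Obs n d s → ℂ
  | .contraction, _ => star (state P) ⬝ᵥ state P
  | .expectation _, A => star (state P) ⬝ᵥ (LocalObservable.toMatrix A *ᵥ state P)

/-! ## Encoding of the inputs -/

/-- A pair of integers as a value. -/
def encInt2 (z : ℤ × ℤ) : Val := .pair (.int z.1) (.int z.2)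

/-- All indices, in lexicographic order. -/
def idxList (n D d : ℕ) : List (Idx n D d) :=
  List.finRange n ×ˢ (List.finRange n ×ˢ (List.finRange D ×ˢ (List.finRange D ×ˢ
    (List.finRange D ×ˢ (List.finRange D ×ˢ List.finRange d)))))

/-- The list of all basis states of `k` spins. -/
def basisList (k d : ℕ) : List (Fin k → Fin d) :=
  (List.finRange (d ^ k)).map finFunctionFinEquiv.symm

/-- Encoding of an observable: precision, sites, matrix row by row. -/
def LocalObservable.encode {k n d s : ℕ} (A : LocalObservable k n d s) : Val :=
  .pair (.int s) (.pair
    (.ofList ((List.finRange k).map fun a => encInt2 ((A.site a).1.val, (A.site a).2.val)))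
    (.ofList ((basisList k d).map fun a =>
      .ofList ((basisList k d).map fun c => encInt2 (A.entry a c)))))

/-- Encoding of the part of the input beyond the PEPS data. -/
def Task.encodeObs {n d s : ℕ} : (τ : Task) → τ.Obs n d s → Val
  | .contraction, _ => .int 0
  | .expectation _, A => LocalObservable.encode A

/-- Encoding of an instance: PEPS data `X / 2 ^ b` and, possibly, an observable. -/
def encode {n D d s : ℕ} (τ : Task) (b : ℕ) (X : Idx n D d → ℤ × ℤ) (A : τ.Obs n d s) : Val :=
  .pair (.int n) (.pair (.int D) (.pair (.int d) (.pair (.int b) (.pair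
    (.ofList ((idxList n D d).map fun i => encInt2 (X i))) (τ.encodeObs A)))))

/-- `y` is correct up to `2^{-p}` on the instance. -/
def Accurate {n D d s : ℕ} (τ : Task) (b p : ℕ) (X : Idx n D d → ℤ × ℤ) (A : τ.Obs n d s)
    (y : Val) : Prop :=
  ‖((y.toRat : ℚ) : ℂ) - τ.value (fun i => toComplex b (X i)) A‖ ≤ (1 / 2 : ℝ) ^ p

/-! ## Random PEPS data -/

/-- The two choices for the distribution of the entries. -/
inductive Ensemble : Type
  | uniform : Ensemble
  | gaussian : Ensemble

/-- Law of the real and of the imaginary part of an entry: uniform on `[-σ, σ]`, or normal with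
mean `0` and standard deviation `σ`. -/
noncomputable def Ensemble.law : Ensemble → ℝ → Measure ℝ
  | .uniform, σ => volume[|Set.Icc (-σ) σ]
  | .gaussian, σ => gaussianReal 0 (σ ^ 2).toNNReal

/-- The law of random PEPS data: all the real and imaginary parts of the entries are
independent. -/
noncomputable def Ensemble.dataLaw (E : Ensemble) (σ : ℝ) (n D d : ℕ) :
    Measure (Idx n D d → ℝ × ℝ) :=
  Measure.pi fun _ => (E.law σ).prod (E.law σ)

/-! ## Solving a problem on average and in the worst case

In both definitions `N = n²` is the number of sites. -/

/-- The deterministic program `O` runs in polynomial time on the instances with precision `b(N)`,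
and, on PEPS data drawn from the ensemble and rounded to precision `b(N)`, its output
is correct up to `2^{-p(N)}` with probability at least `1 - 1 / (12 N)`, for each observable. -/
def SolvesOnAverage (τ : Task) (E : Ensemble) (σ : ℝ) (d : ℕ) (D : ℕ → ℕ)
    (s b p : Polynomial ℕ) (O : Prog) : Prop :=
  (∃ T : Polynomial ℕ, ∀ n : ℕ, 1 ≤ n → ∀ (X : Idx n (D (n ^ 2)) d → ℤ × ℤ)
      (A : τ.Obs n d (s.eval (n ^ 2))), ∃ (y : Val) (t : ℕ),
      O.Runs (encode τ (b.eval (n ^ 2)) X A) y t ∧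
        t ≤ T.eval (encode τ (b.eval (n ^ 2)) X A).size) ∧
  ∀ n : ℕ, 1 ≤ n → ∀ A : τ.Obs n d (s.eval (n ^ 2)),
    1 - 1 / (12 * ((n ^ 2 : ℕ) : ℝ)) ≤
      (E.dataLaw σ n (D (n ^ 2)) d).real {W | ∃ (y : Val) (t : ℕ),
        O.Runs (encode τ (b.eval (n ^ 2)) (fun i => round (b.eval (n ^ 2)) (W i)) A) y t ∧
        Accurate τ (b.eval (n ^ 2)) (p.eval (n ^ 2))
          (fun i => round (b.eval (n ^ 2)) (W i)) A y}

/-- The program `Q` uses `c(N)` fair coin tosses, given to it as a uniformly random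
integer in `[0, 2^{c(N)})` next to the instance.  It runs in polynomial time, and on each instance
with `s(N)` binary digits before and after the point its output is correct up to `2^{-q(N)}` with
probability at least `1 - 2^{-e(N)}` over the coin tosses. -/
def SolvesAllInstances (τ : Task) (d : ℕ) (D : ℕ → ℕ) (s q e : Polynomial ℕ) (Q : Prog) : Prop :=
  ∃ c T : Polynomial ℕ, ∀ n : ℕ, 1 ≤ n → ∀ (X : Idx n (D (n ^ 2)) d → ℤ × ℤ),
    (∀ i, Bounded (s.eval (n ^ 2)) (X i)) → ∀ A : τ.Obs n d (s.eval (n ^ 2)),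
      (∀ r : Fin (2 ^ c.eval (n ^ 2)), ∃ (y : Val) (t : ℕ),
        Q.Runs (.pair (encode τ (s.eval (n ^ 2)) X A) (.int (r : ℕ))) y t ∧
          t ≤ T.eval (encode τ (s.eval (n ^ 2)) X A).size) ∧
      1 - (1 / 2 : ℝ) ^ e.eval (n ^ 2) ≤
        (Set.ncard {r : Fin (2 ^ c.eval (n ^ 2)) | ∃ (y : Val) (t : ℕ),
          Q.Runs (.pair (encode τ (s.eval (n ^ 2)) X A) (.int (r : ℕ))) y t ∧
          Accurate τ (s.eval (n ^ 2)) (q.eval (n ^ 2)) X A y} : ℝ) / 2 ^ c.eval (n ^ 2)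

end PEPS

namespace PEPS

/-! ## Execution of programs -/

/-! Let N = n², M = 2N, and let X be the worst-case data. For data P and real t, each site
contributes one factor linear in t to the amplitudes of the PEPS with data P + tX, and conjugation
keeps polynomials in a real variable polynomial. So the quantity sought, taken at P + tX, is a
polynomial in t of degree at most M whose coefficient of t^M is the solution for X
(`value_polyTop`). Its M-th finite difference over the nodes jδ, j ≤ M, with δ = 2^(-a), equals M!
δ^M times that coefficient (`PolyTop.sum_choose`). Answers with error 2^(-g) therefore give the
solution up to a factor of order 2^M 2^(aM) in the error, and polynomially many bits g suffice.

The nodes have to look like samples of the ensemble. Let I bound the number of entries. Then δ is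
chosen so small that sampling and shifting one coordinate raises the probability of a grid cell by a
factor of at most e^(1/(8I)) (`Ensemble.domination`), and over at most 2I coordinates by at most
e^(1/4) ≤ 4/3 (`card_sampleData_le`). Only this one-sided comparison is needed, so the sampler may
miss the tails of the ensemble. Each of the 2N + 1 ≤ 3N queries then fails with probability at most
(4/3)/(12N), and the whole line with probability at most 1/3 (`Reduction.card_bad_le`).

The sampler must use coins and integers only. For the uniform ensemble it takes uniform integers in
a slightly smaller interval. For the Gaussian one it takes the centred median of 2m + 1 uniform
integers in [0, 2A): the weight of a is essentially ((a + 1)(2A - a))^m, which is close to a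
multiple of exp(-m z²/A²), and m = 2k², A = 2kζ give standard deviation ζ (`gaussian_domination`).
The uniform integers are the base-2A digits of one random integer below 2^c; this at most doubles
probabilities (`card_digit_le`).

Finally, a median of 2ρ + 1 repetitions is accurate as soon as the majority is (`median_mem`), and a
bad majority is exponentially unlikely in ρ (`card_majority_le`). The running time is handled by
closure properties of `PT`: composition, arithmetic, branching and bounded iteration, from which the
program is assembled (`Reduction.pt_result`). -/

theorem Prog.Runs.det {P : Prog} {x y : Val} {t : ℕ} (h : P.Runs x y t) :
    ∀ {y' : Val} {t' : ℕ}, P.Runs x y' t' → y = y' := by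
  induction h with
  | prim o x => intro y' t' h'; cases h'; rfl
  | pair _ _ ih1 ih2 =>
    intro y' t' h'
    cases h' with
    | pair h1 h2 => rw [ih1 h1, ih2 h2]
  | comp _ _ ih1 ih2 =>
    intro y' t' h'
    cases h' with
    | comp h1 h2 =>
      have := ih1 h1
      subst this
      exact ih2 h2
  | cond_pos _ hw _ ih1 ih2 =>
    intro y' t' h'
    cases h' with
    | cond_pos h1 _ h2 => exact ih2 h2
    | cond_neg h1 hw' h2 => exact absurd hw (ih1 h1 ▸ hw')
  | cond_neg _ hw _ ih1 ih2 =>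
    intro y' t' h'
    cases h' with
    | cond_pos h1 hw' h2 => exact absurd (ih1 h1 ▸ hw') hw
    | cond_neg h1 _ h2 => exact ih2 h2
  | loop_stop _ hw ih1 =>
    intro y' t' h'
    cases h' with
    | loop_stop _ _ => rfl
    | loop_step h1 hw' _ _ => exact absurd (ih1 h1 ▸ hw') hw
  | loop_step _ hw _ _ ih1 ih2 ih3 =>
    intro y' t' h'
    cases h' with
    | loop_stop h1 hw' => exact absurd hw (ih1 h1 ▸ hw')
    | loop_step _ _ h2 h3 =>
      have := ih2 h2
      subst this
      exact ih3 h3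

/-- Every rule charges for what it writes. Hence polynomial time forces polynomial output size,
without which polynomial-time programs could not be composed. -/
theorem Prog.Runs.size_le {P : Prog} {x y : Val} {t : ℕ} (h : P.Runs x y t) : y.size ≤ t := by
  induction h <;> (try simp only [Val.size] at *) <;> omega

theorem polynomial_eval_mono (p : Polynomial ℕ) : Monotone fun n : ℕ => p.eval n := by
  intro a b hab
  simp only [Polynomial.eval_eq_sum, Polynomial.sum]
  gcongr

/-! ## Quantities that are polynomially bounded in the size of the input -/

section Small

variable {ι : Type}

/-- `f` is bounded by a polynomial in the size of the input `u`. -/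
def Small (u : ι → Val) (f : ι → ℕ) : Prop :=
  ∃ p : Polynomial ℕ, ∀ i, f i ≤ p.eval (u i).size

variable {u : ι → Val} {f g : ι → ℕ}

theorem Small.const (n : ℕ) : Small u fun _ => n := ⟨Polynomial.C n, fun i => by simp⟩

theorem Small.size : Small u fun i => (u i).size := ⟨Polynomial.X, fun i => by simp⟩

theorem Small.add (hf : Small u f) (hg : Small u g) : Small u fun i => f i + g i := by
  obtain ⟨p, hp⟩ := hf
  obtain ⟨q, hq⟩ := hg
  exact ⟨p + q, fun i => by rw [Polynomial.eval_add]; exact add_le_add (hp i) (hq i)⟩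

theorem Small.mul (hf : Small u f) (hg : Small u g) : Small u fun i => f i * g i := by
  obtain ⟨p, hp⟩ := hf
  obtain ⟨q, hq⟩ := hg
  exact ⟨p * q, fun i => by rw [Polynomial.eval_mul]; exact Nat.mul_le_mul (hp i) (hq i)⟩

theorem Small.mono (hf : Small u f) (h : ∀ i, g i ≤ f i) : Small u g := by
  obtain ⟨p, hp⟩ := hf
  exact ⟨p, fun i => (h i).trans (hp i)⟩

theorem Small.poly (hf : Small u f) (P : Polynomial ℕ) : Small u fun i => P.eval (f i) := by
  obtain ⟨p, hp⟩ := hf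
  exact ⟨P.comp p, fun i => by
    rw [Polynomial.eval_comp]; exact polynomial_eval_mono P (hp i)⟩

theorem Small.pow (hf : Small u f) (k : ℕ) : Small u fun i => f i ^ k :=
  (hf.poly (Polynomial.X ^ k)).mono fun i => by simp

/-- Smallness relative to an input that is itself small. -/
theorem Small.trans {v : ι → Val} (hf : Small v f) (hv : Small u fun i => (v i).size) :
    Small u f := by
  obtain ⟨p, hp⟩ := hf
  exact (hv.poly p).mono hp

theorem Small.reindex {κ : Type} (hf : Small u f) (e : κ → ι) :
    Small (fun k => u (e k)) fun k => f (e k) := by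
  obtain ⟨p, hp⟩ := hf
  exact ⟨p, fun i => hp _⟩

end Small

/-! ## Polynomial-time computable families -/

open Val (int pair)

/-- Some program computes `v i` from `u i`, for all `i`, in polynomial time. -/
def PT {ι : Type} (u v : ι → Val) : Prop :=
  ∃ (P : Prog) (T : Polynomial ℕ), ∀ i, ∃ t, P.Runs (u i) (v i) t ∧ t ≤ T.eval (u i).size

section PT

variable {ι : Type} {u v w : ι → Val}

theorem PT.small (h : PT u v) : Small u fun i => (v i).size := by
  obtain ⟨P, T, h⟩ := h
  refine ⟨T, fun i => ?_⟩
  obtain ⟨t, ht, hT⟩ := h i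
  exact ht.size_le.trans hT

theorem PT.of_small {f : (ι → ℕ)} (P : Prog) (hf : Small u f)
    (h : ∀ i, ∃ t, P.Runs (u i) (v i) t ∧ t ≤ f i) : PT u v := by
  obtain ⟨p, hp⟩ := hf
  refine ⟨P, p, fun i => ?_⟩
  obtain ⟨t, ht, hT⟩ := h i
  exact ⟨t, ht, hT.trans (hp i)⟩

/-- This turns a machine known to work on all of its inputs, such as the average-case solver or the
program for σ, into a subroutine called on the inputs that another family produces. -/
theorem PT.reindex {κ : Type} (h : PT u v) (e : κ → ι) :
    PT (fun k => u (e k)) fun k => v (e k) := by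
  obtain ⟨P, T, h⟩ := h
  exact ⟨P, T, fun i => h _⟩

theorem PT.trans (h : PT u v) (h' : PT v w) : PT u w := by
  have hv := h.small
  obtain ⟨P, T, h⟩ := h
  obtain ⟨P', T', h'⟩ := h'
  refine PT.of_small (.comp P' P)
    (((Small.const 1).add Small.size).add (Small.size.poly T) |>.add (hv.poly T')) fun i => ?_
  obtain ⟨t, ht, hT⟩ := h i
  obtain ⟨t', ht', hT'⟩ := h' i
  exact ⟨_, .comp ht ht', by gcongr⟩

theorem PT.pair (h : PT u v) (h' : PT u w) : PT u fun i => .pair (v i) (w i) := by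
  obtain ⟨P, T, h⟩ := h
  obtain ⟨P', T', h'⟩ := h'
  refine PT.of_small (.pair P P')
    (((Small.const 1).add Small.size).add (Small.size.poly T) |>.add (Small.size.poly T'))
    fun i => ?_
  obtain ⟨t, ht, hT⟩ := h i
  obtain ⟨t', ht', hT'⟩ := h' i
  exact ⟨_, .pair ht ht', by gcongr⟩

theorem PT.prim (o : Prim) (h : Small u fun i => (o.eval (u i)).size) :
    PT u fun i => o.eval (u i) :=
  PT.of_small (.prim o) (((Small.const 1).add Small.size).add h) fun _ => ⟨_, .prim _ _, le_rfl⟩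

theorem PT.refl : PT u u := PT.prim .id Small.size

theorem PT.const (z : ℤ) : PT u fun _ => int z := PT.prim (.const z) (Small.const _)

theorem Val.one_le_size (v : Val) : 1 ≤ v.size := by cases v <;> simp [Val.size]

theorem Val.size_fst (v : Val) : v.fst.size ≤ v.size := by
  cases v with
  | int z => simp [Val.size, Val.fst]
  | pair a b => simp only [Val.size, Val.fst]; omega

theorem Val.size_snd (v : Val) : v.snd.size ≤ v.size := by
  cases v with
  | int z => simp [Val.size, Val.snd]
  | pair a b => simp only [Val.size, Val.snd]; omega

theorem Val.size_toInt (v : Val) : (int v.toInt).size ≤ v.size := by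
  cases v with
  | int z => simp [Val.toInt]
  | pair a b => simp [Val.size, Val.toInt]

theorem PT.fst_val (h : PT u v) : PT u fun i => (v i).fst :=
  h.trans (PT.prim .fst (Small.size.mono fun _ => Val.size_fst _))

theorem PT.snd_val (h : PT u v) : PT u fun i => (v i).snd :=
  h.trans (PT.prim .snd (Small.size.mono fun _ => Val.size_snd _))

theorem PT.fst (h : PT u fun i => .pair (v i) (w i)) : PT u v := h.fst_val

theorem PT.snd (h : PT u fun i => .pair (v i) (w i)) : PT u w := h.snd_val

/-! ### Bit sizes under integer arithmetic. -/

theorem size_int_le_iff (z : ℤ) (k : ℕ) : (int z).size ≤ k + 1 ↔ z.natAbs < 2 ^ k := by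
  simp [Val.size, Nat.size_le]

theorem natAbs_lt_two_pow_size (z : ℤ) : z.natAbs < 2 ^ ((int z).size - 1) := by
  rw [← size_int_le_iff]; simp [Val.size]

theorem size_int_add (a b : ℤ) : (int (a + b)).size ≤ (int a).size + (int b).size := by
  have ha := natAbs_lt_two_pow_size a
  have hb := natAbs_lt_two_pow_size b
  have ha' := Val.one_le_size (int a)
  have hb' := Val.one_le_size (int b)
  obtain ⟨k, hk⟩ := Nat.exists_eq_add_of_le' ha'
  obtain ⟨l, hl⟩ := Nat.exists_eq_add_of_le' hb'
  rw [hk, add_tsub_cancel_right] at ha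
  rw [hl, add_tsub_cancel_right] at hb
  rw [hk, hl, show k + 1 + (l + 1) = (k + l + 1) + 1 by ring, size_int_le_iff]
  have h1 : 2 ^ k ≤ 2 ^ (k + l) := Nat.pow_le_pow_right (by norm_num) (by omega)
  have h2 : 2 ^ l ≤ 2 ^ (k + l) := Nat.pow_le_pow_right (by norm_num) (by omega)
  have := Int.natAbs_add_le a b
  rw [pow_succ]
  omega

theorem size_int_neg (a : ℤ) : (int (-a)).size = (int a).size := by simp [Val.size]

theorem size_int_sub (a b : ℤ) : (int (a - b)).size ≤ (int a).size + (int b).size := by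
  rw [sub_eq_add_neg, ← size_int_neg b]; exact size_int_add _ _

theorem size_int_mul (a b : ℤ) : (int (a * b)).size ≤ (int a).size + (int b).size := by
  have ha := natAbs_lt_two_pow_size a
  have hb := natAbs_lt_two_pow_size b
  have ha' := Val.one_le_size (int a)
  have hb' := Val.one_le_size (int b)
  obtain ⟨k, hk⟩ := Nat.exists_eq_add_of_le' ha'
  obtain ⟨l, hl⟩ := Nat.exists_eq_add_of_le' hb'
  rw [hk, add_tsub_cancel_right] at ha
  rw [hl, add_tsub_cancel_right] at hb
  refine le_trans ((size_int_le_iff _ (k + l)).2 ?_) (by omega)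
  rw [Int.natAbs_mul, pow_add]
  exact Nat.mul_lt_mul'' ha hb

theorem size_int_mono {a b : ℤ} (h : a.natAbs ≤ b.natAbs) : (int a).size ≤ (int b).size := by
  simpa [Val.size] using Nat.size_le_size h

theorem size_int_div (a b : ℤ) : (int (a / b)).size ≤ (int a).size :=
  size_int_mono (Int.natAbs_ediv_le_natAbs a b)

theorem size_int_natCast_le (n : ℕ) : (int (n : ℤ)).size ≤ n + 1 := by
  rw [size_int_le_iff]; simpa using Nat.lt_two_pow_self

/-- Adding the leaf 0 makes the arithmetic reading convention, under which a pair counts as 0,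
explicit as an integer leaf. -/
theorem PT.toInt (h : PT u v) : PT u fun i => int (v i).toInt := by
  have h1 : PT (fun i => .pair (v i) (int 0)) fun i => int ((v i).toInt + 0) :=
    PT.prim .add (Small.size.mono fun i => by
      have := Val.size_toInt (v i)
      simp only [Prim.eval, Val.fst, Val.snd, Val.toInt, add_zero, Val.size] at *
      omega)
  simpa using (h.pair (PT.const 0)).trans h1

/-! ### Arithmetic and branching in polynomial time. -/

variable {a b c : ι → ℤ}

theorem PT.add (ha : PT u fun i => int (a i)) (hb : PT u fun i => int (b i)) :
    PT u fun i => int (a i + b i) :=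
  (ha.pair hb).trans (PT.prim .add (Small.size.mono fun i =>
    (size_int_add _ _).trans (by simp [Val.size, Val.fst, Val.snd, Val.toInt])))

theorem PT.sub (ha : PT u fun i => int (a i)) (hb : PT u fun i => int (b i)) :
    PT u fun i => int (a i - b i) :=
  (ha.pair hb).trans (PT.prim .sub (Small.size.mono fun i =>
    (size_int_sub _ _).trans (by simp [Val.size, Val.fst, Val.snd, Val.toInt])))

theorem PT.mul (ha : PT u fun i => int (a i)) (hb : PT u fun i => int (b i)) :
    PT u fun i => int (a i * b i) :=
  (ha.pair hb).trans (PT.prim .mul (Small.size.mono fun i =>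
    (size_int_mul _ _).trans (by simp [Val.size, Val.fst, Val.snd, Val.toInt])))

theorem PT.div (ha : PT u fun i => int (a i)) (hb : PT u fun i => int (b i)) :
    PT u fun i => int (a i / b i) :=
  (ha.pair hb).trans (PT.prim .div (Small.size.mono fun i =>
    (size_int_div _ _).trans (by
      simp only [Val.size, Val.fst, Val.toInt]; omega)))

theorem PT.mod (ha : PT u fun i => int (a i)) (hb : PT u fun i => int (b i)) :
    PT u fun i => int (a i % b i) := by
  simpa only [Int.emod_def] using ha.sub (hb.mul (ha.div hb))

theorem PT.ite (hc : PT u fun i => int (c i)) (hv : PT u v) (hw : PT u w) :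
    PT u fun i => if 0 < c i then v i else w i := by
  obtain ⟨P, T, h⟩ := hc
  obtain ⟨P₁, T₁, h₁⟩ := hv
  obtain ⟨P₂, T₂, h₂⟩ := hw
  refine PT.of_small (.cond P P₁ P₂)
    (((Small.const 1).add Small.size).add (Small.size.poly T) |>.add
      ((Small.size.poly T₁).add (Small.size.poly T₂))) fun i => ?_
  obtain ⟨t, ht, hT⟩ := h i
  by_cases hi : 0 < c i
  · obtain ⟨t₁, ht₁, hT₁⟩ := h₁ i
    exact ⟨_, by rw [if_pos hi]; exact .cond_pos ht hi ht₁, by gcongr; omega⟩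
  · obtain ⟨t₁, ht₁, hT₁⟩ := h₂ i
    exact ⟨_, by rw [if_neg hi]; exact .cond_neg ht hi ht₁, by gcongr; omega⟩

/-- Indicator of a strict inequality. -/
theorem PT.lt (ha : PT u fun i => int (a i)) (hb : PT u fun i => int (b i)) :
    PT u fun i => int (if a i < b i then 1 else 0) := by
  have h := PT.ite (hb.sub ha) (PT.const 1) (PT.const 0)
  have e : (fun i => if 0 < b i - a i then int 1 else int 0) =
      fun i => int (if a i < b i then 1 else 0) := by
    funext i
    by_cases h : a i < b i
    · simp [h]
    · simp [h]
  rwa [e] at h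

theorem PT.polyEval {n : ι → ℕ} (h : PT u fun i => int (n i : ℕ)) (p : Polynomial ℕ) :
    PT u fun i => int ((p.eval (n i) : ℕ) : ℤ) := by
  induction p using Polynomial.induction_on' with
  | add p q hp hq => simpa using hp.add hq
  | monomial k c =>
    induction k with
    | zero => simpa using PT.const (c : ℤ)
    | succ k ih =>
      simpa [pow_succ, mul_assoc, Polynomial.eval_monomial] using ih.mul h

/-! ### Loops -/

/-- The first component of the state is a countdown that serves as the loop test. The uniform size
bound `hs` is essential: iterating a polynomial-time body polynomially often could otherwise let the
state grow exponentially. -/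
theorem PT.loop {K : ι → ℕ} {st : ι → ℕ → Val} (h0 : PT u fun i => st i 0) (hK : Small u K)
    (htest : ∀ i k, k ≤ K i → (st i k).fst = int ((K i : ℤ) - k))
    (hstep : PT (ι := Σ i, Fin (K i)) (fun p => st p.1 p.2) fun p => st p.1 (p.2 + 1))
    (hs : ∃ s, Small u s ∧ ∀ i k, k ≤ K i → (st i k).size ≤ s i) :
    PT u fun i => st i (K i) := by
  obtain ⟨s, hs, hsz⟩ := hs
  obtain ⟨P, T, hstep⟩ := hstep
  obtain ⟨P₀, T₀, h0⟩ := h0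
  -- Cost of one turn: overhead, test and body, each on a state of size at most `s i`. The induction
  -- below runs over the number of remaining turns.
  let B : ι → ℕ := fun i => 1 + s i + (1 + s i + s i) + T.eval (s i)
  have hB : Small u B := ((((Small.const 1).add hs).add (((Small.const 1).add hs).add hs)).add
    (hs.poly T))
  have hrun : ∀ i j, j ≤ K i → ∃ t, (Prog.loop (.prim .fst) P).Runs (st i (K i - j))
      (st i (K i)) t ∧ t ≤ (j + 1) * B i := by
    intro i j
    induction j with
    | zero =>
      intro _
      have h1 := hsz i (K i) le_rfl
      have h2 := Val.size_fst (st i (K i))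
      refine ⟨_, Prog.Runs.loop_stop (.prim .fst _) ?_, ?_⟩
      · simp [Prim.eval, htest i (K i) le_rfl, Val.toInt]
      · simp only [Prim.eval, B, Nat.sub_zero]
        omega
    | succ j ih =>
      intro hj
      obtain ⟨r, hr, hrB⟩ := ih (by omega)
      have hlt : K i - (j + 1) < K i := by omega
      obtain ⟨t, ht, htT⟩ := hstep ⟨i, ⟨K i - (j + 1), hlt⟩⟩
      have h1 := hsz i (K i - (j + 1)) (by omega)
      have h2 := Val.size_fst (st i (K i - (j + 1)))
      have h3 := polynomial_eval_mono T h1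
      simp only at h3 ht htT
      rw [show K i - (j + 1) + 1 = K i - j by omega] at ht
      refine ⟨_, Prog.Runs.loop_step (.prim .fst _) ?_ ht hr, ?_⟩
      · simp only [Prim.eval, htest i (K i - (j + 1)) (by omega), Val.toInt]
        omega
      · rw [add_mul (j + 1) 1, one_mul, add_comm ((j + 1) * B i)]
        refine add_le_add ?_ hrB
        simp only [Prim.eval, B]
        omega
  refine PT.of_small (.comp (.loop (.prim .fst) P) P₀)
    (((Small.const 1).add Small.size).add (Small.size.poly T₀) |>.add
      ((hK.add (Small.const 1)).mul hB)) fun i => ?_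
  obtain ⟨t, ht, hT⟩ := h0 i
  obtain ⟨r, hr, hR⟩ := hrun i (K i) le_rfl
  rw [Nat.sub_self] at hr
  exact ⟨_, .comp ht hr, by gcongr⟩

/-- The context of the body of a loop over `k < K i`. -/
def ctx (u : ι → Val) (K : ι → ℕ) : (Σ i, Fin (K i)) → Val := fun p => .pair (u p.1) (int p.2.1)

theorem PT.ctx_lift {K : ι → ℕ} (h : PT u v) : PT (ctx u K) fun p => v p.1 :=
  (PT.fst (PT.refl (u := ctx u K))).trans (h.reindex Sigma.fst)

theorem PT.ctx_idx {K : ι → ℕ} : PT (ctx u K) fun p => int (p.2.1 : ℤ) :=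
  PT.snd (PT.refl (u := ctx u K))

theorem Small.ctx_lift {K : ι → ℕ} {f : ι → ℕ} (h : Small u f) :
    Small (ctx u K) fun p => f p.1 :=
  (h.reindex Sigma.fst).trans (PT.ctx_lift PT.refl).small

/-- A function of the index and of the input, small relative to the context of a loop, is small
relative to the input. -/
theorem Small.of_ctx {K : ι → ℕ} {f : (Σ i, Fin (K i)) → ℕ} (hK : Small u K)
    (h : Small (ctx u K) f) : ∃ s, Small u s ∧ ∀ i (k : Fin (K i)), f ⟨i, k⟩ ≤ s i := by
  obtain ⟨p, hp⟩ := h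
  refine ⟨fun i => p.eval ((u i).size + (K i + 1) + 1),
    ((Small.size.add (hK.add (Small.const 1))).add (Small.const 1)).poly p, fun i k => ?_⟩
  refine (hp ⟨i, k⟩).trans (polynomial_eval_mono p ?_)
  simp only [ctx, Val.size]
  have h1 := size_int_natCast_le k
  simp only [Val.size] at h1
  have h2 := k.2
  omega

/-- The loop state is the countdown together with the input, the upward index and the accumulator,
so the body has access to the original input and to the index as well. -/
theorem PT.iter {K : ι → ℕ} {acc : ι → ℕ → Val} (hK : PT u fun i => int (K i : ℕ))
    (hK' : Small u K) (h0 : PT u fun i => acc i 0)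
    (hstep : PT (ι := Σ i, Fin (K i)) (fun p => .pair (ctx u K p) (acc p.1 p.2))
      fun p => acc p.1 (p.2 + 1))
    (hs : ∃ s, Small u s ∧ ∀ i k, k ≤ K i → (acc i k).size ≤ s i) :
    PT u fun i => acc i (K i) := by
  obtain ⟨s, hs, hsz⟩ := hs
  have key := PT.loop (u := u) (K := K)
    (st := fun i k => .pair (int ((K i : ℤ) - k)) (.pair (.pair (u i) (int k)) (acc i k)))
    ?_ hK' (fun i k _ => rfl) ?_ ?_
  · exact key.snd.snd
  · simpa using hK.pair ((PT.refl.pair (PT.const 0)).pair h0)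
  · have hall := PT.refl (u := fun p : Σ i, Fin (K i) => .pair (int ((K p.1 : ℤ) - (p.2 : ℕ)))
      (.pair (.pair (u p.1) (int ((p.2 : ℕ) : ℤ))) (acc p.1 p.2)))
    have h1 := hall.fst.sub (PT.const 1)
    have h2 := hall.snd.fst.fst
    have h3 := hall.snd.fst.snd.add (PT.const 1)
    have h4 := hall.snd.trans hstep
    have := h1.pair ((h2.pair h3).pair h4)
    simpa [sub_sub] using this
  · refine ⟨fun i => (K i + 1) + ((((u i).size + (K i + 1)) + 1) + s i + 1) + 1, ?_, ?_⟩
    · have hk1 := hK'.add (Small.const (u := u) 1)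
      exact (hk1.add ((((Small.size.add hk1).add (Small.const 1)).add hs).add
        (Small.const 1))).add (Small.const 1)
    · intro i k hk
      have h1 := size_int_natCast_le k
      have h2 := size_int_natCast_le (K i - k)
      have h3 := hsz i k hk
      rw [Nat.cast_sub hk] at h2
      simp only [Val.size] at *
      omega

/-! ### Sums, products and lists of polynomial length. -/

theorem size_int_sum_le {f : ℕ → ℤ} {M : ℕ} (k : ℕ) (h : ∀ j < k, (int (f j)).size ≤ M) :
    (int (∑ j ∈ Finset.range k, f j)).size ≤ 1 + k * M := by
  induction k with
  | zero => simp [Val.size]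
  | succ k ih =>
    rw [Finset.sum_range_succ]
    refine (size_int_add _ _).trans ?_
    have := ih fun j hj => h j (by omega)
    have := h k (by omega)
    rw [add_mul]
    omega

theorem size_int_prod_le {f : ℕ → ℤ} {M : ℕ} (k : ℕ) (h : ∀ j < k, (int (f j)).size ≤ M) :
    (int (∏ j ∈ Finset.range k, f j)).size ≤ 2 + k * M := by
  induction k with
  | zero => simp [Val.size]
  | succ k ih =>
    rw [Finset.prod_range_succ]
    refine (size_int_mul _ _).trans ?_
    have := ih fun j hj => h j (by omega)
    have := h k (by omega)
    rw [add_mul]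
    omega

theorem PT.sum {K : ι → ℕ} {f : ι → ℕ → ℤ} (hK : PT u fun i => int (K i : ℕ)) (hK' : Small u K)
    (hf : PT (ctx u K) fun p => int (f p.1 p.2)) :
    PT u fun i => int (∑ k ∈ Finset.range (K i), f i k) := by
  obtain ⟨s, hs, hsz⟩ := Small.of_ctx hK' hf.small
  refine PT.iter (acc := fun i k => int (∑ j ∈ Finset.range k, f i j)) hK hK' ?_ ?_
    ⟨fun i => 1 + K i * s i, (Small.const 1).add (hK'.mul hs), fun i k hk => ?_⟩
  · simpa using PT.const 0
  · simp only [Finset.sum_range_succ]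
    exact PT.refl.snd.add (PT.refl.fst.trans hf)
  · exact (size_int_sum_le k fun j hj => hsz i ⟨j, by omega⟩).trans
      (Nat.add_le_add_left (Nat.mul_le_mul_right _ hk) _)

theorem PT.prod {K : ι → ℕ} {f : ι → ℕ → ℤ} (hK : PT u fun i => int (K i : ℕ)) (hK' : Small u K)
    (hf : PT (ctx u K) fun p => int (f p.1 p.2)) :
    PT u fun i => int (∏ k ∈ Finset.range (K i), f i k) := by
  obtain ⟨s, hs, hsz⟩ := Small.of_ctx hK' hf.small
  refine PT.iter (acc := fun i k => int (∏ j ∈ Finset.range k, f i j)) hK hK' ?_ ?_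
    ⟨fun i => 2 + K i * s i, (Small.const 2).add (hK'.mul hs), fun i k hk => ?_⟩
  · simpa using PT.const 1
  · simp only [Finset.prod_range_succ]
    exact PT.refl.snd.mul (PT.refl.fst.trans hf)
  · exact (size_int_prod_le k fun j hj => hsz i ⟨j, by omega⟩).trans
      (Nat.add_le_add_left (Nat.mul_le_mul_right _ hk) _)

theorem PT.pow {K : ι → ℕ} (ha : PT u fun i => int (a i)) (hK : PT u fun i => int (K i : ℕ))
    (hK' : Small u K) : PT u fun i => int (a i ^ K i) := by
  simpa using PT.prod hK hK' (f := fun i _ => a i) ha.ctx_lift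

theorem PT.factorial {K : ι → ℕ} (hK : PT u fun i => int (K i : ℕ)) (hK' : Small u K) :
    PT u fun i => int ((K i).factorial : ℕ) := by
  have := PT.prod hK hK' (f := fun _ k => (k : ℤ) + 1) (PT.ctx_idx.add (PT.const 1))
  simpa [← Finset.prod_range_add_one_eq_factorial] using this

theorem size_ofList_le {M : ℕ} (l : List Val) (h : ∀ a ∈ l, a.size ≤ M) :
    (Val.ofList l).size ≤ 1 + l.length * (M + 1) := by
  induction l with
  | nil => simp [Val.ofList, Val.size]
  | cons a l ih =>
    have h1 := h a (by simp)
    have h2 := ih fun b hb => h b (by simp [hb])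
    rw [Val.ofList, Val.size, List.length_cons, add_mul]
    omega

/-- Lists of values that are computed from the index. -/
theorem PT.listMap {K : ι → ℕ} {f : ι → ℕ → Val} (hK : PT u fun i => int (K i : ℕ))
    (hK' : Small u K) (hf : PT (ctx u K) fun p => f p.1 p.2) :
    PT u fun i => Val.ofList ((List.range (K i)).map (f i)) := by
  obtain ⟨s, hs, hsz⟩ := Small.of_ctx hK' hf.small
  -- Right-nested lists grow at the head, so the list is built from its end: after `k` turns it
  -- holds the last `k` entries.
  have key := PT.iter (u := u) (K := K)
    (acc := fun i k => Val.ofList ((List.range' (K i - k) k).map (f i))) hK hK' ?_ ?_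
    ⟨fun i => 1 + K i * (s i + 1), (Small.const 1).add (hK'.mul (hs.add (Small.const 1))),
      fun i k hk => ?_⟩
  · simpa [List.range_eq_range'] using key
  · simpa [Val.ofList] using PT.const 0
  · have hidx : PT (ctx u K) fun p => int ((K p.1 - (p.2 + 1) : ℕ) : ℤ) := by
      have := (PT.ctx_lift (K := K) hK).sub (PT.ctx_idx.add (PT.const 1))
      refine cast (congrArg _ (funext fun p => ?_)) this
      have := p.2.2
      congr 1
      push_cast [Nat.cast_sub (show p.2.1 + 1 ≤ K p.1 by omega)]
      ring
    have hrev : PT (ctx u K) fun p => f p.1 (K p.1 - (p.2 + 1)) :=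
      (PT.pair (PT.ctx_lift PT.refl) hidx).trans
        (hf.reindex fun p : Σ i, Fin (K i) => ⟨p.1, ⟨K p.1 - (p.2 + 1), by have := p.2.2; omega⟩⟩)
    have := (PT.refl.fst.trans hrev).pair (PT.refl (u := fun p : Σ i, Fin (K i) => .pair
      (ctx u K p) (Val.ofList ((List.range' (K p.1 - p.2) p.2).map (f p.1))))).snd
    refine cast (congrArg _ (funext fun p => ?_)) this
    have hp := p.2.2
    rw [List.range'_succ, List.map_cons, Val.ofList,
      show K p.1 - (p.2.1 + 1) + 1 = K p.1 - p.2.1 by omega]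
  · refine (size_ofList_le (M := s i) _ fun a ha => ?_).trans ?_
    · obtain ⟨j, hj, rfl⟩ := List.mem_map.1 ha
      rw [List.mem_range'_1] at hj
      exact hsz i ⟨j, by omega⟩
    · rw [List.length_map, List.length_range']
      exact Nat.add_le_add_left (Nat.mul_le_mul_right _ hk) _

/-- Lookup in a list. -/
theorem PT.nth {l : ι → List Val} {k : ι → ℕ} (hl : PT u fun i => Val.ofList (l i))
    (hk : PT u fun i => int (k i : ℕ)) (hlt : ∀ i, k i < (l i).length) :
    PT u fun i => (l i)[k i]'(hlt i) := by
  -- A valid position is at most the length of the list, hence small although it is given in binary;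
  -- the lookup may drop heads one at a time.
  have hk' : Small u k := by
    refine (hl.small).mono fun i => (hlt i).le.trans ?_
    generalize l i = l
    induction l with
    | nil => simp
    | cons a l ih => simp only [List.length_cons, Val.ofList, Val.size]; omega
  have key := PT.iter (u := u) (K := k) (acc := fun i j => Val.ofList ((l i).drop j)) hk hk'
    (by simpa using hl) ?_ ⟨_, hl.small, fun i j _ => ?_⟩
  · refine cast (congrArg _ (funext fun i => ?_)) key.fst_val
    rw [List.drop_eq_getElem_cons (hlt i)]
    rfl
  · refine cast (congrArg _ (funext fun p => ?_)) (PT.refl.snd.snd_val (u := fun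
      p : Σ i, Fin (k i) => .pair (ctx u k p) (Val.ofList ((l p.1).drop p.2))))
    have := p.2.2
    have := hlt p.1
    rw [List.drop_eq_getElem_cons (by omega)]
    rfl
  · induction j with
    | zero => simp
    | succ j ih =>
      refine le_trans ?_ (ih (by omega))
      rw [← List.tail_drop]
      cases (l i).drop j with
      | nil => simp
      | cons a l => simp only [List.tail_cons, Val.ofList, Val.size]; omega

end PT

/-! ## Medians -/

/-- Number of `j < K` with `f j < x`. -/
def numLT (K : ℕ) (f : ℕ → ℤ) (x : ℤ) : ℕ := ((Finset.range K).filter fun j => f j < x).card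

/-- Number of `j < K` with `x < f j`. -/
def numGT (K : ℕ) (f : ℕ → ℤ) (x : ℤ) : ℕ := ((Finset.range K).filter fun j => x < f j).card

/-- The last of the values `f 0, …, f (k - 1)` with at most `m` smaller and at most `m` larger ones
among `f 0, …, f (K - 1)`. -/
def medianAux (K m : ℕ) (f : ℕ → ℤ) : ℕ → ℤ
  | 0 => 0
  | k + 1 => if numLT K f (f k) ≤ m ∧ numGT K f (f k) ≤ m then f k else medianAux K m f k

/-- The median of `f 0, …, f (2 m)`. -/
def median (m : ℕ) (f : ℕ → ℤ) : ℤ := medianAux (2 * m + 1) m f (2 * m + 1)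

theorem exists_median (m : ℕ) (f : ℕ → ℤ) : ∃ k < 2 * m + 1,
    numLT (2 * m + 1) f (f k) ≤ m ∧ numGT (2 * m + 1) f (f k) ≤ m := by
  classical
  -- The median is the smallest value with at most `m` larger ones. If more than `m` values were
  -- below it, the largest of those would itself have at most `m` larger ones, against minimality.
  set S := (Finset.range (2 * m + 1)).filter fun k => numGT (2 * m + 1) f (f k) ≤ m with hS
  have hne : S.Nonempty := by
    obtain ⟨k, hk, hmax⟩ := Finset.exists_max_image (Finset.range (2 * m + 1)) f ⟨0, by simp⟩
    refine ⟨k, Finset.mem_filter.2 ⟨hk, ?_⟩⟩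
    rw [numGT, Finset.filter_false_of_mem fun j hj => (hmax j hj).not_gt]
    simp
  obtain ⟨k, hk, hmin⟩ := Finset.exists_min_image S f hne
  obtain ⟨hk1, hk2⟩ := Finset.mem_filter.1 hk
  refine ⟨k, by simpa using hk1, ?_, hk2⟩
  by_contra hlt
  set B := (Finset.range (2 * m + 1)).filter fun j => f j < f k with hB
  have hBcard : m < B.card := by simpa [numLT, hB] using hlt
  have hBne : B.Nonempty := Finset.card_pos.1 (by omega)
  obtain ⟨l, hl, hmax⟩ := Finset.exists_max_image B f hBne
  obtain ⟨hl1, hl2⟩ := Finset.mem_filter.1 hl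
  refine absurd (hmin l (Finset.mem_filter.2 ⟨hl1, ?_⟩)) (by omega)
  have hdisj : Disjoint B ((Finset.range (2 * m + 1)).filter fun j => f l < f j) := by
    rw [Finset.disjoint_left]
    intro j hj hj'
    have := hmax j hj
    have := (Finset.mem_filter.1 hj').2
    omega
  have hle := Finset.card_le_card (Finset.union_subset (Finset.filter_subset _ _)
    (Finset.filter_subset _ _) : B ∪ ((Finset.range (2 * m + 1)).filter fun j => f l < f j) ⊆ _)
  rw [Finset.card_union_of_disjoint hdisj, Finset.card_range] at hle
  rw [numGT]
  omega

theorem medianAux_spec (K m : ℕ) (f : ℕ → ℤ) (k : ℕ)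
    (h : ∃ j < k, numLT K f (f j) ≤ m ∧ numGT K f (f j) ≤ m) :
    ∃ j < k, medianAux K m f k = f j ∧ numLT K f (f j) ≤ m ∧ numGT K f (f j) ≤ m := by
  induction k with
  | zero => simp at h
  | succ k ih =>
    by_cases hk : numLT K f (f k) ≤ m ∧ numGT K f (f k) ≤ m
    · exact ⟨k, by omega, by rw [medianAux, if_pos hk], hk⟩
    · obtain ⟨j, hj, hj'⟩ := h
      have hjk : j < k := by
        rcases Nat.lt_succ_iff_lt_or_eq.1 hj with h | h
        · exact h
        · exact absurd (h ▸ hj') hk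
      obtain ⟨i, hi, h1, h2⟩ := ih ⟨j, hjk, hj'⟩
      exact ⟨i, by omega, by rw [medianAux, if_neg hk, h1], h2⟩

theorem median_spec (m : ℕ) (f : ℕ → ℤ) : ∃ k < 2 * m + 1, median m f = f k ∧
    numLT (2 * m + 1) f (f k) ≤ m ∧ numGT (2 * m + 1) f (f k) ≤ m :=
  medianAux_spec _ _ _ _ (exists_median m f)

/-- The median lies in each order-convex set that contains the majority of the values. -/
theorem median_mem {m : ℕ} {f : ℕ → ℤ} {S : Set ℤ} (hS : S.OrdConnected) {B : Finset ℕ}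
    (hB : ∀ j < 2 * m + 1, j ∉ B → f j ∈ S) (h : B.card ≤ m) : median m f ∈ S := by
  classical
  obtain ⟨k, -, hk, h1, h2⟩ := median_spec m f
  rw [hk]
  -- At least `m + 1` indices lie outside `B`, and at most `m` values exceed the median, so some
  -- value in `S` is at most the median. The other side is symmetric, and order-convexity concludes.
  have hlow : ∃ j ∈ Finset.range (2 * m + 1), j ∉ B ∧ f j ≤ f k := by
    by_contra! hcon
    have hsub : Finset.range (2 * m + 1) ⊆
        B ∪ (Finset.range (2 * m + 1)).filter fun j => f k < f j := by
      intro j hj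
      by_cases hjB : j ∈ B
      · exact Finset.mem_union_left _ hjB
      · exact Finset.mem_union_right _ (Finset.mem_filter.2 ⟨hj, hcon j hj hjB⟩)
    have := (Finset.card_le_card hsub).trans (Finset.card_union_le _ _)
    rw [Finset.card_range] at this
    rw [numGT] at h2
    omega
  have hup : ∃ j ∈ Finset.range (2 * m + 1), j ∉ B ∧ f k ≤ f j := by
    by_contra! hcon
    have hsub : Finset.range (2 * m + 1) ⊆
        B ∪ (Finset.range (2 * m + 1)).filter fun j => f j < f k := by
      intro j hj
      by_cases hjB : j ∈ B
      · exact Finset.mem_union_left _ hjB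
      · exact Finset.mem_union_right _ (Finset.mem_filter.2 ⟨hj, hcon j hj hjB⟩)
    have := (Finset.card_le_card hsub).trans (Finset.card_union_le _ _)
    rw [Finset.card_range] at this
    rw [numLT] at h1
    omega
  obtain ⟨i, hi, hiB, hik⟩ := hlow
  obtain ⟨j, hj, hjB, hkj⟩ := hup
  exact hS.out (hB i (Finset.mem_range.1 hi) hiB) (hB j (Finset.mem_range.1 hj) hjB) ⟨hik, hkj⟩

/-! ### Medians in polynomial time. -/

section PT

variable {ι : Type} {u : ι → Val}

theorem numLT_eq_sum (K : ℕ) (f : ℕ → ℤ) (x : ℤ) :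
    (numLT K f x : ℤ) = ∑ j ∈ Finset.range K, if f j < x then 1 else 0 := by
  simp [numLT]

theorem numGT_eq_sum (K : ℕ) (f : ℕ → ℤ) (x : ℤ) :
    (numGT K f x : ℤ) = ∑ j ∈ Finset.range K, if x < f j then 1 else 0 := by
  simp [numGT]

theorem PT.int_numLT {K : ι → ℕ} {f : ι → ℕ → ℤ} {x : ι → ℤ} (hK : PT u fun i => int (K i : ℕ))
    (hK' : Small u K) (hf : PT (ctx u K) fun p => int (f p.1 p.2))
    (hx : PT u fun i => int (x i)) : PT u fun i => int (numLT (K i) (f i) (x i) : ℕ) := by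
  simp only [numLT_eq_sum]
  exact PT.sum hK hK' (hf.lt hx.ctx_lift)

theorem PT.int_numGT {K : ι → ℕ} {f : ι → ℕ → ℤ} {x : ι → ℤ} (hK : PT u fun i => int (K i : ℕ))
    (hK' : Small u K) (hf : PT (ctx u K) fun p => int (f p.1 p.2))
    (hx : PT u fun i => int (x i)) : PT u fun i => int (numGT (K i) (f i) (x i) : ℕ) := by
  simp only [numGT_eq_sum]
  exact PT.sum hK hK' (hx.ctx_lift.lt hf)

theorem medianAux_eq (K m : ℕ) (f : ℕ → ℤ) (k : ℕ) : medianAux K m f k = 0 ∨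
    ∃ j < k, medianAux K m f k = f j := by
  induction k with
  | zero => exact Or.inl rfl
  | succ k ih =>
    rw [medianAux]
    split_ifs
    · exact Or.inr ⟨k, by omega, rfl⟩
    · rcases ih with h | ⟨j, hj, h⟩
      · exact Or.inl h
      · exact Or.inr ⟨j, by omega, h⟩

theorem PT.int_medianAux {K m : ι → ℕ} {f : ι → ℕ → ℤ} (hK : PT u fun i => int (K i : ℕ))
    (hK' : Small u K) (hm : PT u fun i => int (m i : ℕ))
    (hf : PT (ctx u K) fun p => int (f p.1 p.2)) :
    PT u fun i => int (medianAux (K i) (m i) (f i) (K i)) := by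
  obtain ⟨s, hs, hsz⟩ := Small.of_ctx hK' hf.small
  refine PT.iter (acc := fun i k => int (medianAux (K i) (m i) (f i) k)) hK hK' ?_ ?_
    ⟨fun i => 1 + s i, (Small.const 1).add hs, fun i k hk => ?_⟩
  · exact PT.const 0
  · have hnest : PT (ctx (ctx u K) fun p => K p.1) fun p => int (f p.1.1 p.2) :=
      (PT.pair (PT.ctx_lift (PT.ctx_lift PT.refl)) PT.ctx_idx).trans
        (hf.reindex fun p : Σ q : Σ i, Fin (K i), Fin (K q.1) => ⟨p.1.1, p.2⟩)
    have h1 : PT (ctx u K) fun p => int (numLT (K p.1) (f p.1) (f p.1 p.2) : ℕ) :=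
      PT.int_numLT hK.ctx_lift hK'.ctx_lift hnest hf
    have h2 : PT (ctx u K) fun p => int (numGT (K p.1) (f p.1) (f p.1 p.2) : ℕ) :=
      PT.int_numGT hK.ctx_lift hK'.ctx_lift hnest hf
    have hm1 : PT (ctx u K) fun p => int ((m p.1 : ℤ) + 1) := hm.ctx_lift.add (PT.const 1)
    have hall := PT.refl (u := fun p : Σ i, Fin (K i) => Val.pair (ctx u K p)
      (int (medianAux (K p.1) (m p.1) (f p.1) p.2)))
    have := PT.ite (hall.fst.trans (hm1.sub h1))
      (PT.ite (hall.fst.trans (hm1.sub h2)) (hall.fst.trans hf) hall.snd) hall.snd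
    refine cast (congrArg _ (funext fun p => ?_)) this
    rw [medianAux]
    split_ifs <;> first | rfl | omega
  · rcases medianAux_eq (K i) (m i) (f i) k with h | ⟨j, hj, h⟩
    · simp [h, Val.size]
    · rw [h]
      exact (hsz i ⟨j, by omega⟩).trans (Nat.le_add_left _ _)

theorem PT.int_median {m : ι → ℕ} {f : ι → ℕ → ℤ} (hm : PT u fun i => int (m i : ℕ))
    (hm' : Small u m) (hf : PT (ctx u fun i => 2 * m i + 1) fun p => int (f p.1 p.2)) :
    PT u fun i => int (median (m i) (f i)) :=
  PT.int_medianAux (by simpa using ((PT.const 2).mul hm).add (PT.const 1))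
    (((Small.const 2).mul hm').add (Small.const 1)) hm hf

end PT

/-! ## Distribution of the median of independent uniform variables -/

/-- `a` is a value of `d` with at most `m` smaller and at most `m` larger ones. -/
def IsMedian {T : Type} [Fintype T] {L : ℕ} (m : ℕ) (d : T → Fin L) (a : ℕ) : Prop :=
  ∃ t₀, (d t₀ : ℕ) = a ∧ (Finset.univ.filter fun t => (d t : ℕ) < a).card ≤ m ∧
    (Finset.univ.filter fun t => a < (d t : ℕ)).card ≤ m

-- Choose the position of the median and a set of `m` other positions that contains all strictly
-- smaller values and no strictly larger one. Values on this set are at most `a`, the remaining `m`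
-- at least `a`. Ties are counted several times, which is harmless for an upper bound.
open Classical in
theorem card_isMedian_le {T : Type} [Fintype T] [DecidableEq T] {L m : ℕ} (hT : Fintype.card T = 2 * m + 1)
    {a : ℕ} (ha : a < L) : (Finset.univ.filter fun d : T → Fin L => IsMedian m d a).card ≤
      (2 * m + 1) * (2 * m).choose m * ((a + 1) ^ m * (L - a) ^ m) := by
  let P : T → Finset T → Finset (T → Fin L) := fun t₀ B => Fintype.piFinset fun t =>
    if t = t₀ then {⟨a, ha⟩} else if t ∈ B then Finset.Iic ⟨a, ha⟩ else Finset.Ici ⟨a, ha⟩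
  have hP : ∀ t₀, ∀ B ∈ (Finset.univ.erase t₀).powersetCard m,
      (P t₀ B).card = (a + 1) ^ m * (L - a) ^ m := by
    intro t₀ B hB
    obtain ⟨hB1, hB2⟩ := Finset.mem_powersetCard.1 hB
    have hc : ((Finset.univ.erase t₀) \ B).card = m := by
      rw [Finset.card_sdiff_of_subset hB1, Finset.card_erase_of_mem (Finset.mem_univ _),
        Finset.card_univ, hT, hB2]
      omega
    rw [Fintype.card_piFinset, ← Finset.mul_prod_erase _ _ (Finset.mem_univ t₀), if_pos rfl,
      Finset.card_singleton, one_mul, ← Finset.prod_sdiff hB1, mul_comm]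
    congr 1
    · rw [← hB2]
      refine Finset.prod_eq_pow_card fun t ht => ?_
      rw [if_neg (Finset.ne_of_mem_erase (hB1 ht)), if_pos ht]
      simp
    · rw [← hc]
      refine Finset.prod_eq_pow_card fun t ht => ?_
      obtain ⟨h1, h2⟩ := Finset.mem_sdiff.1 ht
      rw [if_neg (Finset.ne_of_mem_erase h1), if_neg h2]
      simp
  have hsub : (Finset.univ.filter fun d : T → Fin L => IsMedian m d a) ⊆
      Finset.univ.biUnion fun t₀ : T => ((Finset.univ.erase t₀).powersetCard m).biUnion (P t₀) := by
    intro d hd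
    obtain ⟨t₀, h0, h1, h2⟩ := (Finset.mem_filter.1 hd).2
    simp only [Finset.mem_biUnion, Finset.mem_univ, true_and]
    set lo := Finset.univ.filter fun t => (d t : ℕ) < a
    set hi := Finset.univ.filter fun t => a < (d t : ℕ)
    have hlo : lo ⊆ (Finset.univ.erase t₀) \ hi := by
      intro t ht
      have ht' := (Finset.mem_filter.1 ht).2
      simp only [Finset.mem_sdiff, Finset.mem_erase, Finset.mem_univ, and_true, hi,
        Finset.mem_filter, true_and]
      refine ⟨fun h => ?_, by omega⟩
      rw [h] at ht'
      omega
    have hcard : m ≤ ((Finset.univ.erase t₀) \ hi).card := by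
      have := Finset.le_card_sdiff hi (Finset.univ.erase t₀)
      rw [Finset.card_erase_of_mem (Finset.mem_univ _), Finset.card_univ, hT] at this
      omega
    obtain ⟨B, hB1, hB2, hB3⟩ := Finset.exists_subsuperset_card_eq hlo h1 hcard
    refine ⟨t₀, B, Finset.mem_powersetCard.2 ⟨hB2.trans Finset.sdiff_subset, hB3⟩, ?_⟩
    rw [Fintype.mem_piFinset]
    intro t
    split_ifs with ht htB
    · rw [Finset.mem_singleton, Fin.ext_iff, ht, h0]
    · have := (Finset.mem_sdiff.1 (hB2 htB)).2
      rw [Finset.mem_filter] at this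
      rw [Finset.mem_Iic, Fin.le_def]
      simpa using this
    · have : t ∉ lo := fun h => htB (hB1 h)
      rw [Finset.mem_filter] at this
      rw [Finset.mem_Ici, Fin.le_def]
      simpa using this
  refine (Finset.card_le_card hsub).trans (Finset.card_biUnion_le.trans ?_)
  rw [mul_assoc, ← hT, ← Finset.card_univ, ← smul_eq_mul, ← Finset.sum_const]
  refine Finset.sum_le_sum fun t₀ _ => Finset.card_biUnion_le.trans ?_
  rw [Finset.sum_congr rfl (hP t₀), Finset.sum_const, Finset.card_powersetCard,
    Finset.card_erase_of_mem (Finset.mem_univ _), Finset.card_univ, hT, smul_eq_mul,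
    Nat.add_sub_cancel]

/-! ## Comparison of the sampler with the ensembles -/

theorem setOf_floor_eq (b : ℕ) (z : ℤ) : {w : ℝ | ⌊2 ^ b * w⌋ = z} =
    Set.Ico ((z : ℝ) / 2 ^ b) (((z : ℝ) + 1) / 2 ^ b) := by
  ext w
  have : (0 : ℝ) < 2 ^ b := by positivity
  rw [Set.mem_ofPred_eq, Int.floor_eq_iff, Set.mem_Ico, div_le_iff₀ this, lt_div_iff₀ this,
    mul_comm w]

theorem volume_Ico_cell (b : ℕ) (z : ℤ) :
    volume (Set.Ico ((z : ℝ) / 2 ^ b) (((z : ℝ) + 1) / 2 ^ b)) =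
      ENNReal.ofReal ((2 ^ b)⁻¹) := by
  rw [Real.volume_Ico, ← sub_div, add_sub_cancel_left, one_div]

/-- The two inequalities place the whole cell inside [-σ, σ], where its probability is exact. -/
theorem uniform_law_cell {σ : ℝ} {b : ℕ} {z : ℤ} (hσ : 0 < σ)
    (h1 : -(σ * 2 ^ b) ≤ z) (h2 : (z : ℝ) + 1 ≤ σ * 2 ^ b) :
    (Ensemble.uniform.law σ).real {w | ⌊2 ^ b * w⌋ = z} = (2 * (σ * 2 ^ b))⁻¹ := by
  have hb : (0 : ℝ) < 2 ^ b := by positivity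
  rw [setOf_floor_eq, Ensemble.law, measureReal_def, cond_apply measurableSet_Icc,
    Set.inter_eq_self_of_subset_right, volume_Ico_cell, Real.volume_Icc, ENNReal.toReal_mul,
    ENNReal.toReal_inv, ENNReal.toReal_ofReal (by linarith),
    ENNReal.toReal_ofReal (by positivity), ← mul_inv]
  · congr 1
    ring
  · intro w hw
    rw [Set.mem_Ico, div_le_iff₀ hb, lt_div_iff₀ hb] at hw
    constructor <;> nlinarith

/-- `Y` bounds both ends of the cell in units of the mesh, so the density on the cell is at least
its value at distance `Y`. A lower bound suffices since the ensemble only has to dominate the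
sampler. -/
theorem gaussian_law_cell {σ : ℝ} {b : ℕ} {z : ℤ} {Y : ℝ} (hσ : 0 < σ)
    (h1 : |(z : ℝ)| ≤ Y) (h2 : |(z : ℝ) + 1| ≤ Y) :
    (σ * 2 ^ b * √(2 * Real.pi))⁻¹ * Real.exp (-(Y ^ 2 / (2 * (σ * 2 ^ b) ^ 2))) ≤
      (Ensemble.gaussian.law σ).real {w | ⌊2 ^ b * w⌋ = z} := by
  have hb : (0 : ℝ) < 2 ^ b := by positivity
  have hv : (σ ^ 2).toNNReal ≠ 0 := by
    rw [Ne, Real.toNNReal_eq_zero]; push Not; positivity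
  have hvc : (((σ ^ 2).toNNReal : NNReal) : ℝ) = σ ^ 2 := Real.coe_toNNReal _ (by positivity)
  have hfin : (gaussianReal 0 (σ ^ 2).toNNReal) {w | ⌊2 ^ b * w⌋ = z} ≠ ⊤ := measure_ne_top _ _
  rw [Ensemble.law, measureReal_def, ← ENNReal.ofReal_le_iff_le_toReal hfin,
    gaussianReal_apply _ hv, setOf_floor_eq]
  set c : ℝ := (σ * √(2 * Real.pi))⁻¹ * Real.exp (-(Y ^ 2 / (2 * (σ * 2 ^ b) ^ 2))) with hc
  have hle : ∀ x ∈ Set.Ico ((z : ℝ) / 2 ^ b) (((z : ℝ) + 1) / 2 ^ b),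
      ENNReal.ofReal c ≤ gaussianPDF 0 (σ ^ 2).toNNReal x := by
    intro x hx
    rw [Set.mem_Ico, div_le_iff₀ hb, lt_div_iff₀ hb] at hx
    rw [gaussianPDF, gaussianPDFReal, hvc, hc]
    apply ENNReal.ofReal_le_ofReal
    have hs : √(2 * Real.pi * σ ^ 2) = σ * √(2 * Real.pi) := by
      rw [Real.sqrt_mul (by positivity), Real.sqrt_sq hσ.le, mul_comm]
    rw [hs, sub_zero, neg_div]
    have hx2 : (x * 2 ^ b) ^ 2 ≤ Y ^ 2 := by
      apply sq_le_sq'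
      · linarith [(abs_le.1 h1).1]
      · linarith [(abs_le.1 h2).2]
    have : x ^ 2 / (2 * σ ^ 2) ≤ Y ^ 2 / (2 * (σ * 2 ^ b) ^ 2) := by
      rw [div_le_div_iff₀ (by positivity) (by positivity)]
      nlinarith [mul_le_mul_of_nonneg_left hx2 (show 0 ≤ 2 * σ ^ 2 by positivity)]
    gcongr
  calc ENNReal.ofReal ((σ * 2 ^ b * √(2 * Real.pi))⁻¹ *
        Real.exp (-(Y ^ 2 / (2 * (σ * 2 ^ b) ^ 2))))
      = ENNReal.ofReal c * volume (Set.Ico ((z : ℝ) / 2 ^ b) (((z : ℝ) + 1) / 2 ^ b)) := by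
        rw [volume_Ico_cell, ← ENNReal.ofReal_mul (by positivity), hc]
        congr 1
        field_simp
    _ = ∫⁻ _ in Set.Ico ((z : ℝ) / 2 ^ b) (((z : ℝ) + 1) / 2 ^ b), ENNReal.ofReal c := by
        rw [setLIntegral_const]
    _ ≤ _ := setLIntegral_mono' measurableSet_Ico hle

/-- This is the normalisation of the law of the median. The lower bound on Wallis' product has the
right constant π, so that it matches the Gaussian normalisation up to a factor 1 + O(1/m). -/
theorem wallis_choose_le (m : ℕ) :
    ((2 * m + 1 : ℕ) : ℝ) * ((2 * m).choose m : ℕ) ≤ 4 ^ m * (2 * √((m + 1) / Real.pi)) := by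
  have hW := Real.Wallis.le_W m
  rw [Real.Wallis.W_eq_factorial_ratio] at hW
  have hch : (((2 * m).choose m : ℕ) : ℝ) * ((m.factorial : ℝ) ^ 2) = (2 * m).factorial := by
    have := Nat.choose_mul_factorial_mul_factorial (show m ≤ 2 * m by omega)
    rw [show 2 * m - m = m by omega] at this
    rw [← this]
    push_cast
    ring
  have hf : (0 : ℝ) < m.factorial := by exact_mod_cast m.factorial_pos
  have hcpos : (0 : ℝ) < ((2 * m).choose m : ℕ) := by
    exact_mod_cast Nat.choose_pos (by omega)
  rw [← hch] at hW
  set C : ℝ := (((2 * m).choose m : ℕ) : ℝ)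
  have h4 : (2 : ℝ) ^ (4 * m) = (4 ^ m) ^ 2 := by
    rw [← pow_mul, show (4 : ℝ) = 2 ^ 2 by norm_num, ← pow_mul]; ring_nf
  have hpi := Real.pi_pos
  have hsq : (((2 * m + 1 : ℕ) : ℝ) * C) ^ 2 ≤ (4 ^ m * (2 * √((m + 1) / Real.pi))) ^ 2 := by
    rw [mul_pow (4 ^ m : ℝ), mul_pow (2 : ℝ), Real.sq_sqrt (by positivity)]
    rw [h4, show (m.factorial : ℝ) ^ 4 = ((m.factorial : ℝ) ^ 2) ^ 2 by ring, mul_pow C,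
      show ((4 : ℝ) ^ m) ^ 2 * ((m.factorial : ℝ) ^ 2) ^ 2 /
        (C ^ 2 * ((m.factorial : ℝ) ^ 2) ^ 2 * (2 * m + 1)) =
        (4 ^ m) ^ 2 / (C ^ 2 * (2 * m + 1)) by field_simp,
      div_mul_div_comm, div_le_div_iff₀ (by positivity) (by positivity)] at hW
    rw [show ((4 : ℝ) ^ m) ^ 2 * (2 ^ 2 * ((m + 1) / Real.pi)) =
      ((4 : ℝ) ^ m) ^ 2 * ((2 * m + 2) * 2) / Real.pi by ring,
      le_div_iff₀ hpi]
    push_cast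
    linarith
  exact (sq_le_sq₀ (by positivity) (by positivity)).1 hsq

/-- One coordinate of the sampler, shifted by `τ`, is dominated by the uniform ensemble. -/
theorem uniform_domination {σ η : ℝ} {b A : ℕ} {T : ℝ} (hσ : 0 < σ)
    (hAT : A + T ≤ σ * 2 ^ b) (hAη : σ * 2 ^ b ≤ A * Real.exp η) {a : ℕ} (ha : a < 2 * A) {τ : ℤ}
    (hτ : |(τ : ℝ)| ≤ T) :
    1 ≤ (2 * A : ℝ) * (Real.exp η *
      (Ensemble.uniform.law σ).real {w | ⌊2 ^ b * w⌋ = (a : ℤ) - A + τ}) := by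
  obtain ⟨hτ1, hτ2⟩ := abs_le.1 hτ
  have ha' : (a : ℝ) + 1 ≤ 2 * A := by exact_mod_cast ha
  have ha0 : (0 : ℝ) ≤ a := by positivity
  rw [uniform_law_cell hσ (by push_cast; linarith) (by push_cast; linarith)]
  have : 0 < σ * 2 ^ b := by positivity
  rw [← mul_assoc, ← div_eq_mul_inv, le_div_iff₀ (by positivity)]
  linarith

/-- The error budget of the Gaussian comparison, with `x` the distance from the centre. The first
three terms come from the normalisation, from replacing `S` by its integer approximation, and from a
half-integer offset of the radius. The last two measure the mismatch of exponents caused by the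
shift and the change of width; since x = O(kS), this is O(k²T/S). -/
theorem gaussian_exponent_le {k S T x : ℝ} (hk : 1 ≤ k) (hT : 1 ≤ T) (hS : T + 1 ≤ S)
    (hx0 : 0 ≤ x) (hx : x ≤ 2 * k * (S + 2)) :
    1 / (4 * k ^ 2) + 2 / S + 2 * k / S + (x + (T + 1)) ^ 2 / (2 * S ^ 2) -
      x ^ 2 / (2 * (S + 2) ^ 2) ≤ 1 / (4 * k ^ 2) + 25 * k ^ 2 * (T + 1) / S := by
  have hS2 : 2 ≤ S := by linarith
  have hS0 : 0 < S := by linarith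
  have e1 : x ^ 2 / (2 * S ^ 2) - x ^ 2 / (2 * (S + 2) ^ 2) ≤ 12 * k ^ 2 / S := by
    have : x ^ 2 / (2 * S ^ 2) - x ^ 2 / (2 * (S + 2) ^ 2) =
        (x / (S + 2)) ^ 2 * ((2 * S + 2) / S ^ 2) := by
      field_simp; ring
    rw [this]
    have h1 : (x / (S + 2)) ^ 2 ≤ (2 * k) ^ 2 := by
      have : x / (S + 2) ≤ 2 * k := by rw [div_le_iff₀ (by linarith)]; linarith
      gcongr
    have h2 : (2 * S + 2) / S ^ 2 ≤ 3 / S := by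
      rw [div_le_div_iff₀ (by positivity) hS0]; nlinarith
    calc _ ≤ (2 * k) ^ 2 * (3 / S) := by gcongr
      _ = _ := by ring
  have e2 : (2 * x * (T + 1) + (T + 1) ^ 2) / (2 * S ^ 2) ≤ (5 * k * (T + 1)) / S := by
    rw [div_le_div_iff₀ (by positivity) hS0]
    have hx' : x ≤ 4 * k * S := by nlinarith
    have h3 : 2 * x * (T + 1) + (T + 1) ^ 2 ≤ 10 * k * S * (T + 1) := by
      have : (T + 1) * (2 * x + (T + 1)) ≤ (T + 1) * (2 * (4 * k * S) + S) := by gcongr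
      nlinarith [mul_nonneg hS0.le (show 0 ≤ T + 1 by linarith)]
    nlinarith
  have e3 : 2 / S + 2 * k / S + 12 * k ^ 2 / S + (5 * k * (T + 1)) / S ≤
      25 * k ^ 2 * (T + 1) / S := by
    rw [← add_div, ← add_div, ← add_div]
    gcongr
    have h1 : k ≤ k ^ 2 := by nlinarith
    have h2 : 0 ≤ T - 1 := by linarith
    nlinarith [mul_nonneg h2 (sub_nonneg.2 h1), mul_nonneg h2 (sq_nonneg k)]
  have e4 : (x + (T + 1)) ^ 2 / (2 * S ^ 2) = x ^ 2 / (2 * S ^ 2) +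
      (2 * x * (T + 1) + (T + 1) ^ 2) / (2 * S ^ 2) := by ring
  rw [e4]
  linarith

/-- The same budget in terms of the integer `ζ` that the sampler uses instead of `S`. -/
theorem gaussian_exponent_sum_le {k ζ S T x : ℝ} (hk : 1 ≤ k) (hT : 1 ≤ T) (hS : T + 1 ≤ S)
    (hζ : |ζ - S| ≤ 1) (hx0 : 0 ≤ x) (hx : x ≤ 2 * k * ζ + 1 / 2) :
    1 / (4 * k ^ 2) + 2 / S + 2 * k ^ 2 / (2 * k * ζ) +
      -(2 * k ^ 2 * (x ^ 2 / (2 * k * ζ + 1 / 2) ^ 2)) + (x + (T + 1)) ^ 2 / (2 * S ^ 2) ≤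
      1 / (4 * k ^ 2) + 25 * k ^ 2 * (T + 1) / S := by
  obtain ⟨hζ1, hζ2⟩ := abs_le.1 hζ
  have hζ0 : 1 ≤ ζ := by linarith
  have hA' : 2 * k * ζ + 1 / 2 ≤ 2 * k * (S + 2) := by
    have : 2 * k * ζ ≤ 2 * k * (S + 1) := by gcongr; linarith
    linarith
  have h0 := gaussian_exponent_le hk hT hS hx0 (hx.trans hA')
  have h1 : 2 * k ^ 2 / (2 * k * ζ) ≤ 2 * k / S := by
    rw [show 2 * k ^ 2 / (2 * k * ζ) = k / ζ by field_simp, div_le_div_iff₀ (by linarith)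
      (by linarith)]
    have : k * S ≤ k * (2 * ζ) := by gcongr; linarith
    linarith
  have h2 : x ^ 2 / (2 * (S + 2) ^ 2) ≤ 2 * k ^ 2 * (x ^ 2 / (2 * k * ζ + 1 / 2) ^ 2) := by
    have h4 : (2 * k * ζ + 1 / 2) ^ 2 ≤ (2 * k * (S + 2)) ^ 2 := by
      have : 0 ≤ 2 * k * ζ + 1 / 2 := by positivity
      gcongr
    have h5 : 0 < (2 * k * ζ + 1 / 2) ^ 2 := by positivity
    calc x ^ 2 / (2 * (S + 2) ^ 2) = 2 * k ^ 2 * (x ^ 2 / (2 * k * (S + 2)) ^ 2) := by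
          have : S + 2 ≠ 0 := by linarith
          field_simp
          try norm_num
      _ ≤ _ := by gcongr
  linarith

/-- One coordinate of the sampler, shifted by `τ`, is dominated by the Gaussian ensemble. -/
theorem gaussian_domination {σ : ℝ} {b k ζ : ℕ} {T : ℝ} (hσ : 0 < σ) (hk : 1 ≤ k) (hT : 1 ≤ T)
    (hS : T + 1 ≤ σ * 2 ^ b) (hζ : |(ζ : ℝ) - σ * 2 ^ b| ≤ 1) {a : ℕ}
    (ha : a < 2 * (2 * k * ζ)) {τ : ℤ} (hτ : |(τ : ℝ)| ≤ T) :
    ((2 * (2 * k ^ 2) + 1 : ℕ) : ℝ) * ((2 * (2 * k ^ 2)).choose (2 * k ^ 2) : ℕ) *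
        (((a : ℝ) + 1) ^ (2 * k ^ 2) * (2 * (2 * k * ζ) - a) ^ (2 * k ^ 2)) ≤
      (2 * (2 * k * ζ) : ℝ) ^ (2 * (2 * k ^ 2) + 1) *
        (Real.exp (1 / (4 * k ^ 2) + 25 * k ^ 2 * (T + 1) / (σ * 2 ^ b)) *
        (Ensemble.gaussian.law σ).real
          {w | ⌊2 ^ b * w⌋ = (a : ℤ) - (2 * k * ζ : ℕ) + τ}) := by
  obtain ⟨hτ1, hτ2⟩ := abs_le.1 hτ
  obtain ⟨hζ1, hζ2⟩ := abs_le.1 hζ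
  have ha' : (a : ℝ) + 1 ≤ 2 * (2 * k * ζ) := by exact_mod_cast ha
  have ha0 : (0 : ℝ) ≤ a := by positivity
  have hk' : (1 : ℝ) ≤ k := by exact_mod_cast hk
  set S := σ * 2 ^ b with hSdef
  set m := 2 * k ^ 2 with hm
  have hS2 : 2 ≤ S := by linarith
  have hζ0 : (1 : ℝ) ≤ ζ := by linarith
  set A : ℝ := 2 * k * ζ with hA
  have hA2 : 2 ≤ A := by rw [hA]; nlinarith
  set z : ℝ := a - A + 1 / 2 with hz
  set A' : ℝ := A + 1 / 2 with hA'
  have hpi := Real.pi_pos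
  -- With the half-integer centring `z`, the ends of the shifted cell are z + τ ± 1/2, hence at
  -- distance at most |z| + T + 1 from 0.
  have hcell := gaussian_law_cell (σ := σ) (b := b) (z := (a : ℤ) - (2 * k * ζ : ℕ) + τ)
    (Y := |z| + (T + 1)) hσ
    (by
      push_cast
      rw [abs_le]
      constructor <;> cases abs_cases z <;> linarith)
    (by
      push_cast
      rw [abs_le]
      constructor <;> cases abs_cases z <;> linarith)
  -- (a + 1)(2A - a) = A'² - z², and 1 - y ≤ e^(-y) turns the m-th power into a Gaussian. No lower
  -- bound is needed, so the edges where A'² - z² is small cause no trouble.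
  have hfac : ((a : ℝ) + 1) * (2 * A - a) ≤ A' ^ 2 * Real.exp (-(z ^ 2 / A' ^ 2)) := by
    have h1 := Real.add_one_le_exp (-(z ^ 2 / A' ^ 2))
    have h2 : ((a : ℝ) + 1) * (2 * A - a) = A' ^ 2 * (-(z ^ 2 / A' ^ 2) + 1) := by
      have h3 : A' ^ 2 * (-(z ^ 2 / A' ^ 2) + 1) = A' ^ 2 - z ^ 2 := by
        have : A' ≠ 0 := by linarith
        field_simp
        ring
      rw [h3, hz, hA']; ring
    rw [h2]
    gcongr
  have hpow : ((a : ℝ) + 1) ^ m * (2 * A - a) ^ m ≤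
      (A ^ 2) ^ m * (Real.exp (m / A) * Real.exp (-(m * (z ^ 2 / A' ^ 2)))) := by
    rw [← mul_pow]
    refine (pow_le_pow_left₀ (mul_nonneg (by linarith) (by linarith)) hfac m).trans ?_
    rw [mul_pow, ← Real.exp_nat_mul, mul_neg, ← mul_assoc]
    gcongr
    have h1 : A' ≤ A * Real.exp (1 / (2 * A)) := by
      have := Real.add_one_le_exp (1 / (2 * A))
      calc A' = A * (1 / (2 * A) + 1) := by rw [hA']; field_simp; ring
        _ ≤ _ := by gcongr
    calc (A' ^ 2) ^ m ≤ ((A * Real.exp (1 / (2 * A))) ^ 2) ^ m := by gcongr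
      _ = (A ^ 2) ^ m * Real.exp (m / A) := by
        rw [mul_pow, mul_pow, ← Real.exp_nat_mul, ← Real.exp_nat_mul]
        congr 2
        push_cast
        field_simp
  -- For m = 2k² one has 2(m + 1) = (2k)²(1 + 1/(2k²)); the last factor costs e^(1/(4k²)) after the
  -- square root.
  have hsqrt : 2 * √(((m : ℕ) + 1) / Real.pi) ≤
      2 * (2 * k * Real.exp (1 / (4 * k ^ 2))) / √(2 * Real.pi) := by
    rw [mul_div_assoc]
    gcongr
    rw [le_div_iff₀ (by positivity), ← Real.sqrt_mul (by positivity), Real.sqrt_le_left (by positivity)]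
    have h1 := Real.add_one_le_exp (1 / (2 * (k : ℝ) ^ 2))
    have h2 : (Real.exp (1 / (4 * (k : ℝ) ^ 2))) ^ 2 = Real.exp (1 / (2 * k ^ 2)) := by
      rw [← Real.exp_nat_mul]; congr 1; push_cast; field_simp; norm_num
    rw [mul_pow, h2]
    have h3 : ((m : ℝ) + 1) / Real.pi * (2 * Real.pi) = (2 * k) ^ 2 * (1 / (2 * k ^ 2) + 1) := by
      rw [hm]; push_cast; field_simp; ring
    rw [h3]
    gcongr
  have hSζ : S ≤ ζ * Real.exp (2 / S) := by
    have h1 := Real.add_one_le_exp (2 / S)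
    have h2 : S ≤ (S - 1) * (2 / S + 1) := by
      have : (S - 1) * (2 / S + 1) = S + 1 - 2 / S := by field_simp; ring
      rw [this]
      have : 2 / S ≤ 1 := by rw [div_le_one (by linarith)]; exact hS2
      linarith
    refine h2.trans ?_
    gcongr
    linarith
  have hexp := gaussian_exponent_sum_le hk' hT hS hζ (abs_nonneg z)
    (show |z| ≤ 2 * k * ζ + 1 / 2 by rw [abs_le]; constructor <;> linarith)
  rw [sq_abs] at hexp
  have hfinal : Real.exp (1 / (4 * (k : ℝ) ^ 2)) * Real.exp (2 / S) *
      (Real.exp (m / A) * Real.exp (-(m * (z ^ 2 / A' ^ 2)))) ≤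
      Real.exp (1 / (4 * k ^ 2) + 25 * k ^ 2 * (T + 1) / S) *
        Real.exp (-((|z| + (T + 1)) ^ 2 / (2 * S ^ 2))) := by
    rw [← Real.exp_add, ← Real.exp_add, ← Real.exp_add, ← Real.exp_add]
    refine Real.exp_le_exp.2 ?_
    have hmr : (m : ℝ) = 2 * k ^ 2 := by rw [hm]; push_cast; ring
    rw [hmr]
    linarith
  set G := Real.exp (m / A) * Real.exp (-(m * (z ^ 2 / A' ^ 2))) with hG
  calc ((2 * m + 1 : ℕ) : ℝ) * ((2 * m).choose m : ℕ) *
        (((a : ℝ) + 1) ^ m * (2 * A - a) ^ m)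
      ≤ (4 ^ m * (2 * √((m + 1) / Real.pi))) * ((A ^ 2) ^ m * G) := by
        exact mul_le_mul (wallis_choose_le m) hpow
          (mul_nonneg (by positivity) (pow_nonneg (by linarith) _)) (by positivity)
    _ ≤ (4 ^ m * (2 * (2 * k * Real.exp (1 / (4 * k ^ 2))) / √(2 * Real.pi))) *
        ((A ^ 2) ^ m * G) := by gcongr
    _ = (2 * A) ^ (2 * m) * 2 * (2 * k) * (√(2 * Real.pi))⁻¹ * S⁻¹ *
        (S * (Real.exp (1 / (4 * k ^ 2)) * G)) := by
        rw [mul_pow 2 A, pow_mul 2, pow_mul A]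
        norm_num
        field_simp
    _ ≤ (2 * A) ^ (2 * m) * 2 * (2 * k) * (√(2 * Real.pi))⁻¹ * S⁻¹ *
        ((ζ * Real.exp (2 / S)) * (Real.exp (1 / (4 * k ^ 2)) * G)) := by gcongr
    _ = (2 * A) ^ (2 * m + 1) * (√(2 * Real.pi))⁻¹ * S⁻¹ *
        (Real.exp (1 / (4 * k ^ 2)) * Real.exp (2 / S) * G) := by
        rw [pow_succ (2 * A), hA]; ring
    _ ≤ (2 * A) ^ (2 * m + 1) * (√(2 * Real.pi))⁻¹ * S⁻¹ *
        (Real.exp (1 / (4 * k ^ 2) + 25 * k ^ 2 * (T + 1) / S) *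
        Real.exp (-((|z| + (T + 1)) ^ 2 / (2 * S ^ 2)))) := by gcongr
    _ = (2 * A) ^ (2 * m + 1) * (Real.exp (1 / (4 * k ^ 2) + 25 * k ^ 2 * (T + 1) / S) *
        ((S * √(2 * Real.pi))⁻¹ * Real.exp (-((|z| + (T + 1)) ^ 2 / (2 * S ^ 2))))) := by
        rw [mul_inv]; ring
    _ ≤ _ := by gcongr

/-! ## Dependence on the PEPS data along a line -/

/-- `F` is a polynomial function of degree at most `N`, with coefficient `c` in degree `N`. -/
def PolyTop (N : ℕ) (F : ℝ → ℂ) (c : ℂ) : Prop :=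
  ∃ g : Polynomial ℂ, g.natDegree ≤ N ∧ g.coeff N = c ∧ ∀ t : ℝ, g.eval (t : ℂ) = F t

namespace PolyTop

theorem const (c : ℂ) : PolyTop 0 (fun _ => c) c :=
  ⟨Polynomial.C c, by simp, by simp, fun t => by simp⟩

theorem linear (a c : ℂ) : PolyTop 1 (fun t => a + t * c) c :=
  ⟨Polynomial.C a + Polynomial.C c * Polynomial.X, by compute_degree, by simp,
    fun t => by simp; ring⟩

theorem zero (N : ℕ) : PolyTop N (fun _ => 0) 0 := ⟨0, by simp, by simp, fun t => by simp⟩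

theorem add {N : ℕ} {F G : ℝ → ℂ} {c e : ℂ} (hF : PolyTop N F c) (hG : PolyTop N G e) :
    PolyTop N (fun t => F t + G t) (c + e) := by
  obtain ⟨f, h1, h2, h3⟩ := hF
  obtain ⟨g, h4, h5, h6⟩ := hG
  exact ⟨f + g, Polynomial.natDegree_add_le_of_degree_le h1 h4, by simp [h2, h5],
    fun t => by simp [h3, h6]⟩

theorem mul {M N : ℕ} {F G : ℝ → ℂ} {c e : ℂ} (hF : PolyTop M F c) (hG : PolyTop N G e) :
    PolyTop (M + N) (fun t => F t * G t) (c * e) := by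
  obtain ⟨f, h1, h2, h3⟩ := hF
  obtain ⟨g, h4, h5, h6⟩ := hG
  exact ⟨f * g, Polynomial.natDegree_mul_le_of_le h1 h4,
    by rw [Polynomial.coeff_mul_add_eq_of_natDegree_le h1 h4, h2, h5], fun t => by simp [h3, h6]⟩

theorem sum {α : Type*} (s : Finset α) {N : ℕ} {F : α → ℝ → ℂ} {c : α → ℂ}
    (h : ∀ a ∈ s, PolyTop N (F a) (c a)) :
    PolyTop N (fun t => ∑ a ∈ s, F a t) (∑ a ∈ s, c a) := by
  classical
  induction s using Finset.induction_on with
  | empty => simpa using zero N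
  | insert a s ha ih =>
    simp only [Finset.sum_insert ha]
    exact (h a (by simp)).add (ih fun b hb => h b (by simp [hb]))

theorem prod {α : Type*} (s : Finset α) {N : ℕ} {F : α → ℝ → ℂ} {c : α → ℂ}
    (h : ∀ a ∈ s, PolyTop N (F a) (c a)) :
    PolyTop (s.card * N) (fun t => ∏ a ∈ s, F a t) (∏ a ∈ s, c a) := by
  classical
  induction s using Finset.induction_on with
  | empty => simpa using const 1
  | insert a s ha ih =>
    simp only [Finset.prod_insert ha, Finset.card_insert_of_notMem ha, add_mul, one_mul]
    rw [add_comm]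
    exact (h a (by simp)).mul (ih fun b hb => h b (by simp [hb]))

/-- Conjugating the coefficients works because `t` is real; this is why `F` lives on ℝ. -/
theorem star {N : ℕ} {F : ℝ → ℂ} {c : ℂ} (h : PolyTop N F c) :
    PolyTop N (fun t => star (F t)) (star c) := by
  obtain ⟨f, h1, h2, h3⟩ := h
  refine ⟨f.map (starRingEnd ℂ), Polynomial.natDegree_map_le.trans h1, by simp [h2], fun t => ?_⟩
  simp only [← h3 t, Polynomial.eval_map]
  have := Polynomial.hom_eval₂ f (RingHom.id ℂ) (starRingEnd ℂ) (t : ℂ)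
  rw [RingHom.comp_id, Complex.conj_ofReal] at this
  exact this.symm

theorem comp_mul {N : ℕ} {F : ℝ → ℂ} {c : ℂ} (h : PolyTop N F c) (δ : ℝ) :
    PolyTop N (fun t => F (t * δ)) (c * (δ : ℂ) ^ N) := by
  obtain ⟨f, h1, h2, h3⟩ := h
  refine ⟨f.comp (Polynomial.C (δ : ℂ) * Polynomial.X), ?_, ?_,
    fun t => ?_⟩
  · refine Polynomial.natDegree_comp_le.trans ?_
    have : (Polynomial.C (δ : ℂ) * Polynomial.X).natDegree ≤ 1 := by compute_degree
    nlinarith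
  · rw [Polynomial.comp_C_mul_X_coeff, h2]
  · simp only [← h3, Polynomial.eval_comp, Polynomial.eval_mul, Polynomial.eval_C,
      Polynomial.eval_X, Complex.ofReal_mul, mul_comm]

/-- The top coefficient is determined by the values at `0, 1, …, N`. -/
theorem sum_choose {N : ℕ} {F : ℝ → ℂ} {c : ℂ} (h : PolyTop N F c) :
    ∑ j ∈ Finset.range (N + 1), ((-1) ^ (N - j) * N.choose j : ℤ) * F j = N.factorial * c := by
  obtain ⟨f, h1, h2, h3⟩ := h
  have h4 := fwdDiff_iter_eq_sum_shift (1 : ℂ) (fun x => f.eval x) N 0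
  have h5 : (fwdDiff 1)^[N] (fun x => f.eval x) 0 = N.factorial * c := by
    -- The degree may drop below `N`. Then `c = 0` and the `N`-th difference vanishes.
    rcases h1.lt_or_eq with hlt | heq
    · rw [Polynomial.fwdDiff_iter_eq_zero_of_degree_lt hlt, ← h2,
        Polynomial.coeff_eq_zero_of_natDegree_lt hlt]
      simp
    · have := Polynomial.fwdDiff_iter_degree_eq_factorial f
      rw [heq] at this
      rw [this, ← h2, Polynomial.leadingCoeff, heq]
      simp [mul_comm]
  rw [← h5, h4]
  refine Finset.sum_congr rfl fun j _ => ?_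
  have := h3 j
  rw [zsmul_eq_mul, ← this]
  simp

/-- Approximate values at `0, δ, 2δ, …` give the top coefficient approximately. -/
theorem abs_sum_choose_sub_le {N : ℕ} {F : ℝ → ℂ} {c : ℂ} (h : PolyTop N F c) {δ ε : ℝ}
    {y : ℕ → ℝ} (hy : ∀ j ≤ N, ‖(y j : ℂ) - F (j * δ)‖ ≤ ε) :
    ‖((∑ j ∈ Finset.range (N + 1), ((-1) ^ (N - j) * N.choose j : ℤ) * y j : ℝ) : ℂ) -
      N.factorial * (δ : ℂ) ^ N * c‖ ≤ 2 ^ N * ε := by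
  have h1 := (h.comp_mul δ).sum_choose
  rw [mul_assoc, mul_comm ((δ : ℂ) ^ N), ← h1]
  push_cast
  rw [← Finset.sum_sub_distrib]
  refine (norm_sum_le _ _).trans ?_
  -- The signed binomial weights have absolute values summing to 2^N, which is the amplification of
  -- the error.
  have h2 : (2 : ℝ) ^ N * ε = ∑ j ∈ Finset.range (N + 1), (N.choose j : ℝ) * ε := by
    rw [← Finset.sum_mul]
    congr 1
    exact_mod_cast (Nat.sum_range_choose N).symm
  rw [h2]
  refine Finset.sum_le_sum fun j hj => ?_
  rw [← mul_sub, norm_mul, norm_mul, norm_pow, norm_neg, norm_one, one_pow, one_mul,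
    Complex.norm_natCast]
  gcongr
  exact hy j (by simpa [Nat.lt_succ_iff] using hj)

end PolyTop

/-- In each term every one of the n² sites appears exactly once, through a factor linear in `t`; the
boundary condition does not involve the data. -/
theorem state_polyTop {n D d : ℕ} (P X : Idx n D d → ℂ) (x : Config n d) :
    PolyTop (n ^ 2) (fun t => state (fun i => P i + t * X i) x) (state X x) := by
  unfold state
  refine PolyTop.sum _ fun h _ => PolyTop.sum _ fun v _ => ?_
  split_ifs
  · have := PolyTop.prod (Finset.univ : Finset (Fin n)) (N := n) (F := fun i t => ∏ j : Fin n,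
      (P (i, j, h i j.castSucc, h i j.succ, v i.castSucc j, v i.succ j, x (i, j)) +
      t * X (i, j, h i j.castSucc, h i j.succ, v i.castSucc j, v i.succ j, x (i, j))))
      (c := fun i => ∏ j : Fin n,
        X (i, j, h i j.castSucc, h i j.succ, v i.castSucc j, v i.succ j, x (i, j))) fun i _ => by
        simpa using PolyTop.prod (Finset.univ : Finset (Fin n)) (N := 1) fun j _ =>
          PolyTop.linear (P (i, j, h i j.castSucc, h i j.succ, v i.castSucc j, v i.succ j, x (i, j)))
            (X (i, j, h i j.castSucc, h i j.succ, v i.castSucc j, v i.succ j, x (i, j)))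
    simpa [sq] using this
  · exact PolyTop.zero _

theorem value_polyTop {n D d s : ℕ} (τ : Task) (P X : Idx n D d → ℂ) (A : τ.Obs n d s) :
    PolyTop (2 * n ^ 2) (fun t => τ.value (fun i => P i + t * X i) A) (τ.value X A) := by
  rw [two_mul]
  cases τ with
  | contraction =>
    simp only [Task.value, dotProduct, Pi.star_apply]
    exact PolyTop.sum _ fun x _ => (state_polyTop P X x).star.mul (state_polyTop P X x)
  | expectation k =>
    simp only [Task.value, dotProduct, Pi.star_apply, Matrix.mulVec]
    refine PolyTop.sum _ fun x _ => (state_polyTop P X x).star.mul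
      (PolyTop.sum _ fun y _ => ?_)
    simpa using (PolyTop.const _).mul (state_polyTop P X y)

/-! ## Random digits -/

theorem median_congr {m : ℕ} {f g : ℕ → ℤ} (h : ∀ j < 2 * m + 1, f j = g j) :
    median m f = median m g := by
  have hLT : ∀ x, numLT (2 * m + 1) f x = numLT (2 * m + 1) g x := fun x => by
    unfold numLT
    congr 1
    exact Finset.filter_congr fun j hj => by rw [h j (Finset.mem_range.1 hj)]
  have hGT : ∀ x, numGT (2 * m + 1) f x = numGT (2 * m + 1) g x := fun x => by
    unfold numGT
    congr 1
    exact Finset.filter_congr fun j hj => by rw [h j (Finset.mem_range.1 hj)]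
  have : ∀ k ≤ 2 * m + 1, medianAux (2 * m + 1) m f k = medianAux (2 * m + 1) m g k := by
    intro k
    induction k with
    | zero => intro _; rfl
    | succ k ih =>
      intro hk
      simp only [medianAux]
      rw [ih (by omega), h k (by omega), hLT, hGT]
  exact this _ le_rfl

/-- The median of finitely many numbers below `L`. -/
def medianFin {m L : ℕ} (d : Fin (2 * m + 1) → Fin L) : ℤ :=
  median m fun j => if h : j < 2 * m + 1 then ((d ⟨j, h⟩ : ℕ) : ℤ) else 0

theorem medianFin_spec {m L : ℕ} (d : Fin (2 * m + 1) → Fin L) :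
    ∃ a : Fin L, medianFin d = (a : ℕ) ∧ IsMedian m d a := by
  obtain ⟨k, hk, h1, h2, h3⟩ := median_spec m
    fun j => if h : j < 2 * m + 1 then ((d ⟨j, h⟩ : ℕ) : ℤ) else 0
  refine ⟨d ⟨k, hk⟩, by rw [medianFin, h1, dif_pos hk], ⟨k, hk⟩, rfl, ?_, ?_⟩
  · refine le_trans (le_of_eq ?_) h2
    refine Finset.card_bij (fun t _ => t.1) (fun t ht => ?_) (fun t _ t' _ h => Fin.ext h)
      fun j hj => ?_
    · have ht' := (Finset.mem_filter.1 ht).2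
      simp only [Finset.mem_filter, Finset.mem_range, dif_pos hk, dif_pos t.2]
      exact ⟨t.2, by exact_mod_cast ht'⟩
    · simp only [Finset.mem_filter, Finset.mem_range, dif_pos hk] at hj
      rw [dif_pos hj.1] at hj
      exact ⟨⟨j, hj.1⟩, by simpa using hj.2, rfl⟩
  · refine le_trans (le_of_eq ?_) h3
    refine Finset.card_bij (fun t _ => t.1) (fun t ht => ?_) (fun t _ t' _ h => Fin.ext h)
      fun j hj => ?_
    · have ht' := (Finset.mem_filter.1 ht).2
      simp only [Finset.mem_filter, Finset.mem_range, dif_pos hk, dif_pos t.2]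
      exact ⟨t.2, by exact_mod_cast ht'⟩
    · simp only [Finset.mem_filter, Finset.mem_range, dif_pos hk] at hj
      rw [dif_pos hj.1] at hj
      exact ⟨⟨j, hj.1⟩, by simpa using hj.2, rfl⟩

theorem card_medianFin_le {m L : ℕ} (a : Fin L) :
    (Finset.univ.filter fun d : Fin (2 * m + 1) → Fin L => medianFin d = (a : ℕ)).card ≤
      (2 * m + 1) * (2 * m).choose m * ((a + 1) ^ m * (L - a) ^ m) := by
  classical
  refine le_trans (Finset.card_le_card fun d hd => ?_)
    (card_isMedian_le (T := Fin (2 * m + 1)) (by simp) a.2)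
  obtain ⟨a', h1, h2⟩ := medianFin_spec d
  have h3 := (Finset.mem_filter.1 hd).2
  rw [h1] at h3
  rw [show (a : ℕ) = a' by exact_mod_cast h3.symm]
  exact Finset.mem_filter.2 ⟨Finset.mem_univ _, h2⟩

/-- The probability that at least half of an odd number of independent trials fail. -/
theorem card_majority_le {G : Type*} [Fintype G] (bad : G → Prop) [DecidablePred bad] (ρ : ℕ)
    (h : ((Finset.univ.filter bad).card : ℝ) ≤ Fintype.card G / 3) :
    ((Finset.univ.filter fun g : Fin (2 * ρ + 1) → G =>
      ρ < (Finset.univ.filter fun j => bad (g j)).card).card : ℝ) ≤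
      2 / 3 * (8 / 9) ^ ρ * (Fintype.card G : ℝ) ^ (2 * ρ + 1) := by
  classical
  -- Exponential moment method: the mean of 2^(number of failures) is at most (4/3)^(2ρ + 1), while
  -- a bad majority contributes at least 2^(ρ + 1).
  have h1 : ∑ g : Fin (2 * ρ + 1) → G, ∏ j, (if bad (g j) then (2 : ℝ) else 1) =
      (∑ x : G, if bad x then (2 : ℝ) else 1) ^ (2 * ρ + 1) := by
    rw [← Fintype.piFinset_univ, ← Finset.prod_univ_sum
      (fun _ : Fin (2 * ρ + 1) => (Finset.univ : Finset G)) fun _ x => if bad x then (2 : ℝ) else 1]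
    simp
  have h2 : (∑ x : G, if bad x then (2 : ℝ) else 1) ≤ 4 / 3 * Fintype.card G := by
    have : ∀ x : G, (if bad x then (2 : ℝ) else 1) = 1 + if bad x then 1 else 0 := fun x => by
      split_ifs <;> norm_num
    simp only [this, Finset.sum_add_distrib, Finset.sum_boole, Finset.sum_const, Finset.card_univ,
      nsmul_eq_mul, mul_one]
    linarith
  have h3 : (Finset.univ.filter fun g : Fin (2 * ρ + 1) → G =>
      ρ < (Finset.univ.filter fun j => bad (g j)).card).card * (2 : ℝ) ^ (ρ + 1) ≤
      ∑ g : Fin (2 * ρ + 1) → G, ∏ j, (if bad (g j) then (2 : ℝ) else 1) := by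
    rw [← nsmul_eq_mul, ← Finset.sum_const]
    refine (Finset.sum_le_sum fun g hg => ?_).trans
      (Finset.sum_le_sum_of_subset_of_nonneg (Finset.filter_subset _ _)
        fun g _ _ => Finset.prod_nonneg fun j _ => by split_ifs <;> norm_num)
    rw [Finset.prod_ite, Finset.prod_const, Finset.prod_const_one, mul_one]
    exact pow_le_pow_right₀ (by norm_num) (Finset.mem_filter.1 hg).2
  have h0 : (0 : ℝ) ≤ ∑ x : G, if bad x then (2 : ℝ) else 1 :=
    Finset.sum_nonneg fun x _ => by split_ifs <;> norm_num
  have h4 := h3.trans (h1.le.trans (pow_le_pow_left₀ h0 h2 _))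
  have h5 : (4 / 3 * (Fintype.card G : ℝ)) ^ (2 * ρ + 1) =
      (2 / 3 * (8 / 9) ^ ρ * (Fintype.card G : ℝ) ^ (2 * ρ + 1)) * 2 ^ (ρ + 1) := by
    rw [mul_pow, pow_succ (4 / 3 : ℝ), pow_mul, show ((4 / 3 : ℝ) ^ 2) = 8 / 9 * 2 by norm_num,
      mul_pow, pow_succ (2 : ℝ)]
    ring
  rw [h5] at h4
  exact le_of_mul_le_mul_right h4 (by positivity)

/-- The `k`-th digit of `r` in base `L`. -/
def digit {L : ℕ} (hL : 0 < L) (r k : ℕ) : Fin L := ⟨r / L ^ k % L, Nat.mod_lt _ hL⟩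

/-- The first `K` digits determine `r` modulo L^K, so integers with prescribed digits are told apart
by their quotient by L^K. A digit string thus has at most 2^c / L^K + 1 preimages, and L^K ≤ 2^c
makes this at most twice the average. -/
theorem card_digit_le {κ : Type*} [Fintype κ] [DecidableEq κ] {c L K : ℕ} (hL : 0 < L)
    (hc : L ^ K ≤ 2 ^ c) (e : κ ≃ Fin K) (S : (κ → Fin L) → Prop) [DecidablePred S] :
    ((Finset.univ.filter fun r : Fin (2 ^ c) => S fun x => digit hL r (e x)).card : ℝ) * L ^ K ≤
      2 * 2 ^ c * (Finset.univ.filter S).card := by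
  have hM : 0 < L ^ K := Nat.pow_pos hL
  have hfib : ∀ s : κ → Fin L,
      (Finset.univ.filter fun r : Fin (2 ^ c) => (fun x => digit hL r (e x)) = s).card ≤
        2 ^ c / L ^ K + 1 := by
    intro s
    rw [← Finset.card_range (2 ^ c / L ^ K + 1)]
    refine Finset.card_le_card_of_injOn (fun r => (r : ℕ) / L ^ K) (fun r _ => ?_) ?_
    · simp only [Finset.coe_range, Set.mem_Iio, Nat.lt_succ_iff]
      exact Nat.div_le_div_right r.2.le
    · intro r hr r' hr' hdiv
      rw [Finset.mem_coe, Finset.mem_filter] at hr hr'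
      have hmod : (r : ℕ) % L ^ K = (r' : ℕ) % L ^ K := by
        have key : ∀ t : ℕ, ∀ k : Fin K,
            ((finFunctionFinEquiv.symm (⟨t % L ^ K, Nat.mod_lt _ hM⟩ : Fin (L ^ K))) k : ℕ) =
              t / L ^ (k : ℕ) % L := by
          intro t k
          rw [finFunctionFinEquiv_symm_apply_val, ← Nat.mod_mul_right_div_self,
            ← Nat.mod_mul_right_div_self, ← pow_succ, Nat.mod_mod_of_dvd _ (pow_dvd_pow L k.2)]
        have : (⟨(r : ℕ) % L ^ K, Nat.mod_lt _ hM⟩ : Fin (L ^ K)) =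
            ⟨(r' : ℕ) % L ^ K, Nat.mod_lt _ hM⟩ := by
          apply finFunctionFinEquiv.symm.injective
          funext k
          apply Fin.ext
          rw [key, key]
          have := congrFun (hr.2.trans hr'.2.symm) (e.symm k)
          simpa [digit] using this
        exact congrArg Fin.val this
      apply Fin.ext
      rw [← Nat.div_add_mod (r : ℕ) (L ^ K), ← Nat.div_add_mod (r' : ℕ) (L ^ K), hmod]
      simp only at hdiv
      rw [hdiv]
  have hsub : (Finset.univ.filter fun r : Fin (2 ^ c) => S fun x => digit hL r (e x)) ⊆
      (Finset.univ.filter S).biUnion fun s =>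
        Finset.univ.filter fun r : Fin (2 ^ c) => (fun x => digit hL r (e x)) = s := by
    intro r hr
    have hr' := (Finset.mem_filter.1 hr).2
    simpa using hr'
  have h1 : (Finset.univ.filter fun r : Fin (2 ^ c) => S fun x => digit hL r (e x)).card ≤
      (Finset.univ.filter S).card * (2 ^ c / L ^ K + 1) :=
    (Finset.card_le_card hsub).trans (Finset.card_biUnion_le_card_mul _ _ _ fun s _ => hfib s)
  have h2 : (2 ^ c / L ^ K + 1) * L ^ K ≤ 2 * 2 ^ c := by
    have := Nat.div_mul_le_self (2 ^ c) (L ^ K)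
    rw [add_mul]
    omega
  have h3 := Nat.mul_le_mul_right (L ^ K) h1
  have h4 : (Finset.univ.filter S).card * (2 ^ c / L ^ K + 1) * L ^ K ≤
      2 * 2 ^ c * (Finset.univ.filter S).card := by
    rw [mul_assoc, mul_comm (2 * 2 ^ c)]
    exact Nat.mul_le_mul_left _ h2
  exact_mod_cast h3.trans h4

/-! ## Comparison of the sampled PEPS data with the ensemble -/

/-- Probability that a coordinate rounds to `z`. -/
noncomputable def cellProb (E : Ensemble) (σ : ℝ) (b : ℕ) (z : ℤ) : ℝ :=
  (E.law σ).real {w | ⌊2 ^ b * w⌋ = z}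

theorem Ensemble.isProbabilityMeasure_law (E : Ensemble) {σ : ℝ} (hσ : 0 < σ) :
    IsProbabilityMeasure (E.law σ) := by
  cases E with
  | uniform =>
    refine cond_isProbabilityMeasure_of_finite ?_ ?_
    · rw [Real.volume_Icc, Ne, ENNReal.ofReal_eq_zero]; linarith
    · rw [Real.volume_Icc]; exact ENNReal.ofReal_ne_top
  | gaussian => rw [Ensemble.law]; infer_instance

theorem measurable_round (b : ℕ) : Measurable (round b) := by
  unfold round
  fun_prop

theorem dataLaw_round_eq (E : Ensemble) {σ : ℝ} (hσ : 0 < σ) {n D d : ℕ} (b : ℕ)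
    (y : Idx n D d → ℤ × ℤ) :
    (E.dataLaw σ n D d).real {W | (fun i => round b (W i)) = y} =
      ∏ i, (cellProb E σ b (y i).1 * cellProb E σ b (y i).2) := by
  have := E.isProbabilityMeasure_law hσ
  have h1 : {W : Idx n D d → ℝ × ℝ | (fun i => round b (W i)) = y} =
      Set.pi Set.univ fun i =>
        ({w | ⌊2 ^ b * w⌋ = (y i).1} ×ˢ {w | ⌊2 ^ b * w⌋ = (y i).2} : Set (ℝ × ℝ)) := by
    ext W
    simp [funext_iff, round, Prod.ext_iff]
  rw [h1, Ensemble.dataLaw, measureReal_def, Measure.pi_pi, ENNReal.toReal_prod]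
  refine Finset.prod_congr rfl fun i _ => ?_
  rw [Measure.prod_prod, ENNReal.toReal_mul]
  rfl

/-- Distinct rounded data come from disjoint events. The sampler reaches finitely many data only, so
a finite sum and an inequality are enough. -/
theorem sum_dataLaw_le (E : Ensemble) {σ : ℝ} (hσ : 0 < σ) {n D d : ℕ} (b : ℕ)
    (F : Finset (Idx n D d → ℤ × ℤ)) (bad : (Idx n D d → ℤ × ℤ) → Prop) (hF : ∀ y ∈ F, bad y) :
    ∑ y ∈ F, ∏ i, (cellProb E σ b (y i).1 * cellProb E σ b (y i).2) ≤
      (E.dataLaw σ n D d).real {W | bad fun i => round b (W i)} := by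
  have := E.isProbabilityMeasure_law hσ
  have hP : IsProbabilityMeasure (E.dataLaw σ n D d) := by unfold Ensemble.dataLaw; infer_instance
  simp only [← dataLaw_round_eq E hσ]
  rw [← measureReal_biUnion_finset]
  · refine measureReal_mono fun W hW => ?_
    simp only [Set.mem_iUnion] at hW
    obtain ⟨y, hy, hW⟩ := hW
    have hW' : (fun i => round b (W i)) = y := hW
    show bad _
    rw [hW']
    exact hF y hy
  · intro y _ y' _ hne
    rw [Function.onFun, Set.disjoint_left]
    intro W hW hW'
    exact hne (Eq.trans (Eq.symm hW) hW')
  · intro y _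
    have hm : Measurable fun W : Idx n D d → ℝ × ℝ => fun i => round b (W i) :=
      measurable_pi_lambda _ fun i => (measurable_round b).comp (measurable_pi_apply i)
    exact hm (measurableSet_singleton y)

/-- PEPS data sampled from digits: medians, centred. -/
def sampleData {n D d m L : ℕ} (A : ℕ)
    (g : Idx n D d × Fin 2 → Fin (2 * m + 1) → Fin L) (i : Idx n D d) : ℤ × ℤ :=
  (medianFin (g (i, 0)) - A, medianFin (g (i, 1)) - A)

/-- Sampled and slightly shifted PEPS data are bad with essentially at most the probability of bad
data in the ensemble. -/
theorem card_sampleData_le (E : Ensemble) {σ η β T : ℝ} (hσ : 0 < σ) {n D d b m A : ℕ}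
    (hdom : ∀ a : ℕ, a < 2 * A → ∀ τ : ℤ, |(τ : ℝ)| ≤ T →
      (((2 * m + 1) * (2 * m).choose m * ((a + 1) ^ m * (2 * A - a) ^ m) : ℕ) : ℝ) ≤
        (2 * A : ℝ) ^ (2 * m + 1) * (Real.exp η * cellProb E σ b (a - A + τ)))
    (V : Idx n D d → ℤ × ℤ) (hV : ∀ i, |((V i).1 : ℝ)| ≤ T ∧ |((V i).2 : ℝ)| ≤ T)
    (bad : (Idx n D d → ℤ × ℤ) → Prop)
    (hbad : (E.dataLaw σ n D d).real {W | bad fun i => round b (W i)} ≤ β)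
    (S : (Idx n D d × Fin 2 → Fin (2 * m + 1) → Fin (2 * A)) → Prop) [DecidablePred S]
    (hS : ∀ g, S g → bad fun i => sampleData A g i + V i) :
    ((Finset.univ.filter S).card : ℝ) ≤
      ((2 * A : ℝ) ^ (2 * m + 1) * Real.exp η) ^ (2 * Fintype.card (Idx n D d)) * β := by
  classical
  let sh : (Idx n D d × Fin 2) → ℤ := fun x => if x.2 = 0 then (V x.1).1 else (V x.1).2
  let Y : ((Idx n D d × Fin 2) → Fin (2 * A)) → Idx n D d → ℤ × ℤ := fun a i =>
    (((a (i, 0) : ℕ) : ℤ) - A + (V i).1, ((a (i, 1) : ℕ) : ℤ) - A + (V i).2)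
  set badA : Finset ((Idx n D d × Fin 2) → Fin (2 * A)) := Finset.univ.filter fun a => bad (Y a) with hbadA
  -- The digit strings are grouped by their tuples of medians; for a fixed tuple the count
  -- factorises over the coordinates, and each factor is dominated by a cell probability.
  have hsub : Finset.univ.filter S ⊆ badA.biUnion fun a => Fintype.piFinset fun x =>
      Finset.univ.filter fun d : Fin (2 * m + 1) → Fin (2 * A) => medianFin d = (a x : ℕ) := by
    intro g hg
    have hg' := hS g (Finset.mem_filter.1 hg).2
    choose a ha _ using fun x => medianFin_spec (g x)
    rw [Finset.mem_biUnion]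
    refine ⟨a, Finset.mem_filter.2 ⟨Finset.mem_univ _, ?_⟩, ?_⟩
    · convert hg' using 2 with i
      simp only [Y, sampleData, ha, Prod.ext_iff, Prod.fst_add, Prod.snd_add,
        and_self]
    · rw [Fintype.mem_piFinset]
      exact fun x => Finset.mem_filter.2 ⟨Finset.mem_univ _, ha x⟩
  have hcount : ∀ a : (Idx n D d × Fin 2) → Fin (2 * A), ((Fintype.piFinset fun x => Finset.univ.filter fun
      d : Fin (2 * m + 1) → Fin (2 * A) => medianFin d = (a x : ℕ)).card : ℝ) ≤
      ((2 * A : ℝ) ^ (2 * m + 1) * Real.exp η) ^ (2 * Fintype.card (Idx n D d)) *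
        ∏ i, (cellProb E σ b (Y a i).1 * cellProb E σ b (Y a i).2) := by
    intro a
    rw [Fintype.card_piFinset]
    push_cast
    have h1 : ∀ x ∈ (Finset.univ : Finset (Idx n D d × Fin 2)), ((Finset.univ.filter fun
        d : Fin (2 * m + 1) → Fin (2 * A) => medianFin d = (a x : ℕ)).card : ℝ) ≤
        (2 * A : ℝ) ^ (2 * m + 1) * Real.exp η * cellProb E σ b ((a x : ℕ) - A + sh x) := by
      intro x _
      have h2 : (((Finset.univ.filter fun
        d : Fin (2 * m + 1) → Fin (2 * A) => medianFin d = (a x : ℕ)).card : ℕ) : ℝ) ≤ _ :=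
        Nat.cast_le.2 (card_medianFin_le (m := m) (a x))
      refine h2.trans ((hdom (a x) (a x).2 (sh x) ?_).trans_eq (by ring))
      simp only [sh]
      split_ifs
      · exact (hV _).1
      · exact (hV _).2
    refine (Finset.prod_le_prod (fun _ _ => by positivity) h1).trans_eq ?_
    rw [Finset.prod_mul_distrib, Finset.prod_const, Finset.card_univ, Fintype.card_prod,
      Fintype.card_fin, mul_comm (Fintype.card (Idx n D d)), Fintype.prod_prod_type]
    simp [Fin.prod_univ_two, sh, Y]
  -- The shift `V` is fixed, so distinct medians give distinct data and no cell is counted twice.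
  have hYinj : Function.Injective Y := by
    intro a a' h
    funext x
    obtain ⟨i, c⟩ := x
    have h1 := congrFun h i
    simp only [Y, Prod.mk.injEq, add_left_inj, sub_left_inj, Nat.cast_inj] at h1
    fin_cases c
    · exact Fin.ext h1.1
    · exact Fin.ext h1.2
  have hβ : 0 ≤ ((2 * A : ℝ) ^ (2 * m + 1) * Real.exp η) ^ (2 * Fintype.card (Idx n D d)) := by
    positivity
  calc ((Finset.univ.filter S).card : ℝ)
      ≤ ∑ a ∈ badA, ((Fintype.piFinset fun x => Finset.univ.filter fun
          d : Fin (2 * m + 1) → Fin (2 * A) => medianFin d = (a x : ℕ)).card : ℝ) := by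
        exact_mod_cast (Finset.card_le_card hsub).trans Finset.card_biUnion_le
    _ ≤ ∑ a ∈ badA, ((2 * A : ℝ) ^ (2 * m + 1) * Real.exp η) ^ (2 * Fintype.card (Idx n D d)) *
          ∏ i, (cellProb E σ b (Y a i).1 * cellProb E σ b (Y a i).2) :=
        Finset.sum_le_sum fun a _ => hcount a
    _ = ((2 * A : ℝ) ^ (2 * m + 1) * Real.exp η) ^ (2 * Fintype.card (Idx n D d)) *
          ∑ y ∈ badA.image Y, ∏ i, (cellProb E σ b (y i).1 * cellProb E σ b (y i).2) := by
        rw [← Finset.mul_sum, Finset.sum_image fun a _ a' _ h => hYinj h]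
    _ ≤ _ := by
        refine mul_le_mul_of_nonneg_left ?_ hβ
        refine (sum_dataLaw_le E hσ b _ bad fun y hy => ?_).trans hbad
        obtain ⟨a, ha, rfl⟩ := Finset.mem_image.1 hy
        exact (Finset.mem_filter.1 ha).2

/-! ## Parameters of the sampler -/

/-- The sampler takes medians of `2 m + 1` uniform numbers, where `m` is this number, for PEPS data
with at most `I` entries. -/
def Ensemble.medianOrder (I : ℕ) : Ensemble → ℕ
  | .uniform => 0
  | .gaussian => 2 * (2 * I) ^ 2

/-- The sampler uses uniform integers in `[-A, A)`, where `A` is this number.  Here `ζ`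
approximates the standard deviation or half-width in units of the mesh, and `T` bounds the shifts. -/
def Ensemble.radius (I T : ℕ) (ζ : ℤ) : Ensemble → ℕ
  | .uniform => (ζ - T - 1).toNat
  | .gaussian => (2 * (2 * I) * ζ).toNat

/-- Needed only to bound the number of random bits. -/
theorem Ensemble.radius_le (E : Ensemble) {I T : ℕ} {ζ : ℤ} {S : ℝ} (hI : 1 ≤ I) (hS : 0 ≤ S)
    (hζ : |(ζ : ℝ) - S| ≤ 1) : (E.radius I T ζ : ℝ) ≤ 4 * I * (S + 1) := by
  have hI' : (1 : ℝ) ≤ I := by exact_mod_cast hI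
  have hζ2 := (abs_le.1 hζ).2
  cases E with
  | uniform =>
    have h : (((ζ - T - 1).toNat : ℤ) : ℝ) ≤ ((max (ζ - T - 1) 0 : ℤ) : ℝ) := by
      rw [Int.ofNat_toNat]
    rw [Ensemble.radius]
    push_cast at h
    refine h.trans (max_le ?_ (by positivity))
    have : (0 : ℝ) ≤ T := by positivity
    nlinarith
  | gaussian =>
    have h : (((2 * (2 * I) * ζ).toNat : ℤ) : ℝ) ≤ ((max (2 * (2 * I) * ζ) 0 : ℤ) : ℝ) := by
      rw [Int.ofNat_toNat]
    rw [Ensemble.radius]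
    push_cast at h
    refine h.trans (max_le ?_ (by positivity))
    nlinarith

/-- The loss 1/(8I) per coordinate adds up to at most 1/4 over 2I coordinates. In the Gaussian case
k = 2I leaves 1/(16I) for the median approximation and 1/(16I) for the shift; as 25k²(T + 1) ≤ 200
I² T, the latter asks for the constant 3200 = 16 · 200. -/
theorem Ensemble.domination (E : Ensemble) {σ : ℝ} {b I T : ℕ} {ζ : ℤ} (hσ : 0 < σ) (hI : 1 ≤ I)
    (hT : 1 ≤ T) (hS : 3200 * (I : ℝ) ^ 3 * T ≤ σ * 2 ^ b) (hζ : |(ζ : ℝ) - σ * 2 ^ b| ≤ 1) :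
    0 < E.radius I T ζ ∧ ∀ a : ℕ, a < 2 * E.radius I T ζ → ∀ τ : ℤ, |(τ : ℝ)| ≤ T →
      (((2 * E.medianOrder I + 1) * (2 * E.medianOrder I).choose (E.medianOrder I) *
        ((a + 1) ^ E.medianOrder I * (2 * E.radius I T ζ - a) ^ E.medianOrder I) : ℕ) : ℝ) ≤
        (2 * E.radius I T ζ : ℝ) ^ (2 * E.medianOrder I + 1) *
          (Real.exp (1 / (8 * I)) * cellProb E σ b (a - E.radius I T ζ + τ)) := by
  have hI' : (1 : ℝ) ≤ I := by exact_mod_cast hI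
  have hT' : (1 : ℝ) ≤ T := by exact_mod_cast hT
  set S := σ * 2 ^ b with hSdef
  have hI3 : (I : ℝ) ≤ (I : ℝ) ^ 3 := by
    nlinarith [mul_le_mul hI' hI' (by norm_num) (by linarith)]
  have hIT : (I : ℝ) * T ≤ (I : ℝ) ^ 3 * T := by gcongr
  have hTI : (T : ℝ) ≤ I * T := by nlinarith
  have hS0 : 0 < S := by positivity
  obtain ⟨hζ1, hζ2⟩ := abs_le.1 hζ
  have hζ0 : (T : ℝ) + 1 < ζ := by nlinarith
  have hζ0' : (T : ℤ) + 1 < ζ := by exact_mod_cast hζ0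
  cases E with
  | uniform =>
    have hA : (((ζ - T - 1).toNat : ℕ) : ℝ) = ζ - T - 1 := by
      have : (((ζ - T - 1).toNat : ℕ) : ℤ) = ζ - T - 1 := Int.toNat_of_nonneg (by omega)
      exact_mod_cast congrArg (Int.cast : ℤ → ℝ) this
    simp only [Ensemble.radius, Ensemble.medianOrder]
    refine ⟨by omega, fun a ha τ hτ => ?_⟩
    have hAη : S ≤ ((ζ - T - 1).toNat : ℕ) * Real.exp (1 / (8 * I)) := by
      rw [hA]
      have h1 := Real.add_one_le_exp (1 / (8 * (I : ℝ)))
      have h2 : S - T - 2 ≤ (ζ : ℝ) - T - 1 := by linarith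
      have h3 : S ≤ (S - T - 2) * (1 / (8 * I) + 1) := by
        have h4 : (T : ℝ) + 2 ≤ S / (16 * I) := by
          rw [le_div_iff₀ (by positivity)]
          nlinarith
        have h5 : S / (8 * I) = 2 * (S / (16 * I)) := by field_simp; norm_num
        have h6 : (S - T - 2) * (1 / (8 * I) + 1) = S / (8 * I) - ((T : ℝ) + 2) * (1 / (8 * I)) +
            S - (T + 2) := by ring
        have h7 : ((T : ℝ) + 2) * (1 / (8 * I)) ≤ (T + 2) * 1 := by
          gcongr
          rw [div_le_one (by positivity)]
          linarith
        rw [h6]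
        linarith
      have h8 : 0 ≤ S - T - 2 := by nlinarith
      exact h3.trans (mul_le_mul h2 h1 (by positivity) (by linarith))
    have := uniform_domination (T := (T : ℝ)) (b := b) hσ (by rw [hA]; linarith) hAη ha hτ
    simpa [cellProb] using this
  | gaussian =>
    obtain ⟨z, rfl⟩ : ∃ z : ℕ, ζ = z := ⟨ζ.toNat, (Int.toNat_of_nonneg (by omega)).symm⟩
    have hA : (2 * (2 * (I : ℤ)) * z).toNat = 2 * (2 * I) * z := by
      rw [show (2 * (2 * (I : ℤ)) * z) = ((2 * (2 * I) * z : ℕ) : ℤ) by push_cast; ring,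
        Int.toNat_natCast]
    simp only [Ensemble.radius, Ensemble.medianOrder, hA]
    refine ⟨?_, fun a ha τ hτ => ?_⟩
    · have : 0 < z := by omega
      positivity
    have key := gaussian_domination (σ := σ) (b := b) (k := 2 * I) (ζ := z) (T := (T : ℝ)) hσ
      (by omega) hT' (by nlinarith) (by simpa using hζ) ha hτ
    have hexp : 1 / (4 * ((2 * I : ℕ) : ℝ) ^ 2) + 25 * ((2 * I : ℕ) : ℝ) ^ 2 * (T + 1) / S ≤
        1 / (8 * I) := by
      push_cast
      have e1 : 1 / (4 * (2 * (I : ℝ)) ^ 2) ≤ 1 / (16 * I) := by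
        apply one_div_le_one_div_of_le (by positivity)
        nlinarith
      have e2 : 25 * (2 * (I : ℝ)) ^ 2 * (T + 1) / S ≤ 1 / (16 * I) := by
        rw [div_le_div_iff₀ hS0 (by positivity)]
        have : (I : ℝ) ^ 3 * (T + 1) ≤ (I : ℝ) ^ 3 * (2 * T) := by gcongr; linarith
        nlinarith
      have e3 : 1 / (8 * (I : ℝ)) = 1 / (16 * I) + 1 / (16 * I) := by field_simp; norm_num
      linarith
    have hcell : 0 ≤ cellProb .gaussian σ b (a - (2 * (2 * I) * z : ℕ) + τ) := measureReal_nonneg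
    refine le_trans (le_of_eq ?_) (key.trans (le_trans (mul_le_mul_of_nonneg_left
      (mul_le_mul_of_nonneg_right (Real.exp_le_exp.2 hexp) hcell) (by positivity)) (le_of_eq ?_)))
    · push_cast [Nat.cast_sub ha.le]
      ring
    · rw [cellProb]
      push_cast
      ring

/-! ## The reduction -/

theorem length_idxList (n D d : ℕ) :
    (idxList n D d).length = n * (n * (D * (D * (D * (D * d))))) := by
  simp [idxList, List.length_product]

theorem mem_idxList {n D d : ℕ} (x : Idx n D d) : x ∈ idxList n D d := by
  obtain ⟨x₁, x₂, x₃, x₄, x₅, x₆, x₇⟩ := x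
  simp [idxList, List.mem_product]

theorem nodup_idxList (n D d : ℕ) : (idxList n D d).Nodup := by
  unfold idxList
  repeat' apply List.Nodup.product
  all_goals exact List.nodup_finRange _

/-- The position of an index in the list of all indices. -/
def position (n D d : ℕ) : Idx n D d ≃ Fin (idxList n D d).length :=
  ((nodup_idxList n D d).getEquivOfForallMemList _ mem_idxList).symm

theorem position_getElem {n D d k : ℕ} (h : k < (idxList n D d).length) :
    (position n D d ((idxList n D d)[k]) : ℕ) = k := by
  have : position n D d ((idxList n D d)[k]) = ⟨k, h⟩ :=
    (position n D d).symm.injective (by rw [Equiv.symm_apply_apply]; rfl)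
  rw [this]

theorem card_idx (n D d : ℕ) : Fintype.card (Idx n D d) = (idxList n D d).length := by
  rw [Fintype.card_congr (position n D d), Fintype.card_fin]

/-- An instance of the problem: PEPS data as integers, and an observable. -/
structure Inst (τ : Task) (d : ℕ) (D : ℕ → ℕ) (s : Polynomial ℕ) : Type where
  n : ℕ
  pos : 1 ≤ n
  data : Idx n (D (n ^ 2)) d → ℤ × ℤ
  obs : τ.Obs n d (s.eval (n ^ 2))

namespace Inst

variable {τ : Task} {d : ℕ} {D : ℕ → ℕ} {s : Polynomial ℕ}

/-- The encoding of an instance, when the PEPS data has precision `b`. -/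
def code (b : Polynomial ℕ) (i : Inst τ d D s) : Val :=
  encode τ (b.eval (i.n ^ 2)) i.data i.obs

/-- The number of entries of the PEPS data. -/
def len (i : Inst τ d D s) : ℕ := (idxList i.n (D (i.n ^ 2)) d).length

theorem len_eq (i : Inst τ d D s) : i.len = i.n * (i.n * (D (i.n ^ 2) * (D (i.n ^ 2) *
    (D (i.n ^ 2) * (D (i.n ^ 2) * d))))) := length_idxList _ _ _

end Inst

/-- The median of `2 m + 1` digits of `r` in base `2 A`, centred; `x` selects the digits. -/
def sampleInt (m A r x : ℕ) : ℤ :=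
  median m (fun t => ((r / (2 * A) ^ (x * (2 * m + 1) + t) % (2 * A) : ℕ) : ℤ)) - A

/-- Data of the reduction: the ensemble, polynomials (the precision `2⁻ᵃ` of the shifts, the
precision `b` of the average-case instances, the precision `g` of the answers, the number `2 ρ + 1`
of repetitions, a bound on the number of entries), approximations to `σ 2ᵐ`, and the answers
on average-case instances. -/
structure Reduction (τ : Task) (d : ℕ) (D : ℕ → ℕ) (s : Polynomial ℕ) : Type where
  E : Ensemble
  a : Polynomial ℕ
  b : Polynomial ℕ
  g : Polynomial ℕ
  rho : Polynomial ℕ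
  bound : Polynomial ℕ
  zeta : ℕ → ℤ
  out : Inst τ d D s → Val

namespace Reduction

variable {τ : Task} {d : ℕ} {D : ℕ → ℕ} {s : Polynomial ℕ} (R : Reduction τ d D s)

/-- The order of the medians. -/
def order (N : ℕ) : ℕ := R.E.medianOrder (R.bound.eval N)

/-- A bound on the shifts. -/
def shift (N : ℕ) : ℕ := 2 * N * 2 ^ (R.b.eval N + s.eval N - R.a.eval N)

/-- The range of the sampler. -/
def radius (N : ℕ) : ℕ := R.E.radius (R.bound.eval N) (R.shift N) (R.zeta (R.b.eval N))

/-- Scale of the shifts. -/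
def scale (N : ℕ) : ℕ := 2 ^ (R.b.eval N - (s.eval N + R.a.eval N))

/-- The `j`-th point on the random line of the repetition `l`. -/
def input (i : Inst τ d D s) (r l j : ℕ) : Idx i.n (D (i.n ^ 2)) d → ℤ × ℤ := fun x =>
  (sampleInt (R.order (i.n ^ 2)) (R.radius (i.n ^ 2)) r ((l * i.len + position _ _ _ x) * 2) +
      j * R.scale (i.n ^ 2) * (i.data x).1,
    sampleInt (R.order (i.n ^ 2)) (R.radius (i.n ^ 2)) r ((l * i.len + position _ _ _ x) * 2 + 1) +
      j * R.scale (i.n ^ 2) * (i.data x).2)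

/-- The average-case instance at this point. -/
def query (i : Inst τ d D s) (r l j : ℕ) : Inst τ d D s := ⟨i.n, i.pos, R.input i r l j, i.obs⟩

/-- The answer, rounded to an integer. -/
def intAnswer (i : Inst τ d D s) : ℤ :=
  (R.out i).fst.toInt * 2 ^ R.g.eval (i.n ^ 2) / (R.out i).snd.toInt

/-- The finite difference of the answers. -/
def difference (i : Inst τ d D s) (r l : ℕ) : ℤ :=
  ∑ j ∈ Finset.range (2 * i.n ^ 2 + 1),
    ((-1) ^ (2 * i.n ^ 2 - j) * ((2 * i.n ^ 2).choose j : ℤ)) * R.intAnswer (R.query i r l j)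

/-- The output of the reduction. -/
def result (i : Inst τ d D s) (r : ℕ) : Val :=
  .pair (int (median (R.rho.eval (i.n ^ 2)) (R.difference i r) *
      2 ^ (2 * i.n ^ 2 * R.a.eval (i.n ^ 2))))
    (int (2 ^ R.g.eval (i.n ^ 2) * (2 * i.n ^ 2).factorial))

end Reduction

/-! ### Polynomial running time -/

section PT

variable {ι : Type} {u : ι → Val}

theorem PT.congr {v w : ι → Val} (h : PT u v) (e : ∀ i, v i = w i) : PT u w := by
  rwa [← funext e]

theorem PT.int_toNat {z : ι → ℤ} (h : PT u fun i => int (z i)) :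
    PT u fun i => int ((z i).toNat : ℕ) :=
  (PT.ite h h (PT.const 0)).congr fun i => by
    split_ifs with hz
    · rw [Int.toNat_of_nonneg hz.le]
    · rw [Int.toNat_of_nonpos (not_lt.1 hz)]; rfl

theorem PT.natAdd {x y : ι → ℕ} (hx : PT u fun i => int (x i : ℕ))
    (hy : PT u fun i => int (y i : ℕ)) : PT u fun i => int ((x i + y i : ℕ) : ℤ) := by
  simpa using hx.add hy

theorem PT.natMul {x y : ι → ℕ} (hx : PT u fun i => int (x i : ℕ))
    (hy : PT u fun i => int (y i : ℕ)) : PT u fun i => int ((x i * y i : ℕ) : ℤ) := by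
  simpa using hx.mul hy

theorem PT.natSub {x y : ι → ℕ} (hx : PT u fun i => int (x i : ℕ))
    (hy : PT u fun i => int (y i : ℕ)) : PT u fun i => int ((x i - y i : ℕ) : ℤ) :=
  (hx.sub hy).int_toNat.congr fun i => by rw [Int.toNat_sub]

theorem PT.natPow {x y : ι → ℕ} (hx : PT u fun i => int (x i : ℕ))
    (hy : PT u fun i => int (y i : ℕ)) (hy' : Small u y) :
    PT u fun i => int ((x i ^ y i : ℕ) : ℤ) := by
  simpa using hx.pow hy hy'

theorem PT.natConst (c : ℕ) : PT u fun _ => int (c : ℤ) := PT.const _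

theorem PT.choose {x y : ι → ℕ} (hx : PT u fun i => int (x i : ℕ)) (hx' : Small u x)
    (hy : PT u fun i => int (y i : ℕ)) (hyx : ∀ i, y i ≤ x i) :
    PT u fun i => int ((x i).choose (y i) : ℕ) := by
  have hy' : Small u y := hx'.mono hyx
  have h := (PT.factorial hx hx').div ((PT.factorial hy hy').mul
    (PT.factorial (hx.natSub hy) (hx'.mono fun i => Nat.sub_le _ _)))
  refine h.congr fun i => ?_
  rw [Nat.choose_eq_factorial_div_factorial (hyx i)]
  push_cast
  rfl

theorem Small.ctx_idx {K : ι → ℕ} (hK : Small u K) : Small (ctx u K) fun p => (p.2 : ℕ) :=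
  hK.ctx_lift.mono fun p => p.2.2.le

theorem PT.sampleInt {m A r x : ι → ℕ} (hm : PT u fun i => int (m i : ℕ)) (hm' : Small u m)
    (hA : PT u fun i => int (A i : ℕ)) (hr : PT u fun i => int (r i : ℕ))
    (hx : PT u fun i => int (x i : ℕ)) (hx' : Small u x) :
    PT u fun i => int (sampleInt (m i) (A i) (r i) (x i)) := by
  unfold PEPS.sampleInt
  refine PT.sub (PT.int_median hm hm' ?_) hA
  have hK : Small u fun i => 2 * m i + 1 := ((Small.const 2).mul hm').add (Small.const 1)
  have hL : PT u fun i => int ((2 * A i : ℕ) : ℤ) := (PT.natConst 2).natMul hA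
  have hk : PT (ctx u fun i => 2 * m i + 1)
      fun p => int ((x p.1 * (2 * m p.1 + 1) + p.2 : ℕ) : ℤ) :=
    (hx.natMul (((PT.natConst 2).natMul hm).natAdd (PT.natConst 1))).ctx_lift.natAdd PT.ctx_idx
  have hk' : Small (ctx u fun i => 2 * m i + 1) fun p => x p.1 * (2 * m p.1 + 1) + p.2 :=
    (hx'.mul hK).ctx_lift.add hK.ctx_idx
  have := (hr.ctx_lift.div (hL.ctx_lift.natPow hk hk')).mod hL.ctx_lift
  exact this.congr fun p => by push_cast; rfl

end PT

theorem length_le_size_ofList (l : List Val) : l.length ≤ (Val.ofList l).size := by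
  induction l with
  | nil => simp
  | cons a l ih => simp only [List.length_cons, Val.ofList, Val.size]; omega

namespace Inst

variable {τ : Task} {d : ℕ} {D : ℕ → ℕ} {s : Polynomial ℕ}

theorem len_le_size (b : Polynomial ℕ) (i : Inst τ d D s) : i.len ≤ (i.code b).size := by
  have := length_le_size_ofList
    ((idxList i.n (D (i.n ^ 2)) d).map fun x => encInt2 (i.data x))
  rw [List.length_map] at this
  simp only [code, encode, Val.size, len]
  omega

/-- The number `n` is encoded in binary, but the list of entries contains at least one entry per
site. This makes N, and polynomials in N, small relative to the input. -/
theorem sq_le_len (hd : 1 ≤ d) (hD : ∀ N, 1 ≤ D N) (i : Inst τ d D s) : i.n ^ 2 ≤ i.len := by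
  rw [len_eq]
  have := hD (i.n ^ 2)
  have : 1 ≤ D (i.n ^ 2) * (D (i.n ^ 2) * (D (i.n ^ 2) * (D (i.n ^ 2) * d))) :=
    Nat.one_le_iff_ne_zero.2 (by positivity)
  calc i.n ^ 2 = i.n * (i.n * 1) := by ring
    _ ≤ _ := by gcongr

end Inst

namespace Reduction

variable {τ : Task} {d : ℕ} {D : ℕ → ℕ} {s : Polynomial ℕ} (R : Reduction τ d D s)
  {ι : Type} {u : ι → Val} {i : ι → Inst τ d D s} {r l j : ι → ℕ}

/-- The number of sites can be computed from an instance, and it is small. -/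
theorem pt_sites (hi : PT u fun k => (i k).code s) :
    PT u fun k => int (((i k).n ^ 2 : ℕ) : ℤ) := by
  have h : PT u fun k => int ((i k).n : ℤ) := hi.fst_val
  exact (h.natMul h).congr fun k => by rw [sq]

theorem small_sites (hd : 1 ≤ d) (hD : ∀ N, 1 ≤ D N) (hi : PT u fun k => (i k).code s) :
    Small u fun k => (i k).n ^ 2 :=
  hi.small.mono fun k => ((i k).sq_le_len hd hD).trans ((i k).len_le_size s)

theorem pt_len (hi : PT u fun k => (i k).code s) : PT u fun k => int ((i k).len : ℕ) := by
  have hn : PT u fun k => int ((i k).n : ℤ) := hi.fst_val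
  have hD : PT u fun k => int (D ((i k).n ^ 2) : ℕ) := hi.snd_val.fst_val
  exact (hn.natMul (hn.natMul (hD.natMul (hD.natMul (hD.natMul (hD.natMul
    (PT.natConst d))))))).congr fun k => by rw [(i k).len_eq]

variable {N : ι → ℕ}

theorem pt_order (hN : PT u fun k => int (N k : ℕ)) : PT u fun k => int (R.order (N k) : ℕ) := by
  have hI := hN.polyEval R.bound
  unfold order
  cases R.E with
  | uniform => exact PT.natConst 0
  | gaussian =>
    have h := (PT.natConst 2).natMul hI
    exact ((PT.natConst 2).natMul (h.natMul h)).congr fun k => by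
      rw [← sq]; rfl

theorem small_order (hN' : Small u N) : Small u fun k => R.order (N k) := by
  unfold order
  cases R.E with
  | uniform => exact Small.const 0
  | gaussian => exact (Small.const 2).mul (((Small.const 2).mul (hN'.poly _)).pow 2)

theorem pt_shift (hN : PT u fun k => int (N k : ℕ)) (hN' : Small u N) :
    PT u fun k => int (R.shift (N k) : ℕ) :=
  ((PT.natConst 2).natMul hN).natMul ((PT.natConst 2).natPow
    (((hN.polyEval _).natAdd (hN.polyEval _)).natSub (hN.polyEval _))
    (((hN'.poly _).add (hN'.poly _)).mono fun _ => Nat.sub_le _ _))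

theorem pt_scale (hN : PT u fun k => int (N k : ℕ)) (hN' : Small u N) :
    PT u fun k => int (R.scale (N k) : ℕ) :=
  (PT.natConst 2).natPow ((hN.polyEval _).natSub ((hN.polyEval _).natAdd (hN.polyEval _)))
    ((hN'.poly _).mono fun _ => Nat.sub_le _ _)

/-- The program for σ expects 2^m as its input, whose bit size is linear in m; with m = b(N)
polynomial in N this argument can be written down. -/
theorem pt_radius (hζ : PT (fun m : ℕ => int (2 ^ m)) fun m => int (R.zeta m))
    (hN : PT u fun k => int (N k : ℕ)) (hN' : Small u N) :
    PT u fun k => int (R.radius (N k) : ℕ) := by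
  have hz : PT u fun k => int (R.zeta (R.b.eval (N k))) :=
    PT.trans (((PT.natConst 2).natPow (hN.polyEval R.b) (hN'.poly _)).congr fun k => by
      push_cast; rfl) (hζ.reindex fun k => R.b.eval (N k))
  have hT := R.pt_shift hN hN'
  have hI := hN.polyEval R.bound
  unfold radius
  cases R.E with
  | uniform => exact ((hz.sub hT).sub (PT.const 1)).int_toNat
  | gaussian =>
    exact (((PT.const 2).mul ((PT.const 2).mul hI)).mul hz).int_toNat

theorem pt_query (hd : 1 ≤ d) (hD : ∀ N, 1 ≤ D N)
    (hζ : PT (fun m : ℕ => int (2 ^ m)) fun m => int (R.zeta m))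
    (hi : PT u fun k => (i k).code s) (hr : PT u fun k => int (r k : ℕ))
    (hl : PT u fun k => int (l k : ℕ)) (hl' : Small u l) (hj : PT u fun k => int (j k : ℕ)) :
    PT u fun k => (R.query (i k) (r k) (l k) (j k)).code R.b := by
  have hN := pt_sites hi
  have hN' := small_sites hd hD hi
  have hK := pt_len hi
  have hK' : Small u fun k => (i k).len := hi.small.mono fun k => (i k).len_le_size s
  have hlist : PT u fun k => Val.ofList ((idxList (i k).n (D ((i k).n ^ 2)) d).map
      fun x => encInt2 ((i k).data x)) := hi.snd_val.snd_val.snd_val.snd_val.fst_val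
  have hentry : PT (ctx u fun k => (i k).len) fun p =>
      encInt2 ((i p.1).data ((idxList (i p.1).n (D ((i p.1).n ^ 2)) d)[p.2])) :=
    (PT.nth (hlist.ctx_lift (K := fun k => (i k).len)) PT.ctx_idx
      (fun p => by rw [List.length_map]; exact p.2.2)).congr fun p => by
        rw [List.getElem_map]; rfl
  have hx : PT (ctx u fun k => (i k).len) fun p =>
      int (((l p.1 * (i p.1).len + p.2) * 2 : ℕ) : ℤ) :=
    ((hl.natMul hK).ctx_lift.natAdd PT.ctx_idx).natMul (PT.natConst 2)
  have hx' : Small (ctx u fun k => (i k).len) fun p => (l p.1 * (i p.1).len + p.2) * 2 :=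
    ((hl'.mul hK').ctx_lift.add hK'.ctx_idx).mul (Small.const 2)
  have hm := (R.pt_order hN).ctx_lift (K := fun k => (i k).len)
  have hm' := (R.small_order hN').ctx_lift (K := fun k => (i k).len)
  have hA := (R.pt_radius hζ hN hN').ctx_lift (K := fun k => (i k).len)
  have hw := (hj.mul (R.pt_scale hN hN')).ctx_lift (K := fun k => (i k).len)
  have h0 := (PT.sampleInt hm hm' hA hr.ctx_lift hx hx').add (hw.mul hentry.fst)
  have h1 := (PT.sampleInt hm hm' hA hr.ctx_lift (hx.natAdd (PT.natConst 1))
    (hx'.add (Small.const 1))).add (hw.mul hentry.snd)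
  -- `PT.listMap` asks for a function on all of ℕ; the default 0 is never reached.
  have hout := PT.listMap (f := fun k p => if h : p < (i k).len then
    encInt2 (R.input (i k) (r k) (l k) (j k) ((idxList (i k).n (D ((i k).n ^ 2)) d)[p]'h))
    else int 0) hK hK' ((h0.pair h1).congr fun p => by
      rw [dif_pos p.2.2, encInt2, input, position_getElem p.2.2]
      rfl)
  have hdata : PT u fun k => Val.ofList ((idxList (i k).n (D ((i k).n ^ 2)) d).map
      fun x => encInt2 (R.input (i k) (r k) (l k) (j k) x)) := by
    refine hout.congr fun k => congrArg _ (List.ext_getElem (by simp [Inst.len]) fun p h h' => ?_)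
    have hp : p < (i k).len := by simpa using h
    simp [hp]
  have hn : PT u fun k => int ((i k).n : ℤ) := hi.fst_val
  have hDD : PT u fun k => int (D ((i k).n ^ 2) : ℕ) := hi.snd_val.fst_val
  have hobs : PT u fun k => τ.encodeObs (i k).obs := hi.snd_val.snd_val.snd_val.snd_val.snd_val
  exact hn.pair (hDD.pair ((PT.natConst d).pair ((hN.polyEval R.b).pair (hdata.pair hobs))))

theorem pt_intAnswer (hd : 1 ≤ d) (hD : ∀ N, 1 ≤ D N)
    (hO : PT (fun i : Inst τ d D s => i.code R.b) R.out)
    (hi : PT u fun k => (i k).code R.b) : PT u fun k => int (R.intAnswer (i k)) := by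
  have h := hi.trans (hO.reindex i)
  have hn : PT u fun k => int ((i k).n : ℤ) := hi.fst_val
  have hN : PT u fun k => int (((i k).n ^ 2 : ℕ) : ℤ) :=
    (hn.natMul hn).congr fun k => by rw [sq]
  have hN' : Small u fun k => (i k).n ^ 2 :=
    hi.small.mono fun k => ((i k).sq_le_len hd hD).trans ((i k).len_le_size _)
  exact ((h.fst_val.toInt).mul ((PT.const 2).pow (hN.polyEval R.g) (hN'.poly _))).div
    h.snd_val.toInt

theorem pt_difference (hd : 1 ≤ d) (hD : ∀ N, 1 ≤ D N)
    (hζ : PT (fun m : ℕ => int (2 ^ m)) fun m => int (R.zeta m))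
    (hO : PT (fun i : Inst τ d D s => i.code R.b) R.out)
    (hi : PT u fun k => (i k).code s) (hr : PT u fun k => int (r k : ℕ))
    (hl : PT u fun k => int (l k : ℕ)) (hl' : Small u l) :
    PT u fun k => int (R.difference (i k) (r k) (l k)) := by
  have hM : PT u fun k => int ((2 * (i k).n ^ 2 : ℕ) : ℤ) := (PT.natConst 2).natMul (pt_sites hi)
  have hM' : Small u fun k => 2 * (i k).n ^ 2 := (Small.const 2).mul (small_sites hd hD hi)
  refine PT.sum (K := fun k => 2 * (i k).n ^ 2 + 1) (hM.natAdd (PT.natConst 1))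
    (hM'.add (Small.const 1)) (PT.mul (PT.mul (PT.pow (PT.const (-1)) (hM.ctx_lift.natSub
    PT.ctx_idx) (hM'.ctx_lift.mono fun _ => Nat.sub_le _ _)) (PT.choose hM.ctx_lift hM'.ctx_lift
    PT.ctx_idx fun p => Nat.lt_succ_iff.1 p.2.2)) (R.pt_intAnswer hd hD hO ?_))
  exact R.pt_query hd hD hζ hi.ctx_lift hr.ctx_lift hl.ctx_lift hl'.ctx_lift PT.ctx_idx

/-- The reduction runs in polynomial time. -/
theorem pt_result (hd : 1 ≤ d) (hD : ∀ N, 1 ≤ D N)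
    (hζ : PT (fun m : ℕ => int (2 ^ m)) fun m => int (R.zeta m))
    (hO : PT (fun i : Inst τ d D s => i.code R.b) R.out) :
    PT (fun k : Inst τ d D s × ℕ => .pair (k.1.code s) (int k.2)) fun k => R.result k.1 k.2 := by
  set u : Inst τ d D s × ℕ → Val := fun k => .pair (k.1.code s) (int k.2) with hu
  have hi : PT u fun k => k.1.code s := PT.refl.fst
  have hr : PT u fun k => int (k.2 : ℤ) := PT.refl.snd
  have hN := pt_sites hi
  have hN' := small_sites hd hD hi
  have hM : PT u fun k => int ((2 * k.1.n ^ 2 : ℕ) : ℤ) := (PT.natConst 2).natMul hN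
  have hM' : Small u fun k => 2 * k.1.n ^ 2 := (Small.const 2).mul hN'
  have hρ' : Small u fun k => R.rho.eval (k.1.n ^ 2) := hN'.poly _
  have hmed := PT.int_median (f := fun k l => R.difference k.1 k.2 l) (hN.polyEval R.rho) hρ'
    (R.pt_difference hd hD hζ hO hi.ctx_lift hr.ctx_lift PT.ctx_idx
      ((((Small.const 2).mul hρ').add (Small.const 1)).ctx_idx))
  exact (hmed.mul ((PT.const 2).pow (hM.natMul (hN.polyEval R.a)) (hM'.mul (hN'.poly _)))).pair
    (((PT.const 2).pow (hN.polyEval R.g) (hN'.poly _)).mul (PT.factorial hM hM'))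

end Reduction

/-! ### Accuracy of the reduction -/

/-- For `y = 0` both quotients are 0, so a malformed answer with denominator 0 needs no separate
treatment. -/
theorem abs_ediv_sub_div_le (x y : ℤ) : |((x / y : ℤ) : ℝ) - (x : ℝ) / y| ≤ 1 := by
  rcases eq_or_ne y 0 with rfl | hy
  · simp
  · have hy' : (y : ℝ) ≠ 0 := by exact_mod_cast hy
    have h1 : (x : ℝ) = y * (x / y : ℤ) + (x % y : ℤ) := by
      exact_mod_cast (Int.mul_ediv_add_emod x y).symm
    have h2 : (0 : ℝ) ≤ (x % y : ℤ) := by exact_mod_cast Int.emod_nonneg x hy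
    have h3 : ((x % y : ℤ) : ℝ) ≤ |(y : ℝ)| := by
      exact_mod_cast (Int.emod_lt_abs x hy).le
    have h4 : ((x / y : ℤ) : ℝ) - (x : ℝ) / y = -((x % y : ℤ) / y) := by
      rw [h1]
      have : (y * ((x / y : ℤ) : ℝ) + ((x % y : ℤ) : ℝ)) / y = (x / y : ℤ) + (x % y : ℤ) / y := by
        field_simp
      rw [← h1] at this ⊢
      rw [this]
      ring
    rw [h4, abs_neg, abs_div, abs_of_nonneg h2]
    exact div_le_one_of_le₀ h3 (abs_nonneg _)

theorem abs_intAnswer_sub_le (y : Val) (g : ℕ) :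
    |((y.fst.toInt * 2 ^ g / y.snd.toInt : ℤ) : ℝ) / 2 ^ g - ((y.toRat : ℚ) : ℝ)| ≤
      (1 / 2 : ℝ) ^ g := by
  have h := abs_ediv_sub_div_le (y.fst.toInt * 2 ^ g) y.snd.toInt
  have h2 : (0 : ℝ) < 2 ^ g := by positivity
  have h3 : ((y.fst.toInt * 2 ^ g / y.snd.toInt : ℤ) : ℝ) / 2 ^ g - ((y.toRat : ℚ) : ℝ) =
      (((y.fst.toInt * 2 ^ g / y.snd.toInt : ℤ) : ℝ) -
        ((y.fst.toInt * 2 ^ g : ℤ) : ℝ) / y.snd.toInt) / 2 ^ g := by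
    rw [Val.toRat]
    push_cast
    field_simp
  rw [h3, abs_div, abs_of_pos h2, one_div_pow]
  gcongr

/-- The accuracy condition refers to a complex target while the median is taken over integers. Along
the real axis the distance to any complex point first decreases and then increases, so its sublevel
sets are intervals, as `median_mem` requires. -/
theorem ordConnected_norm_sub_le (c : ℂ) (g : ℕ) (ε : ℝ) :
    Set.OrdConnected {z : ℤ | ‖(z : ℂ) / 2 ^ g - c‖ ≤ ε} := by
  have key : ∀ z : ℤ, ‖(z : ℂ) / 2 ^ g - c‖ = ‖(z : ℂ) - 2 ^ g * c‖ / 2 ^ g := fun z => by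
    have h2 : (2 : ℂ) ^ g ≠ 0 := pow_ne_zero _ two_ne_zero
    rw [show (z : ℂ) / 2 ^ g - c = ((z : ℂ) - 2 ^ g * c) / 2 ^ g by field_simp, norm_div]
    simp
  refine ⟨fun x hx y hy z hz => ?_⟩
  rw [Set.mem_ofPred_eq, key] at *
  have hxy : ‖(z : ℂ) - 2 ^ g * c‖ ≤ max ‖(x : ℂ) - 2 ^ g * c‖ ‖(y : ℂ) - 2 ^ g * c‖ := by
    generalize (2 : ℂ) ^ g * c = w
    have hz1 : (x : ℝ) ≤ z := by exact_mod_cast hz.1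
    have hz2 : (z : ℝ) ≤ y := by exact_mod_cast hz.2
    rw [le_max_iff, ← sq_le_sq₀ (norm_nonneg _) (norm_nonneg _),
      ← sq_le_sq₀ (norm_nonneg _) (norm_nonneg _), ← Complex.normSq_eq_norm_sq,
      ← Complex.normSq_eq_norm_sq, ← Complex.normSq_eq_norm_sq]
    simp only [Complex.normSq_apply, Complex.sub_re, Complex.sub_im, Complex.intCast_re,
      Complex.intCast_im]
    rcases le_total (z : ℝ) w.re with h | h
    · left; nlinarith
    · right; nlinarith
  calc _ ≤ max ‖(x : ℂ) - 2 ^ g * c‖ ‖(y : ℂ) - 2 ^ g * c‖ / 2 ^ g := by gcongr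
    _ ≤ ε := by
      rw [← max_div_div_right (by positivity)]
      exact max_le hx hy

namespace Reduction

variable {τ : Task} {d : ℕ} {D : ℕ → ℕ} {s : Polynomial ℕ} (R : Reduction τ d D s)

/-- The answer on an average-case instance is accurate. -/
def Good (p : Polynomial ℕ) (i : Inst τ d D s) : Prop :=
  Accurate τ (R.b.eval (i.n ^ 2)) (p.eval (i.n ^ 2)) i.data i.obs (R.out i)

/-- The exact solution of an instance of the worst-case problem. -/
noncomputable def _root_.PEPS.Inst.solution (i : Inst τ d D s) : ℂ :=
  τ.value (fun x => toComplex (s.eval (i.n ^ 2)) (i.data x)) i.obs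

theorem toComplex_add (b : ℕ) (z w : ℤ × ℤ) :
    toComplex b (z + w) = toComplex b z + toComplex b w := by
  simp only [toComplex, Prod.fst_add, Prod.snd_add]
  push_cast
  ring

/-- Because b ≥ s + a, the shifts by j 2^(-a) X lie exactly on the grid of mesh 2^(-b): moving along
the line causes no rounding error. -/
theorem toComplex_scale {a b s : ℕ} (hb : s + a ≤ b) (j : ℕ) (z : ℤ × ℤ) :
    toComplex b (j * (2 ^ (b - (s + a)) : ℕ) * z.1, j * (2 ^ (b - (s + a)) : ℕ) * z.2) =
      ((j * (1 / 2 : ℝ) ^ a : ℝ) : ℂ) * toComplex s z := by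
  have h : (2 : ℂ) ^ b = 2 ^ (b - (s + a)) * 2 ^ s * 2 ^ a := by
    rw [← pow_add, ← pow_add]; congr 1; omega
  have h2 : (2 : ℂ) ≠ 0 := two_ne_zero
  simp only [toComplex]
  rw [h]
  push_cast
  rw [one_div_pow]
  field_simp

/-- Each answer carries two errors of at most 2^(-g), one from the solver and one from rounding to
an integer multiple of 2^(-g); the finite difference amplifies their sum by 2^M with M = 2N. -/
theorem norm_difference_sub_le {p : Polynomial ℕ} (i : Inst τ d D s) {r l : ℕ}
    (hb : s.eval (i.n ^ 2) + R.a.eval (i.n ^ 2) ≤ R.b.eval (i.n ^ 2))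
    (hp : R.g.eval (i.n ^ 2) ≤ p.eval (i.n ^ 2))
    (hgood : ∀ j ≤ 2 * i.n ^ 2, R.Good p (R.query i r l j)) :
    ‖(R.difference i r l : ℂ) / 2 ^ R.g.eval (i.n ^ 2) - (2 * i.n ^ 2).factorial *
      (((1 / 2 : ℝ) ^ R.a.eval (i.n ^ 2) : ℝ) : ℂ) ^ (2 * i.n ^ 2) * i.solution‖ ≤
      2 ^ (2 * i.n ^ 2) * (2 * (1 / 2 : ℝ) ^ R.g.eval (i.n ^ 2)) := by
  set N := i.n ^ 2 with hN
  set g := R.g.eval N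
  have hpoly := value_polyTop τ (fun x => toComplex (R.b.eval N) (R.input i r l 0 x))
    (fun x => toComplex (s.eval N) (i.data x)) i.obs
  have key := hpoly.abs_sum_choose_sub_le (δ := (1 / 2 : ℝ) ^ R.a.eval N)
    (ε := 2 * (1 / 2 : ℝ) ^ g) (y := fun j => (R.intAnswer (R.query i r l j) : ℝ) / 2 ^ g) ?_
  · rw [Inst.solution]
    refine le_trans (le_of_eq ?_) key
    congr 2
    rw [Reduction.difference]
    push_cast
    rw [Finset.sum_div]
    exact Finset.sum_congr rfl fun j _ => by rw [mul_div_assoc]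
  · intro j hj
    have hval : (fun x => toComplex (R.b.eval N) (R.input i r l 0 x) +
        ((j * (1 / 2 : ℝ) ^ R.a.eval N : ℝ) : ℂ) * toComplex (s.eval N) (i.data x)) =
        fun x => toComplex (R.b.eval N) (R.input i r l j x) := by
      funext x
      rw [← toComplex_scale hb, ← toComplex_add]
      congr 1
      simp [Reduction.input, Reduction.scale, hN]
    rw [hval]
    have h1 : ‖(((R.out (R.query i r l j)).toRat : ℚ) : ℂ) - τ.value
        (fun x => toComplex (R.b.eval N) (R.input i r l j x)) i.obs‖ ≤ (1 / 2 : ℝ) ^ p.eval N :=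
      hgood j hj
    have h2 := abs_intAnswer_sub_le (R.out (R.query i r l j)) g
    have h3 : (1 / 2 : ℝ) ^ p.eval N ≤ (1 / 2 : ℝ) ^ g :=
      pow_le_pow_of_le_one (by norm_num) (by norm_num) hp
    have h4 : ‖(((R.intAnswer (R.query i r l j) : ℝ) / 2 ^ g : ℝ) : ℂ) -
        (((R.out (R.query i r l j)).toRat : ℚ) : ℂ)‖ ≤ (1 / 2 : ℝ) ^ g := by
      rw [← Complex.ofReal_ratCast, ← Complex.ofReal_sub, Complex.norm_real, Real.norm_eq_abs]
      exact h2
    calc _ ≤ _ := norm_sub_le_norm_sub_add_norm_sub _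
            (((R.out (R.query i r l j)).toRat : ℚ) : ℂ) _
      _ ≤ (1 / 2 : ℝ) ^ g + (1 / 2 : ℝ) ^ g := add_le_add h4 (h1.trans h3)
      _ = _ := by ring

/-- If the average-case answers are accurate in the majority of the repetitions, then the output
of the reduction is accurate. -/
theorem accurate_result {p q : Polynomial ℕ} (i : Inst τ d D s) {r : ℕ}
    (hb : s.eval (i.n ^ 2) + R.a.eval (i.n ^ 2) ≤ R.b.eval (i.n ^ 2))
    (hp : R.g.eval (i.n ^ 2) ≤ p.eval (i.n ^ 2))
    (hg : 2 * i.n ^ 2 + 2 * i.n ^ 2 * R.a.eval (i.n ^ 2) + q.eval (i.n ^ 2) + 1 ≤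
      R.g.eval (i.n ^ 2))
    {B : Finset ℕ} (hB : B.card ≤ R.rho.eval (i.n ^ 2))
    (hgood : ∀ l < 2 * R.rho.eval (i.n ^ 2) + 1, l ∉ B → ∀ j ≤ 2 * i.n ^ 2,
      R.Good p (R.query i r l j)) :
    Accurate τ (s.eval (i.n ^ 2)) (q.eval (i.n ^ 2)) i.data i.obs (R.result i r) := by
  have hmed := median_mem (m := R.rho.eval (i.n ^ 2)) (f := R.difference i r)
    (ordConnected_norm_sub_le ((Nat.factorial (2 * i.n ^ 2) : ℂ) *
      (((1 / 2 : ℝ) ^ R.a.eval (i.n ^ 2) : ℝ) : ℂ) ^ (2 * i.n ^ 2) * i.solution)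
      (R.g.eval (i.n ^ 2)) (2 ^ (2 * i.n ^ 2) * (2 * (1 / 2 : ℝ) ^ R.g.eval (i.n ^ 2))))
    (B := B) (fun l hl hlB => R.norm_difference_sub_le i hb hp (hgood l hl hlB)) hB
  rw [Set.mem_ofPred_eq] at hmed
  rw [Accurate, Reduction.result]
  change ‖_ - i.solution‖ ≤ _
  set N := i.n ^ 2
  set M := 2 * N
  set g := R.g.eval N
  set a := R.a.eval N
  set y := median (R.rho.eval N) (R.difference i r)
  have h2 : (2 : ℂ) ≠ 0 := two_ne_zero
  have hf : ((M.factorial : ℕ) : ℂ) ≠ 0 := by exact_mod_cast M.factorial_ne_zero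
  -- Dividing by M! δ^M recovers the solution; since M! ≥ 1, the error grows by at most 2^(Ma),
  -- which the lower bound on `g` absorbs.
  have hcast : (((Val.pair (int (y * 2 ^ (M * a))) (int (2 ^ g * M.factorial))).toRat : ℚ) : ℂ) -
      i.solution = ((y : ℂ) / 2 ^ g - M.factorial * (((1 / 2 : ℝ) ^ a : ℝ) : ℂ) ^ M *
        i.solution) * (2 ^ (M * a) / M.factorial) := by
    have : (((1 / 2 : ℝ) ^ a : ℝ) : ℂ) ^ M = (2 ^ (M * a))⁻¹ := by
      push_cast
      rw [one_div_pow, one_div, inv_pow, ← pow_mul, mul_comm a]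
    rw [this, Val.toRat]
    simp only [Val.fst, Val.snd, Val.toInt]
    push_cast
    field_simp
  rw [hcast, norm_mul]
  have hfac : ‖(2 : ℂ) ^ (M * a) / M.factorial‖ ≤ 2 ^ (M * a) := by
    rw [norm_div, norm_pow, Complex.norm_natCast, Complex.norm_ofNat]
    exact div_le_self (by positivity) (by exact_mod_cast M.factorial_pos)
  calc _ ≤ (2 ^ M * (2 * (1 / 2 : ℝ) ^ g)) * 2 ^ (M * a) :=
        mul_le_mul hmed hfac (norm_nonneg _) (by positivity)
    _ = 2 ^ (M + M * a + 1) * (1 / 2 : ℝ) ^ g := by rw [pow_add, pow_add, pow_one]; ring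
    _ ≤ 2 ^ (M + M * a + 1) * (1 / 2 : ℝ) ^ (M + M * a + 1 + q.eval N) := by
        refine mul_le_mul_of_nonneg_left (pow_le_pow_of_le_one (by norm_num) (by norm_num) ?_)
          (by positivity)
        omega
    _ = (1 / 2 : ℝ) ^ q.eval N := by
        rw [pow_add (1 / 2 : ℝ), ← mul_assoc, ← mul_pow]; norm_num

end Reduction

/-! ### Success probability of the reduction -/

namespace Reduction

variable {τ : Task} {d : ℕ} {D : ℕ → ℕ} {s : Polynomial ℕ} (R : Reduction τ d D s)

/-- The instance obtained from digits `g` at the `j`-th point of the line. -/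
def digitQuery (i : Inst τ d D s) {m L : ℕ} (A : ℕ)
    (g : Idx i.n (D (i.n ^ 2)) d × Fin 2 → Fin (2 * m + 1) → Fin L) (j : ℕ) : Inst τ d D s :=
  ⟨i.n, i.pos, fun x => sampleData A g x +
    (j * R.scale (i.n ^ 2) * (i.data x).1, j * R.scale (i.n ^ 2) * (i.data x).2), i.obs⟩

theorem exp_quarter_le : Real.exp (1 / 4) ≤ 4 / 3 := by
  have h1 : Real.exp (1 / 4) ^ 4 ≤ (4 / 3) ^ 4 := by
    rw [← Real.exp_nat_mul]
    have := Real.exp_one_lt_d9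
    norm_num
    linarith
  exact le_of_pow_le_pow_left₀ (by norm_num) (by norm_num) h1

/-- Passing to the complement needs measurability, which holds because the event depends on the data
only through their rounding, with values in a countable type. -/
theorem measureReal_not_good_le {p : Polynomial ℕ} {σ β : ℝ} (hσ : 0 < σ) (i : Inst τ d D s)
    (h : 1 - β ≤ (R.E.dataLaw σ i.n (D (i.n ^ 2)) d).real
      {W | R.Good p ⟨i.n, i.pos, fun x => round (R.b.eval (i.n ^ 2)) (W x), i.obs⟩}) :
    (R.E.dataLaw σ i.n (D (i.n ^ 2)) d).real
      {W | ¬ R.Good p ⟨i.n, i.pos, fun x => round (R.b.eval (i.n ^ 2)) (W x), i.obs⟩} ≤ β := by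
  have := R.E.isProbabilityMeasure_law hσ
  have hP : IsProbabilityMeasure (R.E.dataLaw σ i.n (D (i.n ^ 2)) d) := by
    unfold Ensemble.dataLaw; infer_instance
  have hm : Measurable fun W : Idx i.n (D (i.n ^ 2)) d → ℝ × ℝ =>
      fun x => round (R.b.eval (i.n ^ 2)) (W x) :=
    measurable_pi_lambda _ fun x => (measurable_round _).comp (measurable_pi_apply x)
  have hset : MeasurableSet {W : Idx i.n (D (i.n ^ 2)) d → ℝ × ℝ |
      R.Good p ⟨i.n, i.pos, fun x => round (R.b.eval (i.n ^ 2)) (W x), i.obs⟩} :=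
    hm (Set.to_countable {Y | R.Good p ⟨i.n, i.pos, Y, i.obs⟩}).measurableSet
  have hc := probReal_compl_eq_one_sub (μ := R.E.dataLaw σ i.n (D (i.n ^ 2)) d) hset
  have : {W : Idx i.n (D (i.n ^ 2)) d → ℝ × ℝ |
      ¬ R.Good p ⟨i.n, i.pos, fun x => round (R.b.eval (i.n ^ 2)) (W x), i.obs⟩} =
      {W | R.Good p ⟨i.n, i.pos, fun x => round (R.b.eval (i.n ^ 2)) (W x), i.obs⟩}ᶜ := rfl
  rw [this, hc]
  linarith

open Classical in
/-- One repetition fails with probability at most `1 / 3`. -/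
theorem card_bad_le {p : Polynomial ℕ} {σ : ℝ} (hσ : 0 < σ) (i : Inst τ d D s)
    (hX : ∀ x, Bounded (s.eval (i.n ^ 2)) (i.data x))
    (hb : s.eval (i.n ^ 2) + R.a.eval (i.n ^ 2) ≤ R.b.eval (i.n ^ 2))
    (hbound : i.len ≤ R.bound.eval (i.n ^ 2)) (hbound1 : 1 ≤ R.bound.eval (i.n ^ 2))
    (hζ : |(R.zeta (R.b.eval (i.n ^ 2)) : ℝ) - σ * 2 ^ R.b.eval (i.n ^ 2)| ≤ 1)
    (hS : 3200 * ((R.bound.eval (i.n ^ 2) : ℕ) : ℝ) ^ 3 * R.shift (i.n ^ 2) ≤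
      σ * 2 ^ R.b.eval (i.n ^ 2))
    (hgood : 1 - 1 / (12 * ((i.n ^ 2 : ℕ) : ℝ)) ≤ (R.E.dataLaw σ i.n (D (i.n ^ 2)) d).real
      {W | R.Good p ⟨i.n, i.pos, fun x => round (R.b.eval (i.n ^ 2)) (W x), i.obs⟩}) :
    ((Finset.univ.filter fun g : Idx i.n (D (i.n ^ 2)) d × Fin 2 →
        Fin (2 * R.order (i.n ^ 2) + 1) → Fin (2 * R.radius (i.n ^ 2)) =>
      ∃ j < 2 * i.n ^ 2 + 1, ¬ R.Good p (R.digitQuery i (R.radius (i.n ^ 2)) g j)).card : ℝ) ≤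
      Fintype.card (Idx i.n (D (i.n ^ 2)) d × Fin 2 →
        Fin (2 * R.order (i.n ^ 2) + 1) → Fin (2 * R.radius (i.n ^ 2))) / 3 := by
  have hN1 : 1 ≤ i.n ^ 2 := Nat.one_le_pow _ _ i.pos
  have hT1 : 1 ≤ R.shift (i.n ^ 2) := Nat.one_le_iff_ne_zero.2 (by
    unfold shift; positivity)
  obtain ⟨hA, hdom⟩ := R.E.domination hσ hbound1 hT1 hS hζ
  change 0 < R.radius (i.n ^ 2) at hA
  have hbad := R.measureReal_not_good_le (p := p) hσ i hgood
  -- In units of 2^(-b), a shift is at most 2N · 2^(b - s - a) · 2^(2s).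
  have hshift : ∀ j < 2 * i.n ^ 2 + 1, ∀ z : ℤ, |z| ≤ 2 ^ (2 * s.eval (i.n ^ 2)) →
      |((j * R.scale (i.n ^ 2) * z : ℤ) : ℝ)| ≤ R.shift (i.n ^ 2) := by
    intro j hj z hz
    have h1 : (R.shift (i.n ^ 2) : ℤ) =
        (2 * (i.n ^ 2 : ℕ) : ℤ) * (R.scale (i.n ^ 2)) * 2 ^ (2 * s.eval (i.n ^ 2)) := by
      have h2 : (2 : ℤ) ^ (R.b.eval (i.n ^ 2) + s.eval (i.n ^ 2) - R.a.eval (i.n ^ 2)) =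
          2 ^ (R.b.eval (i.n ^ 2) - (s.eval (i.n ^ 2) + R.a.eval (i.n ^ 2))) *
            2 ^ (2 * s.eval (i.n ^ 2)) := by
        rw [← pow_add]; congr 1; omega
      rw [shift, scale]
      push_cast
      rw [h2]
      ring
    have h2 : |(j * R.scale (i.n ^ 2) * z : ℤ)| ≤ R.shift (i.n ^ 2) := by
      rw [h1, abs_mul, abs_of_nonneg (by positivity)]
      gcongr
      omega
    exact_mod_cast h2
  generalize hm : R.order (i.n ^ 2) = m at *
  rw [order] at hm
  rw [hm] at hdom
  generalize hAA : R.radius (i.n ^ 2) = A at *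
  rw [radius] at hAA
  rw [hAA] at hdom
  set G := Idx i.n (D (i.n ^ 2)) d × Fin 2 → Fin (2 * m + 1) → Fin (2 * A) with hG
  have hcard : (Fintype.card G : ℝ) =
      ((2 * A : ℝ) ^ (2 * m + 1)) ^ (2 * Fintype.card (Idx i.n (D (i.n ^ 2)) d)) := by
    change (Fintype.card (Idx i.n (D (i.n ^ 2)) d × Fin 2 → Fin (2 * m + 1) → Fin (2 * A)) : ℝ) = _
    simp only [Fintype.card_fun, Fintype.card_prod, Fintype.card_fin]
    push_cast
    ring
  have hexp : Real.exp (1 / (8 * ((R.bound.eval (i.n ^ 2) : ℕ) : ℝ))) ^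
      (2 * Fintype.card (Idx i.n (D (i.n ^ 2)) d)) ≤ 4 / 3 := by
    refine le_trans ?_ exp_quarter_le
    rw [← Real.exp_nat_mul]
    apply Real.exp_le_exp.2
    have h1 : (1 : ℝ) ≤ ((R.bound.eval (i.n ^ 2) : ℕ) : ℝ) := by exact_mod_cast hbound1
    have h2 : (Fintype.card (Idx i.n (D (i.n ^ 2)) d) : ℝ) ≤ ((R.bound.eval (i.n ^ 2) : ℕ) : ℝ) := by
      rw [card_idx]; exact_mod_cast hbound
    rw [mul_one_div, div_le_div_iff₀ (by positivity) (by norm_num)]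
    push_cast
    linarith
  have hone : ∀ j < 2 * i.n ^ 2 + 1, ((Finset.univ.filter fun g : G =>
      ¬ R.Good p (R.digitQuery i A g j)).card : ℝ) ≤
      Fintype.card G * (4 / 3) * (1 / (12 * ((i.n ^ 2 : ℕ) : ℝ))) := by
    intro j hj
    refine (card_sampleData_le R.E hσ (η := 1 / (8 * ((R.bound.eval (i.n ^ 2) : ℕ) : ℝ)))
      (T := R.shift (i.n ^ 2)) hdom
      (fun x => (j * R.scale (i.n ^ 2) * (i.data x).1, j * R.scale (i.n ^ 2) * (i.data x).2))
      (fun x => ⟨hshift j hj _ (hX x).1, hshift j hj _ (hX x).2⟩)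
      (fun Y => ¬ R.Good p ⟨i.n, i.pos, Y, i.obs⟩) hbad _ fun g hg => hg).trans ?_
    rw [mul_pow, hcard]
    gcongr
  have hunion : (Finset.univ.filter fun g : G => ∃ j < 2 * i.n ^ 2 + 1,
      ¬ R.Good p (R.digitQuery i A g j)) ⊆ (Finset.range (2 * i.n ^ 2 + 1)).biUnion fun j =>
        Finset.univ.filter fun g : G => ¬ R.Good p (R.digitQuery i A g j) := by
    intro g hg
    simpa using hg
  have hNr : (1 : ℝ) ≤ ((i.n ^ 2 : ℕ) : ℝ) := by exact_mod_cast hN1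
  calc ((Finset.univ.filter fun g : G => ∃ j < 2 * i.n ^ 2 + 1,
        ¬ R.Good p (R.digitQuery i A g j)).card : ℝ)
      ≤ ∑ j ∈ Finset.range (2 * i.n ^ 2 + 1), ((Finset.univ.filter fun g : G =>
          ¬ R.Good p (R.digitQuery i A g j)).card : ℝ) := by
        exact_mod_cast (Finset.card_le_card hunion).trans Finset.card_biUnion_le
    _ ≤ ∑ _j ∈ Finset.range (2 * i.n ^ 2 + 1),
          Fintype.card G * (4 / 3) * (1 / (12 * ((i.n ^ 2 : ℕ) : ℝ))) :=
        Finset.sum_le_sum fun j hj => hone j (Finset.mem_range.1 hj)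
    _ ≤ _ := by
        rw [Finset.sum_const, Finset.card_range, nsmul_eq_mul]
        have h0 : (0 : ℝ) ≤ Fintype.card G := by positivity
        -- Union bound over the nodes: (2N + 1)/(12N) ≤ 1/4, and 4/3 · 1/4 = 1/3.
        have h1 : ((2 * i.n ^ 2 + 1 : ℕ) : ℝ) * (1 / (12 * ((i.n ^ 2 : ℕ) : ℝ))) ≤ 1 / 4 := by
          rw [mul_one_div, div_le_div_iff₀ (by positivity) (by norm_num)]
          push_cast at hNr ⊢
          linarith
        nlinarith [mul_le_mul_of_nonneg_left h1 h0]

/-- The numbering of all the digits: repetition, entry, real or imaginary part, position. -/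
def digitEquiv (i : Inst τ d D s) (k m : ℕ) :
    (Fin k × (Idx i.n (D (i.n ^ 2)) d × Fin 2) × Fin (2 * m + 1)) ≃
      Fin (k * i.len * 2 * (2 * m + 1)) :=
  (Equiv.prodAssoc _ _ _).symm.trans <|
    (((Equiv.prodAssoc _ _ _).symm.trans <|
      (((Equiv.prodCongr (Equiv.refl _) (position _ _ _)).trans finProdFinEquiv).prodCongr
        (Equiv.refl _)).trans finProdFinEquiv).prodCongr (Equiv.refl _)).trans finProdFinEquiv

theorem digitEquiv_val (i : Inst τ d D s) (k m : ℕ) (l : Fin k)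
    (x : Idx i.n (D (i.n ^ 2)) d) (c : Fin 2) (t : Fin (2 * m + 1)) :
    (digitEquiv i k m (l, (x, c), t) : ℕ) =
      ((l * i.len + position _ _ _ x) * 2 + c) * (2 * m + 1) + t := by
  have h : (digitEquiv i k m (l, (x, c), t) : ℕ) =
      t + (2 * m + 1) * (c + 2 * (position _ _ _ x + i.len * l)) := rfl
  rw [h]
  ring

theorem medianFin_digit {m A r x : ℕ} (hL : 0 < 2 * A) :
    medianFin (fun t : Fin (2 * m + 1) => digit hL r (x * (2 * m + 1) + t)) - A =
      sampleInt m A r x := by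
  rw [medianFin, sampleInt]
  congr 1
  refine median_congr fun j hj => ?_
  rw [dif_pos hj]
  rfl

/-- This identifies what the program computes from the random integer with the digit model in which
the probabilities are counted. -/
theorem query_eq_digitQuery (i : Inst τ d D s) (hL : 0 < 2 * R.radius (i.n ^ 2)) (r k j : ℕ)
    (l : Fin k) : R.query i r l j = R.digitQuery i (R.radius (i.n ^ 2)) (fun x t => digit hL r
      (digitEquiv i k (R.order (i.n ^ 2)) (l, x, t))) j := by
  rw [query, digitQuery]
  congr 1
  funext x
  simp only [input, sampleData, digitEquiv_val, medianFin_digit, Fin.val_zero, Fin.val_one,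
    add_zero, Prod.mk_add_mk]

open Classical in
/-- All but few of the random integers lead to an accurate result. -/
theorem card_not_majority_le {p : Polynomial ℕ} {c : ℕ} (i : Inst τ d D s)
    (hA : 0 < R.radius (i.n ^ 2))
    (hc : (2 * R.radius (i.n ^ 2)) ^ ((2 * R.rho.eval (i.n ^ 2) + 1) * i.len * 2 *
      (2 * R.order (i.n ^ 2) + 1)) ≤ 2 ^ c)
    (hbad : ((Finset.univ.filter fun g : Idx i.n (D (i.n ^ 2)) d × Fin 2 →
        Fin (2 * R.order (i.n ^ 2) + 1) → Fin (2 * R.radius (i.n ^ 2)) =>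
      ∃ j < 2 * i.n ^ 2 + 1, ¬ R.Good p (R.digitQuery i (R.radius (i.n ^ 2)) g j)).card : ℝ) ≤
      Fintype.card (Idx i.n (D (i.n ^ 2)) d × Fin 2 →
        Fin (2 * R.order (i.n ^ 2) + 1) → Fin (2 * R.radius (i.n ^ 2))) / 3) :
    ((Finset.univ.filter fun r : Fin (2 ^ c) => R.rho.eval (i.n ^ 2) <
      (Finset.univ.filter fun l : Fin (2 * R.rho.eval (i.n ^ 2) + 1) =>
        ∃ j < 2 * i.n ^ 2 + 1, ¬ R.Good p (R.query i r l j)).card).card : ℝ) ≤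
      4 / 3 * (8 / 9) ^ R.rho.eval (i.n ^ 2) * 2 ^ c := by
  have hL : 0 < 2 * R.radius (i.n ^ 2) := by omega
  simp only [R.query_eq_digitQuery i hL _ (2 * R.rho.eval (i.n ^ 2) + 1)]
  generalize R.rho.eval (i.n ^ 2) = ρ at *
  generalize R.order (i.n ^ 2) = m at *
  generalize R.radius (i.n ^ 2) = A at *
  set bad : ((Idx i.n (D (i.n ^ 2)) d × Fin 2) → Fin (2 * m + 1) → Fin (2 * A)) → Prop := fun g =>
    ∃ j < 2 * i.n ^ 2 + 1, ¬ R.Good p (R.digitQuery i A g j) with hbaddef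
  have h1 := card_majority_le bad ρ hbad
  have h2 := card_digit_le (c := c) hL hc (digitEquiv i (2 * ρ + 1) m) fun f =>
    ρ < (Finset.univ.filter fun l => bad fun x t => f (l, x, t)).card
  have h4 : (Fintype.card ((Idx i.n (D (i.n ^ 2)) d × Fin 2) → Fin (2 * m + 1) → Fin (2 * A)) : ℝ) ^ (2 * ρ + 1) =
      ((2 * A : ℕ) : ℝ) ^ ((2 * ρ + 1) * i.len * 2 * (2 * m + 1)) := by
    have : Fintype.card (Idx i.n (D (i.n ^ 2)) d × Fin 2) = i.len * 2 := by
      rw [Fintype.card_prod, card_idx, Fintype.card_fin]; rfl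
    simp only [Fintype.card_fun, Fintype.card_fin, this]
    push_cast
    rw [← pow_mul, ← pow_mul]
    congr 1
    ring
  rw [h4] at h1
  have h5 : (0 : ℝ) < ((2 * A : ℕ) : ℝ) ^ ((2 * ρ + 1) * i.len * 2 * (2 * m + 1)) := by positivity
  have h6 : 4 / 3 * (8 / 9 : ℝ) ^ ρ * 2 ^ c *
      ((2 * A : ℕ) : ℝ) ^ ((2 * ρ + 1) * i.len * 2 * (2 * m + 1)) = 2 * 2 ^ c * (2 / 3 * (8 / 9) ^ ρ *
      ((2 * A : ℕ) : ℝ) ^ ((2 * ρ + 1) * i.len * 2 * (2 * m + 1))) := by ring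
  refine le_of_mul_le_mul_right (h2.trans ?_) h5
  rw [h6]
  refine mul_le_mul_of_nonneg_left (le_trans (le_of_eq ?_) h1) (by positivity)
  -- Currying turns one array of digits, indexed also by the repetition, into a family of
  -- independent samples.
  refine congrArg Nat.cast (Finset.card_equiv ((Equiv.curry _ _ _).trans
    (Equiv.piCongrRight fun _ => Equiv.curry _ _ _)) fun f => ?_)
  simp only [Finset.mem_filter, Finset.mem_univ, true_and]
  rfl

end Reduction

theorem eight_ninths_pow_le (e : ℕ) : (4 / 3 : ℝ) * (8 / 9) ^ (6 * (e + 1)) ≤ (1 / 2) ^ e := by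
  rw [pow_mul]
  have h1 : ((8 / 9 : ℝ) ^ 6) ^ (e + 1) ≤ (1 / 2) ^ (e + 1) :=
    pow_le_pow_left₀ (by norm_num) (by norm_num) _
  have h2 : (1 / 2 : ℝ) ^ (e + 1) = (1 / 2) ^ e * (1 / 2) := pow_succ _ _
  have h3 : (0 : ℝ) ≤ (1 / 2) ^ e := by positivity
  linarith

namespace Reduction

variable {τ : Task} {d : ℕ} {D : ℕ → ℕ} {s : Polynomial ℕ} (R : Reduction τ d D s)

theorem order_le (N : ℕ) : R.order N ≤ 2 * (2 * R.bound.eval N) ^ 2 := by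
  unfold order
  cases R.E <;> simp [Ensemble.medianOrder]

/-- A bound on the number of random bits. -/
noncomputable def bits (c : ℕ) : Polynomial ℕ :=
  (R.b + R.bound + Polynomial.C (c + 4)) *
    ((2 * R.rho + 1) * R.bound * 2 * (2 * (2 * (2 * R.bound) ^ 2) + 1))

/-- The random integer must have at least as many values as there are digit strings, and the number
of bits must be polynomial in N. -/
theorem pow_le_two_pow_bits {σ : ℝ} (hσ : 0 < σ) (i : Inst τ d D s)
    (hbound : i.len ≤ R.bound.eval (i.n ^ 2)) (hbound1 : 1 ≤ R.bound.eval (i.n ^ 2))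
    (hζ : |(R.zeta (R.b.eval (i.n ^ 2)) : ℝ) - σ * 2 ^ R.b.eval (i.n ^ 2)| ≤ 1) :
    (2 * R.radius (i.n ^ 2)) ^ ((2 * R.rho.eval (i.n ^ 2) + 1) * i.len * 2 *
      (2 * R.order (i.n ^ 2) + 1)) ≤ 2 ^ (R.bits ⌈σ⌉₊).eval (i.n ^ 2) := by
  set N := i.n ^ 2
  have h1 := R.E.radius_le (T := R.shift N) hbound1 (by positivity) hζ
  change (R.radius N : ℝ) ≤ _ at h1
  have h2 : R.radius N ≤ 4 * R.bound.eval N * ((⌈σ⌉₊ + 1) * 2 ^ R.b.eval N) := by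
    have h3 : σ * 2 ^ R.b.eval N + 1 ≤ (⌈σ⌉₊ + 1) * 2 ^ R.b.eval N := by
      have h4 := Nat.le_ceil σ
      have h5 : (1 : ℝ) ≤ 2 ^ R.b.eval N := one_le_pow₀ (by norm_num)
      have h6 : σ * 2 ^ R.b.eval N ≤ ⌈σ⌉₊ * 2 ^ R.b.eval N := by gcongr
      linarith
    have h7 : (R.radius N : ℝ) ≤ 4 * (R.bound.eval N : ℕ) * ((⌈σ⌉₊ + 1) * 2 ^ R.b.eval N) :=
      h1.trans (by gcongr)
    exact_mod_cast h7
  have h3 : 2 * R.radius N ≤ 2 ^ (R.b.eval N + R.bound.eval N + (⌈σ⌉₊ + 4)) := by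
    have h4 : R.bound.eval N ≤ 2 ^ R.bound.eval N := Nat.lt_two_pow_self.le
    have h5 : ⌈σ⌉₊ + 1 ≤ 2 ^ (⌈σ⌉₊ + 1) := Nat.lt_two_pow_self.le
    calc 2 * R.radius N ≤ 2 * (4 * 2 ^ R.bound.eval N * (2 ^ (⌈σ⌉₊ + 1) * 2 ^ R.b.eval N)) := by
          refine Nat.mul_le_mul_left _ (h2.trans ?_)
          gcongr
      _ = _ := by ring
  refine (Nat.pow_le_pow_left h3 _).trans ?_
  rw [← pow_mul]
  refine Nat.pow_le_pow_right (by norm_num) ?_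
  have h4 := R.order_le N
  simp only [bits, Polynomial.eval_mul, Polynomial.eval_add, Polynomial.eval_C,
    Polynomial.eval_pow, Polynomial.eval_one, Polynomial.eval_ofNat]
  gcongr

/-- The reduction succeeds with high probability. -/
theorem le_ncard_accurate {p q e : Polynomial ℕ} {σ : ℝ} (hσ : 0 < σ) (i : Inst τ d D s)
    (hrho : R.rho.eval (i.n ^ 2) = 6 * (e.eval (i.n ^ 2) + 1))
    (hX : ∀ x, Bounded (s.eval (i.n ^ 2)) (i.data x))
    (hb : s.eval (i.n ^ 2) + R.a.eval (i.n ^ 2) ≤ R.b.eval (i.n ^ 2))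
    (hp : R.g.eval (i.n ^ 2) ≤ p.eval (i.n ^ 2))
    (hg : 2 * i.n ^ 2 + 2 * i.n ^ 2 * R.a.eval (i.n ^ 2) + q.eval (i.n ^ 2) + 1 ≤
      R.g.eval (i.n ^ 2))
    (hbound : i.len ≤ R.bound.eval (i.n ^ 2)) (hbound1 : 1 ≤ R.bound.eval (i.n ^ 2))
    (hζ : |(R.zeta (R.b.eval (i.n ^ 2)) : ℝ) - σ * 2 ^ R.b.eval (i.n ^ 2)| ≤ 1)
    (hS : 3200 * ((R.bound.eval (i.n ^ 2) : ℕ) : ℝ) ^ 3 * R.shift (i.n ^ 2) ≤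
      σ * 2 ^ R.b.eval (i.n ^ 2))
    (hgood : 1 - 1 / (12 * ((i.n ^ 2 : ℕ) : ℝ)) ≤ (R.E.dataLaw σ i.n (D (i.n ^ 2)) d).real
      {W | R.Good p ⟨i.n, i.pos, fun x => round (R.b.eval (i.n ^ 2)) (W x), i.obs⟩}) :
    1 - (1 / 2 : ℝ) ^ e.eval (i.n ^ 2) ≤
      (Set.ncard {r : Fin (2 ^ (R.bits ⌈σ⌉₊).eval (i.n ^ 2)) |
        Accurate τ (s.eval (i.n ^ 2)) (q.eval (i.n ^ 2)) i.data i.obs (R.result i r)} : ℝ) /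
        2 ^ (R.bits ⌈σ⌉₊).eval (i.n ^ 2) := by
  classical
  have hT1 : 1 ≤ R.shift (i.n ^ 2) := Nat.one_le_iff_ne_zero.2 (by
    have : 1 ≤ i.n := i.pos
    unfold shift; positivity)
  have hA : 0 < R.radius (i.n ^ 2) := (R.E.domination hσ hbound1 hT1 hS hζ).1
  have key := R.card_not_majority_le i hA (R.pow_le_two_pow_bits hσ i hbound hbound1 hζ)
    (R.card_bad_le (p := p) hσ i hX hb hbound hbound1 hζ hS hgood)
  set c := (R.bits ⌈σ⌉₊).eval (i.n ^ 2)
  set bad : Fin (2 ^ c) → Prop := fun r => R.rho.eval (i.n ^ 2) <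
    (Finset.univ.filter fun l : Fin (2 * R.rho.eval (i.n ^ 2) + 1) =>
      ∃ j < 2 * i.n ^ 2 + 1, ¬ R.Good p (R.query i r l j)).card
  have hsub : ∀ r, ¬ bad r →
      Accurate τ (s.eval (i.n ^ 2)) (q.eval (i.n ^ 2)) i.data i.obs (R.result i r) := by
    intro r hr
    refine R.accurate_result i hb hp hg (B := (Finset.univ.filter fun
      l : Fin (2 * R.rho.eval (i.n ^ 2) + 1) =>
        ∃ j < 2 * i.n ^ 2 + 1, ¬ R.Good p (R.query i r l j)).map Fin.valEmbedding)
      (by rw [Finset.card_map]; exact not_lt.1 hr) fun l hl hlB j hj => ?_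
    by_contra hbadj
    exact hlB (Finset.mem_map.2 ⟨⟨l, hl⟩, Finset.mem_filter.2 ⟨Finset.mem_univ _, j,
      Nat.lt_succ_of_le hj, hbadj⟩, rfl⟩)
  have hcount : 2 ^ c - (Finset.univ.filter bad).card ≤ Set.ncard {r : Fin (2 ^ c) |
      Accurate τ (s.eval (i.n ^ 2)) (q.eval (i.n ^ 2)) i.data i.obs (R.result i r)} := by
    have h1 : (Finset.univ.filter fun r => ¬ bad r).card = 2 ^ c -
        (Finset.univ.filter bad).card := by
      have := Finset.card_filter_add_card_filter_not (s := (Finset.univ : Finset (Fin (2 ^ c)))) bad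
      rw [Finset.card_univ, Fintype.card_fin] at this
      omega
    rw [← h1, ← Set.ncard_coe_finset]
    refine Set.ncard_le_ncard (fun r hr => hsub r ?_) (Set.toFinite _)
    simpa using hr
  have hcount' : (2 : ℝ) ^ c ≤ (Set.ncard {r : Fin (2 ^ c) | Accurate τ (s.eval (i.n ^ 2))
      (q.eval (i.n ^ 2)) i.data i.obs (R.result i r)} : ℝ) + (Finset.univ.filter bad).card := by
    exact_mod_cast (by omega : 2 ^ c ≤ Set.ncard {r : Fin (2 ^ c) | Accurate τ (s.eval (i.n ^ 2))
      (q.eval (i.n ^ 2)) i.data i.obs (R.result i r)} + (Finset.univ.filter bad).card)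
  have hle := eight_ninths_pow_le (e.eval (i.n ^ 2))
  have key' : ((Finset.univ.filter bad).card : ℝ) ≤
      4 / 3 * (8 / 9) ^ R.rho.eval (i.n ^ 2) * 2 ^ c := by convert key
  rw [← hrho] at hle
  have h2c : (0 : ℝ) < 2 ^ c := by positivity
  have hle' := mul_le_mul_of_nonneg_right hle h2c.le
  rw [le_div_iff₀ h2c, sub_mul, one_mul]
  linarith [key'.trans hle']

end Reduction

end PEPS

/-! ### Choice of the parameters and conclusion. -/

theorem theorem2 (τ : PEPS.Task) (E : PEPS.Ensemble)
    (σ : ℝ) (hσ : 0 < σ) (hσc : PEPS.PolyTimeReal σ)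
    (d : ℕ) (hd : 1 ≤ d) (D : ℕ → ℕ) (hD : ∀ N, 1 ≤ D N)
    (hDpoly : ∃ B : Polynomial ℕ, ∀ N, D N ≤ B.eval N)
    (s q : Polynomial ℕ) :
    ∃ p₀ b₀ : Polynomial ℕ, ∀ p b : Polynomial ℕ,
      (∀ N : ℕ, p₀.eval N ≤ p.eval N) → (∀ N : ℕ, b₀.eval N ≤ b.eval N) →
      (∃ O : PEPS.Prog, PEPS.SolvesOnAverage τ E σ d D s b p O) →
      ∀ e : Polynomial ℕ, ∃ Q : PEPS.Prog, PEPS.SolvesAllInstances τ d D s q e Q := by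
  obtain ⟨B, hB⟩ := hDpoly
  obtain ⟨Pz, Tz, hz⟩ := hσc
  choose zeta tz hrun htz hzeta using hz
  let bound : Polynomial ℕ := Polynomial.X * (B * (B * (B * (B * Polynomial.C d))))
  -- Chosen so that σ 2^U ≥ σ U ≥ 6400 I³ N. With a = s + U the maximal shift is 2N · 2^(b - U) grid
  -- units, and 3200 I³ times this is at most σ 2^b, as `Ensemble.domination` requires.
  let U : Polynomial ℕ := Polynomial.C (6400 * ⌈1 / σ⌉₊) * bound ^ 3 * Polynomial.X
  let a : Polynomial ℕ := s + U
  -- The bits lost are 2N in the finite difference, 2N a in the division by δ^(2N), and one for the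
  -- two errors of each answer; q bits remain.
  let g : Polynomial ℕ := 2 * Polynomial.X + 2 * Polynomial.X * a + q + 1
  refine ⟨g, s + a, fun p b hp hb hex e => ?_⟩
  obtain ⟨O, ⟨TO, hO⟩, hgood⟩ := hex
  choose out tO hrunO htO using fun i : PEPS.Inst τ d D s => hO i.n i.pos i.data i.obs
  let R : PEPS.Reduction τ d D s := ⟨E, a, b, g, 6 * (e + 1), bound, zeta, out⟩
  have hζ : PEPS.PT (fun m : ℕ => PEPS.Val.int (2 ^ m)) fun m => PEPS.Val.int (R.zeta m) := by
    refine ⟨Pz, Tz, fun m => ⟨tz m, hrun m, (htz m).trans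
      (PEPS.polynomial_eval_mono Tz ?_)⟩⟩
    rw [PEPS.Val.size, Int.natAbs_pow]
    change m ≤ Nat.size (2 ^ m) + 1
    rw [Nat.size_pow]
    omega
  have hOut : PEPS.PT (fun i : PEPS.Inst τ d D s => i.code R.b) R.out :=
    ⟨O, TO, fun i => ⟨tO i, hrunO i, htO i⟩⟩
  obtain ⟨Q, T, hQ⟩ := R.pt_result hd hD hζ hOut
  choose tQ hrunQ htQ using hQ
  -- The time bound may refer to the instance only, so the size of the random integer is bounded by
  -- its number of bits, a polynomial in N and hence in the size of the instance.
  refine ⟨Q, R.bits ⌈σ⌉₊, T.comp (Polynomial.X + R.bits ⌈σ⌉₊ + 2), fun n hn X hX A => ?_⟩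
  set i : PEPS.Inst τ d D s := ⟨n, hn, X, A⟩ with hi
  have hrunR : ∀ r : ℕ, Q.Runs (.pair (PEPS.encode τ (s.eval (n ^ 2)) X A) (.int r))
      (R.result i r) (tQ (i, r)) := fun r => hrunQ (i, r)
  refine ⟨fun r => ⟨_, _, hrunR r, ?_⟩, ?_⟩
  · refine (htQ (i, r)).trans ?_
    rw [Polynomial.eval_comp]
    refine PEPS.polynomial_eval_mono T ?_
    simp only [Polynomial.eval_add, Polynomial.eval_X, Polynomial.eval_ofNat]
    have h1 : (PEPS.Val.int ((r : ℕ) : ℤ)).size ≤ (R.bits ⌈σ⌉₊).eval (n ^ 2) + 1 := by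
      rw [PEPS.size_int_le_iff]
      simp
    have h2 : n ^ 2 ≤ (i.code s).size := (i.sq_le_len hd hD).trans (i.len_le_size s)
    have h3 := PEPS.polynomial_eval_mono (R.bits ⌈σ⌉₊) h2
    simp only at h3
    change (i.code s).size + (PEPS.Val.int ((r : ℕ) : ℤ)).size + 1 ≤ (i.code s).size +
      (R.bits ⌈σ⌉₊).eval (i.code s).size + 2
    omega
  · have hN1 : 1 ≤ n ^ 2 := Nat.one_le_pow _ _ hn
    have hboundN : bound.eval (n ^ 2) = n ^ 2 * (B.eval (n ^ 2) * (B.eval (n ^ 2) *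
        (B.eval (n ^ 2) * (B.eval (n ^ 2) * d)))) := by
      simp [bound]
    have hlen : i.len ≤ bound.eval (n ^ 2) := by
      rw [PEPS.Inst.len_eq, hboundN, ← mul_assoc i.n, ← sq]
      have := hB (n ^ 2)
      simp only [hi]
      gcongr
    have hbound1 : 1 ≤ bound.eval (n ^ 2) := le_trans hN1 ((i.sq_le_len hd hD).trans hlen)
    have hbN := hb (n ^ 2)
    have haN : a.eval (n ^ 2) = s.eval (n ^ 2) + U.eval (n ^ 2) := by simp [a]
    rw [Polynomial.eval_add] at hbN
    have hS : 3200 * ((bound.eval (n ^ 2) : ℕ) : ℝ) ^ 3 * R.shift (n ^ 2) ≤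
        σ * 2 ^ b.eval (n ^ 2) := by
      have h1 : (2 : ℝ) ^ b.eval (n ^ 2) = 2 ^ U.eval (n ^ 2) *
          2 ^ (b.eval (n ^ 2) + s.eval (n ^ 2) - a.eval (n ^ 2)) := by
        rw [← pow_add]; congr 1; omega
      have h2 : ((U.eval (n ^ 2) : ℕ) : ℝ) ≤ 2 ^ U.eval (n ^ 2) := by
        exact_mod_cast (Nat.lt_two_pow_self (n := U.eval (n ^ 2))).le
      have h3 : ((U.eval (n ^ 2) : ℕ) : ℝ) = 6400 * ⌈1 / σ⌉₊ *
          ((bound.eval (n ^ 2) : ℕ) : ℝ) ^ 3 * ((n ^ 2 : ℕ) : ℝ) := by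
        simp [U]
      have h4 : 1 ≤ σ * ⌈1 / σ⌉₊ := by
        have := Nat.le_ceil (1 / σ)
        rwa [div_le_iff₀ hσ, mul_comm] at this
      have h5 : (R.shift (n ^ 2) : ℝ) = 2 * ((n ^ 2 : ℕ) : ℝ) *
          2 ^ (b.eval (n ^ 2) + s.eval (n ^ 2) - a.eval (n ^ 2)) := by
        simp [PEPS.Reduction.shift, R]
      rw [h1, h5]
      generalize (2 : ℝ) ^ U.eval (n ^ 2) = u at *
      have h6 : (0 : ℝ) ≤ 2 ^ (b.eval (n ^ 2) + s.eval (n ^ 2) - a.eval (n ^ 2)) := by positivity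
      have h7 : 6400 * ((bound.eval (n ^ 2) : ℕ) : ℝ) ^ 3 * ((n ^ 2 : ℕ) : ℝ) ≤ σ * u := by
        have h8 : (0 : ℝ) ≤ 6400 * ((bound.eval (n ^ 2) : ℕ) : ℝ) ^ 3 * ((n ^ 2 : ℕ) : ℝ) := by
          positivity
        rw [h3] at h2
        nlinarith [mul_le_mul_of_nonneg_left h2 hσ.le, mul_le_mul_of_nonneg_right h4 h8]
      nlinarith [mul_le_mul_of_nonneg_right h7 h6]
    have hfin := R.le_ncard_accurate (p := p) (q := q) (e := e) hσ i (by simp [R]) hX hbN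
      (hp (n ^ 2)) (by simp [R, g, hi]) hlen hbound1 (hzeta _) hS ?_
    · refine hfin.trans ?_
      exact div_le_div_of_nonneg_right (Nat.cast_le.2 (Set.ncard_le_ncard
        (fun r hr => ⟨_, _, hrunR r, hr⟩) (Set.toFinite _))) (by positivity)
    · refine (hgood n hn A).trans ?_
      have := E.isProbabilityMeasure_law hσ
      have hP : MeasureTheory.IsProbabilityMeasure (E.dataLaw σ n (D (n ^ 2)) d) := by
        unfold PEPS.Ensemble.dataLaw; infer_instance
      refine MeasureTheory.measureReal_mono fun W hW => ?_
      obtain ⟨y, t, hy, hacc⟩ := hW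
      -- The average-case hypothesis speaks of some output of `O`; determinism identifies it with
      -- the chosen output.
      have := (hrunO ⟨n, hn, fun x => PEPS.round (b.eval (n ^ 2)) (W x), A⟩).det hy
      change PEPS.Accurate τ _ _ _ _ (out _)
      rw [this]
      exact hacc
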